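/- **Theorem.** Let $\beta>0$, let $(\mu_n)$ be a sequence of nonnegative reals with $\mu_n/n\to\alpha$, and let $\sigma\ge 0$ (if $\alpha=0$, any $\sigma\in\mathbb R$ is allowed). *Ensemble.* Let $\mathbb P_{n,\mu}$ be the probability measure on $\mathbb R^n$ with density proportional to $$\prod_{i=1}^n|\lambda_i|^{\beta\mu}\,e^{-\frac\beta2\sum_i\lambda_i^2}\prod_{i<j}|\lambda_i-\lambda_j|^\beta ,$$ that is, the joint eigenvalue law of the generalized Gaussian ensemble with Dyson index $\beta$ (for $\beta=1,2,4$ the eigenvalue law of the real symmetric, complex Hermitian, quaternionic Hermitian matrix ensemble with density $\propto|\det X|^{\beta\mu}e^{-\frac\beta2\langle X,X\rangle}$). Let $\mathbb P^\sigma_n$ be $\mathbb P_{n,\mu_n}$ conditioned on $\{\lambda_i\ge\sigma\sqrt n \text{ for all } i\}$, and let $\nu^\sigma_n=\mathbb E^\sigma_n\big[\frac1n\sum_{i=1}^n\delta_{\lambda_i}\big]$ be the mean empirical eigenvalue measure under $\mathbb P^\sigma_n$. *Endpoints.* Put $$\varphi_\alpha(x,a)=x+a-\frac{2\alpha}{\sqrt{ax}},\qquad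 \psi_\alpha(x,a)=\tfrac34(x-a)^2+a(x-a)+2\alpha\frac{\sqrt a}{\sqrt x}-2\alpha-2$$ (for $\alpha=0$ the terms containing $\alpha$ are absent), and let $E_\alpha$ be the set of $a$ ($a>0$ if $\alpha>0$, $a\in\mathbb R$ if $\alpha=0$) for which some $x>a$ satisfies $\varphi_\alpha(x,a)\ge0$ and $\psi_\alpha(x,a)=0$. Then there is exactly one pair $(a,b)$ such that $E_\alpha$ has a least element $a_c$, $a=\max(\sigma,a_c)$, $b>a$, $\varphi_\alpha(b,a)\ge0$ and $\psi_\alpha(b,a)=0$. For this pair, the function $$f_{\alpha,\sigma}(x)=\frac1{2\pi}\sqrt{\frac{b-x}{x-a}}\Big(2x+b-a-2\alpha\sqrt{\tfrac ab}\,\frac1x\Big),\qquad a<x\le b,$$ (the last term being absent for $\alpha=0$) is nonnegative and is the density of a probability measure $\nu^\sigma_\alpha$ with support $[a,b]$. The measure $\nu^\sigma_\alpha$ is the unique equilibrium measure for the field $Q_\alpha(x)=x^2+2\alpha\log\frac1x$ on $[\sigma,\infty)$, i.e. the unique minimizer of $$E(\nu)=\iint\Big(\log\frac1{|x-y|}+\tfrac12Q_\alpha(x)+\tfrac12Q_\alpha(y)\Big)\nu(dx)\nu(dy)$$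 among all probability measures $\nu$ on $[\sigma,\infty)$ (for $\alpha=0$, $Q_0(x)=x^2$; for $\alpha>0$, $Q_\alpha(0)=+\infty$). Moreover $\nu^\sigma_n$, rescaled by $1/\sqrt n$, converges to $\nu^\sigma_\alpha$ in the tight topology: for every bounded continuous $\varphi:\mathbb R\to\mathbb R$, $$\lim_{n\to\infty}\int\varphi\Big(\frac x{\sqrt n}\Big)\,\nu^\sigma_n(dx)=\int\varphi(x)\,\nu^\sigma_\alpha(dx).$$ -/

import Mathlib

open MeasureTheory Filter Topology

noncomputable section

/-- The Vandermonde product `∏_{i<j} |λ_i - λ_j|`. -/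
def absVandermonde (n : ℕ) (x : Fin n → ℝ) : ℝ :=
  ∏ i : Fin n, ∏ j ∈ Finset.Ioi i, |x i - x j|

/-- The unnormalised joint eigenvalue density of the generalized Gaussian ensemble
`∏ |λ_i|^(β m) * exp (-(β/2) ∑ λ_i^2) * |Δ(λ)|^β`. -/
def eigenvalueWeight (β m : ℝ) (n : ℕ) (x : Fin n → ℝ) : ℝ :=
  (∏ i, |x i| ^ (β * m)) * Real.exp (-(β / 2) * ∑ i, x i ^ 2) * absVandermonde n x ^ β

/-- The joint eigenvalue law of the generalized Gaussian ensemble: the eigenvalue density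
with respect to Lebesgue measure on `ℝ^n`, divided by its total mass `C_n`. -/
def eigenvalueLaw (β m : ℝ) (n : ℕ) : Measure (Fin n → ℝ) :=
  (∫⁻ x : Fin n → ℝ, ENNReal.ofReal (eigenvalueWeight β m n x))⁻¹ •
    (volume : Measure (Fin n → ℝ)).withDensity
      (fun x => ENNReal.ofReal (eigenvalueWeight β m n x))

/-- The eigenvalue law conditioned on all the eigenvalues being at least `s`. -/
def restrictedLaw (β m s : ℝ) (n : ℕ) : Measure (Fin n → ℝ) :=
  ProbabilityTheory.cond (eigenvalueLaw β m n) {x | ∀ i, s ≤ x i}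

/-- The mean empirical measure `E[(1/n) ∑ δ_{λ_i}]` under the restricted law, i.e. the
average of the one-coordinate marginals. -/
def meanEmpirical (β m s : ℝ) (n : ℕ) : Measure ℝ :=
  (n : ENNReal)⁻¹ • ∑ i : Fin n, (restrictedLaw β m s n).map (fun x => x i)

/-- The external field `Q_α(x) = x^2 + 2 α log (1/x)`, with value `+∞` at `x ≤ 0` when
`0 < α`, and `Q_0(x) = x^2` on the whole line. -/
def externalField (α x : ℝ) : EReal :=
  ((x ^ 2 : ℝ) : EReal) + ((2 * α : ℝ) : EReal) * (-(ENNReal.log (ENNReal.ofReal x)))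

/-- The symmetrised kernel `log (1/|x-y|) + Q(x)/2 + Q(y)/2`; it is `+∞` on the diagonal. -/
def energyKernel (Q : ℝ → EReal) (x y : ℝ) : EReal :=
  -(ENNReal.log (ENNReal.ofReal |x - y|)) + ((1 / 2 : ℝ) : EReal) * (Q x + Q y)

/-- The energy `∫∫ log (1/|x-y|) ν(dx) ν(dy) + ∫ Q dν`, written as the integral of the
symmetrised kernel (positive part minus negative part), an extended real number. -/
def logEnergy (Q : ℝ → EReal) (ν : Measure ℝ) : EReal :=
  ((∫⁻ z, (energyKernel Q z.1 z.2).toENNReal ∂(ν.prod ν) : ENNReal) : EReal) -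
    ((∫⁻ z, (-(energyKernel Q z.1 z.2)).toENNReal ∂(ν.prod ν) : ENNReal) : EReal)

/-- `ν` is an equilibrium measure of `(S, Q)`: it minimises the energy among the probability
measures carried by `S`. -/
def IsEquilibriumMeasure (S : Set ℝ) (Q : ℝ → EReal) (ν : Measure ℝ) : Prop :=
  IsProbabilityMeasure ν ∧ ν Sᶜ = 0 ∧
    ∀ ρ : Measure ℝ, IsProbabilityMeasure ρ → ρ Sᶜ = 0 → logEnergy Q ν ≤ logEnergy Q ρ

/-- `φ_α(x, a) = x + a - 2 α / √(a x)`. -/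
def phiFun (α x a : ℝ) : ℝ := x + a - 2 * α / √(a * x)

/-- `ψ_α(x, a) = (3/4)(x-a)^2 + a(x-a) + 2 α √a / √x - 2 α - 2`. -/
def psiFun (α x a : ℝ) : ℝ :=
  3 / 4 * (x - a) ^ 2 + a * (x - a) + 2 * α * (√a / √x) - 2 * α - 2

/-- The set `E_α` of admissible left endpoints, a subset of `]0, ∞[` when `0 < α` and of `ℝ`
when `α = 0`. -/
def admissibleLeft (α : ℝ) : Set ℝ :=
  {a | (0 < α → 0 < a) ∧ ∃ x, a < x ∧ 0 ≤ phiFun α x a ∧ psiFun α x a = 0}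

/-- `(a, b)` are the endpoints of the limiting spectrum: `a = max (σ, a_c)` where
`a_c = min E_α`, and `b > a` solves `φ_α(b, a) ≥ 0`, `ψ_α(b, a) = 0`. -/
def IsEndpoints (α σ a b : ℝ) : Prop :=
  (∃ ac, IsLeast (admissibleLeft α) ac ∧ a = max σ ac) ∧
    a < b ∧ 0 ≤ phiFun α b a ∧ psiFun α b a = 0

/-- The density
`(1/2π) √((b-x)/(x-a)) (2x + b - a - 2α √(a/b) / x)`.
(If `φ_α(b, a) = 0` it equals `(1/π) √((b-x)(x-a)) (1 + α / (√(ab) x))`.) -/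
def limitDensity (α a b x : ℝ) : ℝ :=
  1 / (2 * Real.pi) * √((b - x) / (x - a)) *
    (2 * x + b - a - 2 * α * √(a / b) * (1 / x))

/-- The measure on `]a, b]` with density `limitDensity α a b`. -/
def limitLaw (α a b : ℝ) : Measure ℝ :=
  (volume.restrict (Set.Ioc a b)).withDensity
    (fun x => ENNReal.ofReal (limitDensity α a b x))

end

/-! ### Endpoints of the limiting spectrum -/

/-! The proof has an explicit half, which shows that `limitLaw` satisfies the Euler-Lagrange
conditions, and a general half, which draws minimality, uniqueness and convergence from those
conditions.

Explicit half. Write `ω_s` for the arcsine law on `[a, s]`. Its potential `∫ log|x - y| ω_s(dy)` is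
constant on `[a, s]` and has derivative `1 / √((t - a)(t - s))` at `t > s`. For a signed mixture
`∫_a^b q(s) ω_s ds` with potential `U`, the condition `2U' = Q'` on `(a, b)` is therefore the Abel
equation `∫_a^t q(s) / √(t - s) ds = √(t - a) (t - α / t)`, which `mixingDensity` solves;
integrating out `s` gives `limitDensity`. Since `q = ∂_x ψ / 2` and `ψ(a, a) = -2`, total mass one
is the equation `ψ(b, a) = 0`. The last factor of the density equals `φ(b, a)` at `x = a` and
increases, so `φ(b, a) ≥ 0` is positivity. It also makes `q ≥ 0` beyond `b`, so that `Q - 2U` does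
not fall below its constant value there (`effectivePotential_eq`, `effectivePotential_ge`). To the
left of `a` a condition arises only if `σ < a`; then `a = a_c`, `φ(b, a) = 0`, and `Q - 2U`
decreases towards `a`. Existence and uniqueness of the endpoints come from `∂_a ψ = -φ / 2`, from
the growth of `ψ` in `x` where `φ ≥ 0`, and from the explicit solution of `φ = ψ = 0`, which gives
`a_c`.

General half. By Frullani, `-log|u|` is an integral over `t > 0` of Gaussian kernels `exp(-t u²)`
minus a constant. Stopping at `t = T` gives the kernel `regLog T`, finite on the diagonal. Gaussian
kernels are positive definite, so the regularised energy `regDist T ρ ν` of a difference of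
probability measures is nonnegative, and it is bounded below by a positive constant when a fixed
test function separates `ρ` from `ν`. Expanding the energy around an extremal `ν` gives, for `ρ` of
finite energy, `E(ρ) ≥ E_min + regDist T ρ ν - o(1)` as `T → ∞`, hence minimality and uniqueness.

The same expansion applies to the Hamiltonian of `n` points, because the self-interaction in `regLog
T` costs at most `T / (2n)` after division by `n²`. Configurations whose empirical measure is
separated from `ν` thus have weight at most `exp(-(β/2) n² (E_min + c - o(1)))`, while Jensen's
inequality under `ν^n` bounds the partition function below by `exp(-(β/2) n² (E_min + o(1)))`. With
`T = √n` all errors vanish, and the separated configurations have probability tending to `0`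
(`IsExtremal.tendsto_restrictedLaw_far`). Test functions of compact support suffice, since the limit
has compact support and mass one. -/

lemma two_mul_le_of_phiFun_nonneg {α x a : ℝ} (ha : 0 < a) (hx : 0 < x) (h : 0 ≤ phiFun α x a) :
    2 * α ≤ (x + a) * (√a * √x) := by
  unfold phiFun at h
  rw [Real.sqrt_mul ha.le] at h
  have : 0 < √a * √x := by positivity
  have h2 : 2 * α / (√a * √x) ≤ x + a := by linarith
  rwa [div_le_iff₀ this] at h2

/-- The derivative of `ψ` in `a` is `-φ / 2`, and `φ` increases with `a`; so `ψ` keeps decreasing to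
the right of a point where `φ ≥ 0`. Taking square roots as variables reduces this to polynomial
inequalities. -/
lemma psiFun_le_psiFun_left {α x a a' : ℝ} (hα : 0 ≤ α) (hdom : 0 < α → 0 < a) (haa : a ≤ a')
    (hx : a < x) (h : 0 ≤ phiFun α x a) : psiFun α x a' ≤ psiFun α x a := by
  rcases hα.eq_or_lt with rfl | hα
  · simp only [phiFun, psiFun, mul_zero, zero_mul, zero_div] at *
    nlinarith [mul_nonneg (sub_nonneg.2 haa) h, mul_nonneg (sub_nonneg.2 haa) (sub_nonneg.2 haa)]
  · have ha := hdom hα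
    have hx0 : 0 < x := ha.trans hx
    have h2 := two_mul_le_of_phiFun_nonneg ha hx0 h
    obtain ⟨v, hv, rfl⟩ : ∃ v, 0 < v ∧ a = v ^ 2 := ⟨√a, by positivity, (Real.sq_sqrt ha.le).symm⟩
    obtain ⟨w, hw, rfl⟩ : ∃ v, 0 < v ∧ a' = v ^ 2 :=
      ⟨√a', Real.sqrt_pos.2 (ha.trans_le haa), (Real.sq_sqrt (ha.le.trans haa)).symm⟩
    obtain ⟨u, hu, rfl⟩ : ∃ v, 0 < v ∧ x = v ^ 2 := ⟨√x, by positivity, (Real.sq_sqrt hx0.le).symm⟩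
    unfold psiFun
    rw [Real.sqrt_sq hu.le, Real.sqrt_sq hv.le] at *
    rw [Real.sqrt_sq hw.le]
    have hvw : v ≤ w := by nlinarith
    have h3 : 2 * α * (w / u) - 2 * α * (v / u) ≤ (u ^ 2 + v ^ 2) * v * (w - v) := by
      have : 2 * α * (w / u) - 2 * α * (v / u) = (2 * α) * ((w - v) / u) := by ring
      rw [this]
      calc (2 * α) * ((w - v) / u) ≤ ((u ^ 2 + v ^ 2) * (v * u)) * ((w - v) / u) :=
            mul_le_mul_of_nonneg_right h2 (div_nonneg (by linarith) hu.le)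
        _ = _ := by field_simp
    have h4 : (u ^ 2 + v ^ 2) * v ≤ (w + v) * (u ^ 2 / 2 + (w ^ 2 + v ^ 2) / 4) := by
      nlinarith [mul_nonneg (sub_nonneg.2 hvw) (sq_nonneg u), mul_pos hv hw, pow_pos hv 3,
        mul_nonneg (sub_nonneg.2 hvw) (sq_nonneg v), mul_nonneg (sub_nonneg.2 hvw) (sq_nonneg w),
        mul_nonneg hv.le (sub_nonneg.2 haa)]
    nlinarith [mul_le_mul_of_nonneg_right h4 (sub_nonneg.2 hvw)]

/-- For `a ≤ x` and `φ ≥ 0`, the term `α √a x^(-3/2)` of the derivative in `x` is at most `a (x + a)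
/ (2x) ≤ a`. This leaves a derivative of at least `3 (x - a) / 2`, and `φ ≥ 0` persists as `x`
grows. -/
lemma psiFun_lt_psiFun_right {α x x' a : ℝ} (hα : 0 ≤ α) (hdom : 0 < α → 0 < a) (hx : a ≤ x)
    (hxx : x < x') (h : 0 ≤ phiFun α x a) : psiFun α x a < psiFun α x' a := by
  rcases hα.eq_or_lt with rfl | hα
  · simp only [phiFun, psiFun, mul_zero, zero_mul, zero_div] at *
    have : 0 ≤ x := by linarith
    nlinarith [mul_pos (sub_pos.2 hxx) (sub_pos.2 hxx), mul_nonneg (sub_pos.2 hxx).le this]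
  · have ha := hdom hα
    have hx0 : 0 < x := ha.trans_le hx
    have h2 := two_mul_le_of_phiFun_nonneg ha hx0 h
    obtain ⟨v, hv, rfl⟩ : ∃ v, 0 < v ∧ a = v ^ 2 := ⟨√a, by positivity, (Real.sq_sqrt ha.le).symm⟩
    obtain ⟨w, hw, rfl⟩ : ∃ v, 0 < v ∧ x' = v ^ 2 :=
      ⟨√x', Real.sqrt_pos.2 (hx0.trans hxx), (Real.sq_sqrt (hx0.trans hxx).le).symm⟩
    obtain ⟨u, hu, rfl⟩ : ∃ v, 0 < v ∧ x = v ^ 2 := ⟨√x, by positivity, (Real.sq_sqrt hx0.le).symm⟩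
    unfold psiFun
    rw [Real.sqrt_sq hu.le, Real.sqrt_sq hv.le] at *
    rw [Real.sqrt_sq hw.le]
    have huw : u < w := by nlinarith
    have h3 : 2 * α * (v / u) - 2 * α * (v / w) ≤ (u ^ 2 + v ^ 2) * v ^ 2 * (w - u) / w := by
      have : 2 * α * (v / u) - 2 * α * (v / w) = (2 * α) * (v * (w - u) / (u * w)) := by
        field_simp
      rw [this]
      calc (2 * α) * (v * (w - u) / (u * w))
          ≤ ((u ^ 2 + v ^ 2) * (v * u)) * (v * (w - u) / (u * w)) :=
            mul_le_mul_of_nonneg_right h2 (div_nonneg (mul_nonneg hv.le (by linarith)) (by positivity))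
        _ = _ := by field_simp
    have h4 : (u ^ 2 + v ^ 2) * v ^ 2 / w < (w + u) * (3 / 4 * (w ^ 2 + u ^ 2) - v ^ 2 / 2) := by
      rw [div_lt_iff₀ hw]
      have e1 : (u ^ 2 + v ^ 2) * v ^ 2 ≤ (2 * u ^ 2) * u ^ 2 :=
        mul_le_mul (by linarith) hx (by positivity) (by positivity)
      have e2 : 2 * u ^ 2 < (w + u) * w := by nlinarith
      have e3 : u ^ 2 ≤ 3 / 4 * (w ^ 2 + u ^ 2) - v ^ 2 / 2 := by nlinarith
      calc _ ≤ (2 * u ^ 2) * u ^ 2 := e1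
        _ < ((w + u) * w) * u ^ 2 := mul_lt_mul_of_pos_right e2 (by positivity)
        _ ≤ ((w + u) * w) * (3 / 4 * (w ^ 2 + u ^ 2) - v ^ 2 / 2) :=
            mul_le_mul_of_nonneg_left e3 (by positivity)
        _ = _ := by ring
    have h5 := mul_lt_mul_of_pos_right h4 (sub_pos.2 huw)
    have h6 : (u ^ 2 + v ^ 2) * v ^ 2 / w * (w - u) = (u ^ 2 + v ^ 2) * v ^ 2 * (w - u) / w := by
      ring
    nlinarith

lemma phiFun_lt_phiFun_left {α x a a' : ℝ} (hα : 0 ≤ α) (hdom : 0 < α → 0 < a ∧ 0 < x)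
    (haa : a < a') : phiFun α x a < phiFun α x a' := by
  unfold phiFun
  rcases hα.eq_or_lt with rfl | hα
  · simp; linarith
  · obtain ⟨ha, hx⟩ := hdom hα
    have : 2 * α / √(a' * x) ≤ 2 * α / √(a * x) := by
      apply div_le_div_of_nonneg_left (by positivity) (by positivity)
      exact Real.sqrt_le_sqrt (by nlinarith)
    linarith

lemma phiFun_lt_phiFun_right {α x x' a : ℝ} (hα : 0 ≤ α) (hdom : 0 < α → 0 < a ∧ 0 < x)
    (hxx : x < x') : phiFun α x a < phiFun α x' a := by
  unfold phiFun
  rcases hα.eq_or_lt with rfl | hα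
  · simp; linarith
  · obtain ⟨ha, hx⟩ := hdom hα
    have : 2 * α / √(a * x') ≤ 2 * α / √(a * x) := by
      apply div_le_div_of_nonneg_left (by positivity) (by positivity)
      exact Real.sqrt_le_sqrt (by nlinarith)
    linarith

lemma right_endpoint_unique {α x x' a : ℝ} (hα : 0 ≤ α) (hdom : 0 < α → 0 < a) (hx : a < x)
    (hx' : a < x') (h : 0 ≤ phiFun α x a) (h' : 0 ≤ phiFun α x' a) (hψ : psiFun α x a = 0)
    (hψ' : psiFun α x' a = 0) : x = x' := by
  rcases lt_trichotomy x x' with hlt | heq | hlt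
  · have := psiFun_lt_psiFun_right hα hdom hx.le hlt h; linarith
  · exact heq
  · have := psiFun_lt_psiFun_right hα hdom hx'.le hlt h'; linarith

/-- The common zero of `φ` and `ψ` is the edge of the unconstrained spectrum; it turns out to be
`a_c` with its right endpoint. -/
lemma exists_soft_edge (α : ℝ) (hα : 0 ≤ α) : ∃ ac xc : ℝ, (0 < α → 0 < ac) ∧ ac < xc ∧
    phiFun α xc ac = 0 ∧ psiFun α xc ac = 0 := by
  rcases hα.eq_or_lt with rfl | hα
  · refine ⟨-√2, √2, by simp, by linarith [Real.sqrt_pos.2 (two_pos : (0:ℝ) < 2)], ?_, ?_⟩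
    · simp [phiFun]
    · simp only [psiFun, mul_zero, zero_mul]
      nlinarith [Real.sq_sqrt (zero_le_two : (0:ℝ) ≤ 2)]
  -- In terms of `s = x + a` and `p = √(a x)`, `φ = 0` reads `p s = 2α`. Then `ψ = 0` becomes `3/4
  -- s² - p² = 2α + 2`, a quadratic equation for `S = s²` whose positive root is taken.
  · set D := √(64 * (α + 1) ^ 2 + 192 * α ^ 2) with hD
    have hDsq : D ^ 2 = 64 * (α + 1) ^ 2 + 192 * α ^ 2 := Real.sq_sqrt (by positivity)
    have hD0 : 0 ≤ D := Real.sqrt_nonneg _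
    set S := (8 * (α + 1) + D) / 6 with hS
    have hSq : 3 * S ^ 2 - 8 * (α + 1) * S - 16 * α ^ 2 = 0 := by
      rw [hS]; nlinarith
    have hS0 : 0 < S := by positivity
    -- This makes `(x - a)² = S - 4 p²` positive, so the two endpoints are real and distinct.
    have hS4 : 4 * α < S := by
      have : 16 * α < D := by
        apply lt_of_pow_lt_pow_left₀ 2 hD0
        rw [hDsq]; nlinarith
      rw [hS]; linarith
    set s := √S with hs
    have hs0 : 0 < s := Real.sqrt_pos.2 hS0
    have hsS : s ^ 2 = S := Real.sq_sqrt hS0.le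
    set p := 2 * α / s with hp
    have hp0 : 0 < p := by positivity
    have hps : p * s = 2 * α := by rw [hp]; field_simp
    have h2p : 2 * p < s := by
      have : 2 * p * s < s * s := by nlinarith
      exact lt_of_mul_lt_mul_right this hs0.le
    set R := √(s ^ 2 - 4 * p ^ 2) with hR
    have hpos : 0 < s ^ 2 - 4 * p ^ 2 := by nlinarith
    have hR0 : 0 < R := Real.sqrt_pos.2 hpos
    have hRsq : R ^ 2 = s ^ 2 - 4 * p ^ 2 := Real.sq_sqrt hpos.le
    have hRs : R < s := by
      apply lt_of_pow_lt_pow_left₀ 2 hs0.le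
      nlinarith
    have ha : 0 < (s - R) / 2 := by linarith
    have hx : 0 < (s + R) / 2 := by linarith
    have hax : (s - R) / 2 * ((s + R) / 2) = p ^ 2 := by nlinarith
    refine ⟨(s - R) / 2, (s + R) / 2, fun _ => ha, by linarith, ?_, ?_⟩
    · unfold phiFun
      rw [hax, Real.sqrt_sq hp0.le, ← hps]
      field_simp
      ring
    · unfold psiFun
      have hsq : √((s - R) / 2) / √((s + R) / 2) = ((s - R) / 2) / p := by
        have h1 : √((s - R) / 2) * √((s + R) / 2) = p := by
          rw [← Real.sqrt_mul ha.le, hax, Real.sqrt_sq hp0.le]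
        have h2 : √((s - R) / 2) * √((s - R) / 2) = (s - R) / 2 := Real.mul_self_sqrt ha.le
        have h3 : 0 < √((s - R) / 2) := Real.sqrt_pos.2 ha
        have h4 : 0 < √((s + R) / 2) := Real.sqrt_pos.2 hx
        rw [div_eq_div_iff h4.ne' hp0.ne', ← h1]
        nlinarith
      rw [hsq]
      have h5 : 2 * α * ((s - R) / 2 / p) = s * ((s - R) / 2) := by
        rw [← hps]; field_simp
      rw [h5]
      have h6 : p ^ 2 * S = 4 * α ^ 2 := by
        calc p ^ 2 * S = (p * s) ^ 2 := by rw [← hsS]; ring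
          _ = 4 * α ^ 2 := by rw [hps]; ring
      have h7 : S * (3 / 4 * S - p ^ 2 - 2 * α - 2) = 0 := by linear_combination (1 / 4) * hSq - h6
      have h8 : 3 / 4 * S - p ^ 2 - 2 * α - 2 = 0 := by
        rcases mul_eq_zero.1 h7 with h | h
        · exact absurd h hS0.ne'
        · exact h
      linear_combination h8 + (1 / 4) * hRsq + (3 / 4) * hsS

/-- An admissible `a < ac` has `φ(xc, a) < 0`, so its partner satisfies `x > xc`. Then `0 = ψ(x, a)
≥ ψ(x, ac) > ψ(xc, ac) = 0`, which is absurd. -/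
lemma admissibleLeft_lower_bound {α ac xc a : ℝ} (hα : 0 ≤ α) (hdom : 0 < α → 0 < ac)
    (hac : ac < xc) (hφ : phiFun α xc ac = 0) (hψ : psiFun α xc ac = 0)
    (ha : a ∈ admissibleLeft α) : ac ≤ a := by
  obtain ⟨hda, x, hx, hφx, hψx⟩ := ha
  by_contra! hlt
  have h1 : phiFun α xc a < 0 := by
    rw [← hφ]
    exact phiFun_lt_phiFun_left hα (fun h => ⟨hda h, (hdom h).trans hac⟩) hlt
  have h2 : xc < x := by
    by_contra! hle
    rcases hle.eq_or_lt with rfl | hl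
    · linarith
    · have := phiFun_lt_phiFun_right (x := x) (x' := xc) (a := a) hα
        (fun h => ⟨hda h, (hda h).trans hx⟩) hl
      linarith
  have h3 := psiFun_le_psiFun_left hα hda hlt.le hx hφx
  have h4 := psiFun_lt_psiFun_right hα hdom hac.le h2 hφ.ge
  linarith

lemma exists_right_endpoint {α ac xc a : ℝ} (hα : 0 ≤ α) (hdom : 0 < α → 0 < ac)
    (hac : ac < xc) (hφ : phiFun α xc ac = 0) (hψ : psiFun α xc ac = 0) (ha : ac ≤ a) :
    ∃ b, a < b ∧ 0 ≤ phiFun α b a ∧ psiFun α b a = 0 := by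
  have hda : 0 < α → 0 < a := fun h => (hdom h).trans_le ha
  -- The starting point is `xc` if `a < xc` and `a` itself otherwise, where `ψ(a, a) = -2`. The last
  -- clause excludes the degenerate zero `b = a`.
  obtain ⟨x₀, hx₀, hφ₀, hψ₀, hne⟩ : ∃ x₀, a ≤ x₀ ∧ 0 ≤ phiFun α x₀ a ∧ psiFun α x₀ a ≤ 0 ∧
      (x₀ = a → psiFun α x₀ a < 0) := by
    have hφa : 0 ≤ phiFun α xc a := by
      rcases ha.eq_or_lt with rfl | hl
      · exact hφ.ge
      · rw [← hφ]
        exact (phiFun_lt_phiFun_left hα (fun h => ⟨hdom h, (hdom h).trans hac⟩) hl).le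
    rcases lt_or_ge a xc with h | h
    · exact ⟨xc, h.le, hφa, hψ ▸ psiFun_le_psiFun_left hα hdom ha hac hφ.ge, fun e => by linarith⟩
    · have : psiFun α a a < 0 := by
        unfold psiFun
        rcases hα.eq_or_lt with rfl | hα
        · simp
        · rw [div_self (Real.sqrt_pos.2 (hda hα)).ne']; simp
      refine ⟨a, le_rfl, ?_, this.le, fun _ => this⟩
      rcases h.eq_or_lt with rfl | h
      · exact hφa
      · exact hφa.trans (phiFun_lt_phiFun_right hα
          (fun h => ⟨hda h, (hdom h).trans hac⟩) h).le
  -- Far enough for the quadratic part `3/4 (X - a)² + a (X - a)` to exceed `2α + 2`.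
  set X := x₀ + 2 * (α + 2) + 2 * |a| with hX
  have hXa : 2 * (α + 2) + 2 * |a| ≤ X - a := by linarith
  have hψX : 0 ≤ psiFun α X a := by
    unfold psiFun
    have h1 : 0 ≤ 2 * α * (√a / √X) := by positivity
    have h2 := neg_abs_le a
    have h3 := abs_nonneg a
    nlinarith [mul_nonneg h3 h3, mul_nonneg hα h3]
  have hcont : ContinuousOn (fun x => psiFun α x a) (Set.Icc x₀ X) := by
    unfold psiFun
    rcases hα.eq_or_lt with rfl | hα
    · simp only [mul_zero, zero_mul]; fun_prop
    · have : ∀ x ∈ Set.Icc x₀ X, √x ≠ 0 := fun x hx =>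
        (Real.sqrt_pos.2 ((hda hα).trans_le (hx₀.trans hx.1))).ne'
      fun_prop (disch := assumption)
  obtain ⟨b, hb, hb0⟩ := intermediate_value_Icc
    (by rw [hX]; linarith [abs_nonneg a] : x₀ ≤ X) hcont ⟨hψ₀, hψX⟩
  refine ⟨b, ?_, ?_, hb0⟩
  · rcases (hx₀.trans hb.1).eq_or_lt with h | h
    · have h0 : x₀ = a := le_antisymm (hb.1.trans h.ge) hx₀
      have h1 := hne h0
      have h2 : b = x₀ := by linarith
      simp only [h2] at hb0
      linarith
    · exact h
  · rcases hb.1.eq_or_lt with h | h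
    · rwa [← h]
    · exact hφ₀.trans (phiFun_lt_phiFun_right hα
        (fun h => ⟨hda h, (hda h).trans_le hx₀⟩) h).le

/-- Given the standing assumptions, the pair of endpoints exists and is unique. -/
theorem existsUnique_isEndpoints {α : ℝ} (hα : 0 ≤ α) (σ : ℝ) :
    ∃! p : ℝ × ℝ, IsEndpoints α σ p.1 p.2 := by
  obtain ⟨ac, xc, hdom, hac, hφ, hψ⟩ := exists_soft_edge α hα
  have hleast : IsLeast (admissibleLeft α) ac :=
    ⟨⟨hdom, xc, hac, hφ.ge, hψ⟩, fun a ha => admissibleLeft_lower_bound hα hdom hac hφ hψ ha⟩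
  obtain ⟨b, hb, hφb, hψb⟩ := exists_right_endpoint hα hdom hac hφ hψ (le_max_right σ ac)
  refine ⟨(max σ ac, b), ⟨⟨ac, hleast, rfl⟩, hb, hφb, hψb⟩, ?_⟩
  rintro ⟨a', b'⟩ ⟨⟨ac', hl', ha'⟩, hb', hφb', hψb'⟩
  simp only at ha' hb' hφb' hψb'
  have := hl'.unique hleast
  subst this
  subst ha'
  rw [right_endpoint_unique hα (fun h => (hdom h).trans_le (le_max_right _ _)) hb' hb hφb' hφb
    hψb' hψb]

/-- The last clause is the alternative between hard and soft edge: if the barrier `σ` is not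
reached, then `a = a_c`, and uniqueness of the right endpoint carries over `φ = 0`. -/
lemma IsEndpoints.facts {α σ a b : ℝ} (hα : 0 ≤ α) (h : IsEndpoints α σ a b) :
    a < b ∧ σ ≤ a ∧ (0 < α → 0 < a) ∧ 0 ≤ phiFun α b a ∧ psiFun α b a = 0 ∧
      (σ < a → phiFun α b a = 0) := by
  obtain ⟨ac, xc, hdom, hac, hφ, hψ⟩ := exists_soft_edge α hα
  have hleast : IsLeast (admissibleLeft α) ac :=
    ⟨⟨hdom, xc, hac, hφ.ge, hψ⟩, fun a ha => admissibleLeft_lower_bound hα hdom hac hφ hψ ha⟩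
  obtain ⟨⟨ac', hl', ha'⟩, hb', hφb', hψb'⟩ := h
  have := hl'.unique hleast
  subst this
  refine ⟨hb', ha' ▸ le_max_left _ _, fun h => (hdom h).trans_le (ha' ▸ le_max_right _ _), hφb',
    hψb', fun hlt => ?_⟩
  have h1 : a = ac' := by
    rcases max_choice σ ac' with h | h
    · rw [h] at ha'; exact absurd ha' hlt.ne'
    · rw [h] at ha'; exact ha'
  subst h1
  rw [right_endpoint_unique hα hdom hb' hac hφb' hφ.ge hψb' hψ, hφ]

/-! ### Elementary integrals with inverse square root singularities -/

/-- The mixing density `q(s) = ∂ψ_α(s, a) / 2` in the representation of the limit law as a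
superposition of arcsine laws on the intervals `[a, s]`. -/
noncomputable def mixingDensity (α a s : ℝ) : ℝ :=
  3 / 4 * s - a / 4 - α * √a / 2 * (s * √s)⁻¹

lemma integrableOn_inv_sqrt_sub (y b : ℝ) :
    IntegrableOn (fun s => (√(s - y))⁻¹) (Set.Ioo y b) ∧
      ∫ s in Set.Ioo y b, (√(s - y))⁻¹ = 2 * √(b - y) := by
  rcases le_or_gt b y with h | h
  · rw [Set.Ioo_eq_empty (by linarith)]
    simp [Real.sqrt_eq_zero_of_nonpos (sub_nonpos.2 h)]
  have hd : ∀ s ∈ Set.Ioo y b, HasDerivAt (fun s => 2 * √(s - y)) ((√(s - y))⁻¹) s := by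
    intro s hs
    have h1 : s - y ≠ 0 := (sub_pos.2 hs.1).ne'
    have := (((hasDerivAt_id s).sub_const y).sqrt h1).const_mul 2
    refine this.congr_deriv ?_
    have : √(s - y) ≠ 0 := (Real.sqrt_pos.2 (sub_pos.2 hs.1)).ne'
    simp only [id]
    field_simp
  have hc : ContinuousOn (fun s => 2 * √(s - y)) (Set.Icc y b) := by fun_prop
  -- A nonnegative derivative of a function continuous up to the singular endpoint is automatically
  -- integrable.
  have hi := intervalIntegral.integrableOn_deriv_of_nonneg hc hd
    (fun s _ => inv_nonneg.2 (Real.sqrt_nonneg _))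
  refine ⟨hi.mono_set Set.Ioo_subset_Ioc_self, ?_⟩
  rw [← integral_Ioc_eq_integral_Ioo, ← intervalIntegral.integral_of_le h.le,
    intervalIntegral.integral_eq_sub_of_hasDerivAt_of_le h.le hc hd
    ((intervalIntegrable_iff_integrableOn_Ioc_of_le h.le).2 hi)]
  simp

lemma integrableOn_inv_sqrt_sub' (a t : ℝ) :
    IntegrableOn (fun s => (√(t - s))⁻¹) (Set.Ioo a t) ∧
      ∫ s in Set.Ioo a t, (√(t - s))⁻¹ = 2 * √(t - a) := by
  obtain ⟨h1, h2⟩ := integrableOn_inv_sqrt_sub (-t) (-a)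
  have hmp : MeasurePreserving (fun x : ℝ => -x) volume volume := Measure.measurePreserving_neg _
  have hme : MeasurableEmbedding (fun x : ℝ => -x) := (MeasurableEquiv.neg ℝ).measurableEmbedding
  have himg : Set.Ioo a t = (fun x : ℝ => -x) ⁻¹' Set.Ioo (-t) (-a) := by
    ext x; simp only [Set.mem_Ioo, Set.mem_preimage]; constructor <;> rintro ⟨h, h'⟩ <;>
      constructor <;> linarith
  have hfun : (fun s => (√(t - s))⁻¹) = (fun s => (√(s - -t))⁻¹) ∘ (fun x : ℝ => -x) := by
    ext s; simp only [Function.comp]; congr 2; ring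
  constructor
  · rw [himg, hfun]
    exact (hmp.integrableOn_comp_preimage hme).2 h1
  · rw [himg, hfun]
    simp only [Function.comp_def]
    rw [hmp.setIntegral_preimage_emb hme (fun s => (√(s - -t))⁻¹), h2]
    congr 2
    ring

/-- The default values `√x = 0` for `x ≤ 0` and `0⁻¹ = 0` act as an indicator function: the Abel
kernels can be integrated over all of `(a, b)`, whatever the position of the singular point. -/
lemma inv_sqrt_sub_eq_zero {y s : ℝ} (h : s ≤ y) : (√(s - y))⁻¹ = 0 := by
  rw [Real.sqrt_eq_zero_of_nonpos (sub_nonpos.2 h), inv_zero]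

lemma integrableOn_inv_sqrt_sub_Ioo {y a b : ℝ} (h : a ≤ y) :
    IntegrableOn (fun s => (√(s - y))⁻¹) (Set.Ioo a b) ∧
      ∫ s in Set.Ioo a b, (√(s - y))⁻¹ = 2 * √(b - y) := by
  obtain ⟨h1, h2⟩ := integrableOn_inv_sqrt_sub y b
  have hsub : Set.Ioo y b ⊆ Set.Ioo a b := Set.Ioo_subset_Ioo_left h
  have hz : ∀ s ∈ Set.Ioo a b \ Set.Ioo y b, (√(s - y))⁻¹ = 0 := by
    rintro s ⟨hs, hs'⟩
    exact inv_sqrt_sub_eq_zero (not_lt.1 fun h => hs' ⟨h, hs.2⟩)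
  exact ⟨h1.of_forall_sdiff_eq_zero measurableSet_Ioo hz,
    (setIntegral_eq_of_subset_of_forall_sdiff_eq_zero measurableSet_Ioo hsub hz).trans h2⟩

/-- Only an inequality, because `t` may lie beyond `b`. -/
lemma integrableOn_inv_sqrt_sub_Ioo' {t a b : ℝ} :
    IntegrableOn (fun s => (√(t - s))⁻¹) (Set.Ioo a b) ∧
      ∫ s in Set.Ioo a b, (√(t - s))⁻¹ ≤ 2 * √(t - a) := by
  obtain ⟨h1, h2⟩ := integrableOn_inv_sqrt_sub' a t
  have hz : ∀ s ∈ Set.Ioi a \ Set.Ioo a t, (√(t - s))⁻¹ = 0 := by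
    rintro s ⟨hs, hs'⟩
    exact inv_sqrt_sub_eq_zero (not_lt.1 fun h => hs' ⟨hs, h⟩)
  have h3 : IntegrableOn (fun s => (√(t - s))⁻¹) (Set.Ioi a) :=
    h1.of_forall_sdiff_eq_zero measurableSet_Ioi hz
  refine ⟨h3.mono_set Set.Ioo_subset_Ioi_self, ?_⟩
  rw [← h2, setIntegral_eq_of_subset_of_forall_sdiff_eq_zero measurableSet_Ioi
    Set.Ioo_subset_Ioi_self hz |>.symm]
  exact setIntegral_mono_set h3 (ae_of_all _ fun s => inv_nonneg.2 (Real.sqrt_nonneg _))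
    (Set.Ioo_subset_Ioi_self.eventuallyLE)

/-! ### Abel integrals of the mixing density -/

lemma measurable_mixingDensity (α a : ℝ) : Measurable (mixingDensity α a) := by
  unfold mixingDensity; fun_prop

lemma abs_mixingDensity_le {α a : ℝ} (hα : 0 ≤ α) (ha : 0 < α → 0 < a) (b : ℝ) :
    ∃ M, 0 ≤ M ∧ ∀ s ∈ Set.Icc a b, |mixingDensity α a s| ≤ M := by
  have hc : ContinuousOn (mixingDensity α a) (Set.Icc a b) := by
    unfold mixingDensity
    rcases hα.eq_or_lt with rfl | hα
    · simp only [zero_mul, zero_div]; fun_prop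
    · have : ∀ s ∈ Set.Icc a b, s * √s ≠ 0 := fun s hs => by
        have : 0 < s := (ha hα).trans_le hs.1
        positivity
      fun_prop (disch := assumption)
  obtain ⟨M, hM⟩ := isCompact_Icc.exists_bound_of_continuousOn hc
  exact ⟨max M 0, le_max_right _ _, fun s hs => (hM s hs).trans (le_max_left _ _)⟩

/-- The primitive of `s ↦ q(s) / √(s - y)`. -/
lemma hasDerivAt_primitive_right {α a y s : ℝ} (hα : 0 ≤ α) (h0 : 0 < α → 0 < y) (hs : y < s) :
    HasDerivAt (fun s => 1 / 2 * √(s - y) * (2 * y + s - a - 2 * α * √a * (√s)⁻¹ * y⁻¹))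
      (mixingDensity α a s * (√(s - y))⁻¹) s := by
  have h1 : s - y ≠ 0 := (sub_pos.2 hs).ne'
  have hw : 0 < √(s - y) := Real.sqrt_pos.2 (sub_pos.2 hs)
  have hw2 : √(s - y) ^ 2 = s - y := Real.sq_sqrt (sub_pos.2 hs).le
  have e1 := (((hasDerivAt_id s).sub_const y).sqrt h1).const_mul (1 / 2)
  rcases hα.eq_or_lt with rfl | hα
  · have e2 := ((hasDerivAt_id s).const_add (2 * y)).sub_const a
    simp only [mul_zero, zero_mul, sub_zero]
    refine (e1.mul e2).congr_deriv ?_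
    simp only [id, mixingDensity, zero_mul, zero_div, sub_zero]
    field_simp
    rw [hw2]
    ring
  · have hy := h0 hα
    have hs0 : 0 < s := hy.trans hs
    have hv : 0 < √s := Real.sqrt_pos.2 hs0
    have hv2 : √s ^ 2 = s := Real.sq_sqrt hs0.le
    have e3 := ((((hasDerivAt_id s).sqrt hs0.ne').inv hv.ne').const_mul (2 * α * √a)).mul_const y⁻¹
    have e2 := (((hasDerivAt_id s).const_add (2 * y)).sub_const a).sub e3
    refine (e1.mul e2).congr_deriv ?_
    simp only [id, Pi.sub_apply, Pi.inv_apply, mixingDensity]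
    -- With the two square roots as independent variables and `y = v² - w²`, the claim is an
    -- identity of rational functions.
    generalize √(s - y) = w at *
    generalize √s = v at *
    obtain rfl : y = v ^ 2 - w ^ 2 := by rw [hv2, hw2]; ring
    subst hv2
    field_simp
    ring

/-- The primitive of `s ↦ q(s) / √(t - s)`. -/
lemma hasDerivAt_primitive_left {α a t s : ℝ} (hα : 0 ≤ α) (h0 : 0 < α → 0 < s) (hs : s < t) :
    HasDerivAt (fun s => -(1 / 2 * √(t - s) * (2 * t + s - a - 2 * α * √a * (√s)⁻¹ * t⁻¹)))
      (mixingDensity α a s * (√(t - s))⁻¹) s := by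
  have h1 : t - s ≠ 0 := (sub_pos.2 hs).ne'
  have hw : 0 < √(t - s) := Real.sqrt_pos.2 (sub_pos.2 hs)
  have hw2 : √(t - s) ^ 2 = t - s := Real.sq_sqrt (sub_pos.2 hs).le
  have e1 := (((hasDerivAt_id s).const_sub t).sqrt h1).const_mul (1 / 2)
  rcases hα.eq_or_lt with rfl | hα
  · have e2 := ((hasDerivAt_id s).const_add (2 * t)).sub_const a
    simp only [mul_zero, zero_mul, sub_zero]
    refine (e1.mul e2).neg.congr_deriv ?_
    simp only [id, mixingDensity, zero_mul, zero_div, sub_zero]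
    field_simp
    rw [hw2]
    ring
  · have hs0 := h0 hα
    have ht : 0 < t := hs0.trans hs
    have hv : 0 < √s := Real.sqrt_pos.2 hs0
    have hv2 : √s ^ 2 = s := Real.sq_sqrt hs0.le
    have e3 := ((((hasDerivAt_id s).sqrt hs0.ne').inv hv.ne').const_mul (2 * α * √a)).mul_const t⁻¹
    have e2 := (((hasDerivAt_id s).const_add (2 * t)).sub_const a).sub e3
    refine (e1.mul e2).neg.congr_deriv ?_
    simp only [id, Pi.sub_apply, Pi.inv_apply, mixingDensity]
    generalize √(t - s) = w at *
    generalize √s = v at *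
    obtain rfl : t = v ^ 2 + w ^ 2 := by rw [hv2, hw2]; ring
    subst hv2
    field_simp
    ring

lemma IntegrableOn.mixingDensity_mul {α a b c d : ℝ} {k : ℝ → ℝ} (hα : 0 ≤ α)
    (ha : 0 < α → 0 < a) (hk : IntegrableOn k (Set.Ioo c d)) (hc : a ≤ c) (hd : d ≤ b) :
    IntegrableOn (fun s => mixingDensity α a s * k s) (Set.Ioo c d) := by
  obtain ⟨M, -, hM⟩ := abs_mixingDensity_le hα ha b
  refine hk.bdd_mul (c := M) (measurable_mixingDensity α a).aestronglyMeasurable ?_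
  filter_upwards [ae_restrict_mem measurableSet_Ioo] with s hs
  exact hM s ⟨hc.trans hs.1.le, hs.2.le.trans hd⟩

/-- `∫ q(s) / √(s - y) ds` for `y` to the left of or inside the interval. -/
lemma integral_mixingDensity_right {α a b c y : ℝ} (hα : 0 ≤ α) (ha : 0 < α → 0 < a)
    (h0 : 0 < α → 0 < y) (hy : y ≤ c) (hc : a ≤ c) (hb : c ≤ b) :
    ∫ s in Set.Ioo c b, mixingDensity α a s * (√(s - y))⁻¹ =
      1 / 2 * √(b - y) * (2 * y + b - a - 2 * α * √a * (√b)⁻¹ * y⁻¹) -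
      1 / 2 * √(c - y) * (2 * y + c - a - 2 * α * √a * (√c)⁻¹ * y⁻¹) := by
  have hi : IntegrableOn (fun s => (√(s - y))⁻¹) (Set.Ioo c b) :=
    (integrableOn_inv_sqrt_sub y b).1.mono_set (Set.Ioo_subset_Ioo_left hy)
  have hi2 := IntegrableOn.mixingDensity_mul (b := b) hα ha hi hc le_rfl
  rw [← integral_Ioc_eq_integral_Ioo, ← intervalIntegral.integral_of_le hb]
  refine intervalIntegral.integral_eq_sub_of_hasDerivAt_of_le
    (f := fun s => 1 / 2 * √(s - y) * (2 * y + s - a - 2 * α * √a * (√s)⁻¹ * y⁻¹)) hb ?_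
    (fun s hs => hasDerivAt_primitive_right hα h0 (hy.trans_lt hs.1)) ?_
  · rcases hα.eq_or_lt with rfl | hα
    · simp only [zero_mul, mul_zero]; fun_prop
    · have : ∀ s ∈ Set.Icc c b, √s ≠ 0 := fun s hs =>
        (Real.sqrt_pos.2 ((ha hα).trans_le (hc.trans hs.1))).ne'
      fun_prop (disch := assumption)
  · rw [intervalIntegrable_iff_integrableOn_Ioo_of_le hb]
    exact hi2

lemma integral_mixingDensity_right_of_mem {α a b y : ℝ} (hα : 0 ≤ α) (ha : 0 < α → 0 < a)
    (hy : a ≤ y) (hb : y ≤ b) :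
    ∫ s in Set.Ioo a b, mixingDensity α a s * (√(s - y))⁻¹ =
      1 / 2 * √(b - y) * (2 * y + b - a - 2 * α * √a * (√b)⁻¹ * y⁻¹) := by
  have hsub : Set.Ioo y b ⊆ Set.Ioo a b := Set.Ioo_subset_Ioo_left hy
  have hz : ∀ s ∈ Set.Ioo a b \ Set.Ioo y b, mixingDensity α a s * (√(s - y))⁻¹ = 0 := by
    rintro s ⟨hs, hs'⟩
    rw [inv_sqrt_sub_eq_zero (not_lt.1 fun h => hs' ⟨h, hs.2⟩), mul_zero]
  rw [setIntegral_eq_of_subset_of_forall_sdiff_eq_zero measurableSet_Ioo hsub hz,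
    integral_mixingDensity_right hα ha (fun h => (ha h).trans_le hy) le_rfl hy hb]
  simp

/-- `∫ q(s) / √(t - s) ds` over `(a, t)`. -/
lemma integral_mixingDensity_left {α a t : ℝ} (hα : 0 ≤ α) (ha : 0 < α → 0 < a) (ht : a ≤ t) :
    ∫ s in Set.Ioo a t, mixingDensity α a s * (√(t - s))⁻¹ = √(t - a) * (t - α * t⁻¹) := by
  have hi : IntegrableOn (fun s => (√(t - s))⁻¹) (Set.Ioo a t) := (integrableOn_inv_sqrt_sub' a t).1
  have hi2 := IntegrableOn.mixingDensity_mul (b := t) hα ha hi le_rfl le_rfl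
  rw [← integral_Ioc_eq_integral_Ioo, ← intervalIntegral.integral_of_le ht,
    intervalIntegral.integral_eq_sub_of_hasDerivAt_of_le
      (f := fun s => -(1 / 2 * √(t - s) * (2 * t + s - a - 2 * α * √a * (√s)⁻¹ * t⁻¹))) ht ?_
      (fun s hs => hasDerivAt_primitive_left hα (fun h => (ha h).trans hs.1) hs.2) ?_]
  · have : 2 * α * √a * (√a)⁻¹ = 2 * α := by
      rcases hα.eq_or_lt with rfl | hα
      · simp
      · have := ha hα
        field_simp
    simp only [sub_self, Real.sqrt_zero, this]
    ring
  · rcases hα.eq_or_lt with rfl | hα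
    · simp only [zero_mul, mul_zero]; fun_prop
    · have : ∀ s ∈ Set.Icc a t, √s ≠ 0 := fun s hs =>
        (Real.sqrt_pos.2 ((ha hα).trans_le hs.1)).ne'
      fun_prop (disch := assumption)
  · rw [intervalIntegrable_iff_integrableOn_Ioo_of_le ht]
    exact hi2

/-- Used beyond the right endpoint; for `s < b` the density can be negative. The assumption on `φ`
bounds the singular term by `a (a + b) / (4b) ≤ a / 2`. -/
lemma mixingDensity_nonneg {α a b s : ℝ} (hα : 0 ≤ α) (ha : 0 < α → 0 < a) (hab : a < b)
    (hφ : 0 ≤ phiFun α b a) (hs : b ≤ s) : 0 ≤ mixingDensity α a s := by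
  unfold mixingDensity
  rcases hα.eq_or_lt with rfl | hα
  · simp only [phiFun, mul_zero, zero_div, sub_zero] at hφ
    simp only [zero_mul, zero_div, sub_zero]
    linarith
  · have ha := ha hα
    have hb : 0 < b := ha.trans hab
    have hs0 : 0 < s := hb.trans_le hs
    have h2 := two_mul_le_of_phiFun_nonneg ha hb hφ
    have hsb : √b ≤ √s := Real.sqrt_le_sqrt hs
    have hsb0 : 0 < √b := Real.sqrt_pos.2 hb
    have e : √a * √a = a := Real.mul_self_sqrt ha.le
    have e2 : √b * √b = b := Real.mul_self_sqrt hb.le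
    have h3 : α * √a / 2 * (s * √s)⁻¹ ≤ α * √a / 2 * (b * √b)⁻¹ := by gcongr
    have h4 : α * √a / 2 * (b * √b)⁻¹ ≤ (b + a) * a / (4 * b) := by
      have : α * √a ≤ (b + a) / 2 * (√a * √a) * √b := by
        nlinarith [mul_le_mul_of_nonneg_right h2 (Real.sqrt_nonneg a)]
      rw [e] at this
      rw [← div_eq_mul_inv, div_le_div_iff₀ (by positivity) (by positivity)]
      nlinarith [mul_le_mul_of_nonneg_right this hb.le]
    have h5 : (b + a) * a / (4 * b) ≤ a / 2 := by
      rw [div_le_iff₀ (by positivity)]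
      nlinarith
    linarith

/-! ### Logarithmic potential of the arcsine law -/

/-- Under `y = (a + s)/2 + (s - a)/2 · cos θ` the weight `dy / √((y - a)(s - y))` becomes `dθ`. -/
lemma integral_Ioo_arcsine_subst {a s : ℝ} (has : a < s) (g : ℝ → ℝ) :
    ∫ y in Set.Ioo a s, g y * ((√(y - a))⁻¹ * (√(s - y))⁻¹) =
      ∫ θ in Set.Ioo 0 Real.pi, g ((a + s) / 2 + (s - a) / 2 * Real.cos θ) := by
  set m := (a + s) / 2 with hm
  set r := (s - a) / 2 with hr
  have hr0 : 0 < r := by rw [hr]; linarith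
  have hinj : Set.InjOn (fun θ => m + r * Real.cos θ) (Set.Ioo 0 Real.pi) := by
    intro x hx y hy hxy
    have : Real.cos x = Real.cos y := mul_left_cancel₀ hr0.ne' (add_left_cancel hxy)
    exact Real.injOn_cos (Set.Ioo_subset_Icc_self hx) (Set.Ioo_subset_Icc_self hy) this
  have himg : (fun θ => m + r * Real.cos θ) '' Set.Ioo 0 Real.pi = Set.Ioo a s := by
    ext y
    constructor
    · rintro ⟨θ, hθ, rfl⟩
      have h1 : -1 < Real.cos θ := by
        rw [← Real.cos_pi]
        exact Real.strictAntiOn_cos (Set.Ioo_subset_Icc_self hθ)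
          (Set.right_mem_Icc.2 Real.pi_pos.le) hθ.2
      have h2 : Real.cos θ < 1 := by
        rw [← Real.cos_zero]
        exact Real.strictAntiOn_cos (Set.left_mem_Icc.2 Real.pi_pos.le)
          (Set.Ioo_subset_Icc_self hθ) hθ.1
      constructor <;> simp only [hm, hr] <;> nlinarith
    · rintro ⟨h1, h2⟩
      have e1 : -1 < (y - m) / r := by rw [lt_div_iff₀ hr0]; linarith
      have e2 : (y - m) / r < 1 := by rw [div_lt_iff₀ hr0]; linarith
      refine ⟨Real.arccos ((y - m) / r), ⟨Real.arccos_pos.2 e2, ?_⟩, ?_⟩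
      · refine lt_of_le_of_ne (Real.arccos_le_pi _) fun h => ?_
        rw [Real.arccos_eq_pi] at h
        linarith
      · simp only
        rw [Real.cos_arccos e1.le e2.le]
        field_simp
        ring
  rw [← himg, integral_image_eq_integral_abs_deriv_smul measurableSet_Ioo
    (f' := fun θ => r * (-Real.sin θ)) (fun θ _ =>
      ((Real.hasDerivAt_cos θ).const_mul r |>.const_add m).hasDerivWithinAt) hinj]
  refine setIntegral_congr_fun measurableSet_Ioo fun θ hθ => ?_
  have hsin : 0 < Real.sin θ := Real.sin_pos_of_mem_Ioo hθ
  have h1 : √(m + r * Real.cos θ - a) * √(s - (m + r * Real.cos θ)) = r * Real.sin θ := by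
    have h2 : m + r * Real.cos θ - a = r * (1 + Real.cos θ) := by rw [hm, hr]; ring
    have h3 : s - (m + r * Real.cos θ) = r * (1 - Real.cos θ) := by rw [hm, hr]; ring
    rw [h2, h3, ← Real.sqrt_mul (mul_nonneg hr0.le (by linarith [Real.neg_one_le_cos θ]))]
    rw [show r * (1 + Real.cos θ) * (r * (1 - Real.cos θ)) = (r * Real.sin θ) ^ 2 by
      rw [mul_pow, Real.sin_sq]; ring]
    exact Real.sqrt_sq (by positivity)
  simp only [smul_eq_mul]
  rw [← mul_inv, h1, mul_neg, abs_neg, abs_of_pos (by positivity)]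
  field_simp

/-- The two integrals run over the upper and the lower half circle. Together they form the circle
average of `log|z - w|`, which Jensen's formula evaluates. -/
lemma integral_log_norm_circle (w : ℂ) :
    IntegrableOn (fun θ : ℝ => Real.log ‖Complex.exp (θ * Complex.I) - w‖) (Set.Ioo 0 Real.pi) ∧
    IntegrableOn (fun θ : ℝ => Real.log ‖Complex.exp (-(θ * Complex.I)) - w‖) (Set.Ioo 0 Real.pi) ∧
    (∫ θ in Set.Ioo 0 Real.pi, Real.log ‖Complex.exp (θ * Complex.I) - w‖) +
      ∫ θ in Set.Ioo 0 Real.pi, Real.log ‖Complex.exp (-(θ * Complex.I)) - w‖ =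
      2 * Real.pi * Real.posLog ‖w‖ := by
  have hpi := Real.pi_pos
  set F : ℝ → ℝ := fun θ => Real.log ‖Complex.exp (θ * Complex.I) - w‖ with hF
  have hint : IntervalIntegrable F volume 0 (2 * Real.pi) := by
    have := circleIntegrable_log_norm_sub_const (a := w) (c := 0) 1
    simpa [CircleIntegrable, circleMap, hF] using this
  have hval : ∫ θ in (0 : ℝ)..2 * Real.pi, F θ = 2 * Real.pi * Real.posLog ‖w‖ := by
    have := circleAverage_log_norm_sub_const_eq_posLog (a := w)
    rw [Real.circleAverage_def] at this
    simp only [circleMap, zero_add, Complex.ofReal_one, one_mul, smul_eq_mul] at this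
    rw [← this, ← mul_assoc, mul_inv_cancel₀ (by positivity), one_mul]
  have hsub1 : IntervalIntegrable F volume 0 Real.pi := hint.mono_set (by
    rw [Set.uIcc_of_le hpi.le, Set.uIcc_of_le (by linarith)]
    exact Set.Icc_subset_Icc_right (by linarith))
  have hsub2 : IntervalIntegrable F volume Real.pi (2 * Real.pi) := hint.mono_set (by
    rw [Set.uIcc_of_le (by linarith), Set.uIcc_of_le (by linarith)]
    exact Set.Icc_subset_Icc_left (by linarith))
  have hFG : (fun θ : ℝ => Real.log ‖Complex.exp (-(θ * Complex.I)) - w‖) =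
      fun θ => F (2 * Real.pi - θ) := by
    ext θ
    simp only [hF]
    congr 3
    push_cast
    rw [sub_mul, Complex.exp_sub, Complex.exp_two_pi_mul_I, Complex.exp_neg, one_div]
  have hsub3 : IntervalIntegrable (fun θ => F (2 * Real.pi - θ)) volume 0 Real.pi := by
    have := (hsub2.comp_sub_left (2 * Real.pi)).symm
    simpa [two_mul] using this
  have hval3 : ∫ θ in (0 : ℝ)..Real.pi, F (2 * Real.pi - θ) =
      ∫ θ in Real.pi..2 * Real.pi, F θ := by
    rw [intervalIntegral.integral_comp_sub_left]
    congr 1 <;> ring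
  rw [hFG]
  refine ⟨(intervalIntegrable_iff_integrableOn_Ioo_of_le hpi.le).1 hsub1,
    (intervalIntegrable_iff_integrableOn_Ioo_of_le hpi.le).1 hsub3, ?_⟩
  rw [← integral_Ioc_eq_integral_Ioo, ← integral_Ioc_eq_integral_Ioo,
    ← intervalIntegral.integral_of_le hpi.le, ← intervalIntegral.integral_of_le hpi.le, hval3,
    intervalIntegral.integral_add_adjacent_intervals hsub1 hsub2, hval]

/-- The logarithmic potential of the arcsine law in the Joukowski parameter. -/
lemma integral_log_arcsine {a s x : ℝ} (has : a < s) {w : ℂ} (hw : 1 ≤ ‖w‖)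
    (hx : (x : ℂ) = (a + s) / 2 + (s - a) / 4 * (w + w⁻¹)) :
    ∫ y in Set.Ioo a s, Real.log (x - y) * ((√(y - a))⁻¹ * (√(s - y))⁻¹) =
      Real.pi * (Real.log ((s - a) / 4) + Real.log ‖w‖) := by
  rw [integral_Ioo_arcsine_subst has (fun y => Real.log (x - y))]
  obtain ⟨hi1, hi2, hval⟩ := integral_log_norm_circle w
  have hw0 : w ≠ 0 := by rw [← norm_pos_iff]; linarith
  have hkey : ∀ᵐ θ ∂(volume.restrict (Set.Ioo 0 Real.pi)),
      Real.log (x - ((a + s) / 2 + (s - a) / 2 * Real.cos θ)) =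
        (Real.log ((s - a) / 4) - Real.log ‖w‖) +
          (Real.log ‖Complex.exp (θ * Complex.I) - w‖ +
          Real.log ‖Complex.exp (-(θ * Complex.I)) - w‖) := by
    -- Splitting the logarithm of the product below requires nonzero factors; this fails for at most
    -- one angle.
    have hnull : volume {θ : ℝ | θ ∈ Set.Ioo 0 Real.pi ∧
        x - ((a + s) / 2 + (s - a) / 2 * Real.cos θ) = 0} = 0 := by
      refine Set.Subsingleton.measure_zero ?_ _
      rintro θ ⟨hθ, h1⟩ θ' ⟨hθ', h2⟩
      refine Real.injOn_cos (Set.Ioo_subset_Icc_self hθ) (Set.Ioo_subset_Icc_self hθ') ?_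
      have : (s - a) / 2 ≠ 0 := by linarith
      exact mul_left_cancel₀ this (by linarith)
    filter_upwards [ae_restrict_mem measurableSet_Ioo,
      ae_restrict_of_ae (measure_eq_zero_iff_ae_notMem.1 hnull)] with θ hθ hne
    have hne' : x - ((a + s) / 2 + (s - a) / 2 * Real.cos θ) ≠ 0 := fun h => hne ⟨hθ, h⟩
    -- The Joukowski factorisation `w + w⁻¹ - 2 cos θ = w⁻¹ (e^{iθ} - w)(e^{-iθ} - w)`.
    have hid : ((x - ((a + s) / 2 + (s - a) / 2 * Real.cos θ) : ℝ) : ℂ) =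
        ((s - a) / 4 : ℝ) * w⁻¹ * ((Complex.exp (θ * Complex.I) - w) *
          (Complex.exp (-(θ * Complex.I)) - w)) := by
      have hc : Complex.cos θ = (Complex.exp (θ * Complex.I) + Complex.exp (-(θ * Complex.I))) / 2 := by
        rw [Complex.cos, neg_mul]
      have he : Complex.exp (θ * Complex.I) * Complex.exp (-(θ * Complex.I)) = 1 := by
        rw [← Complex.exp_add]; simp
      push_cast
      rw [hx, hc]
      generalize Complex.exp (θ * Complex.I) = u at *
      generalize Complex.exp (-(θ * Complex.I)) = v at *
      field_simp
      linear_combination (-(4 : ℂ) * (s - a)) * he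
    have hn := congrArg (fun z : ℂ => Real.log ‖z‖) hid
    have hne2 : ((x - ((a + s) / 2 + (s - a) / 2 * Real.cos θ) : ℝ) : ℂ) ≠ 0 := by
      exact_mod_cast hne'
    rw [hid] at hne2
    have e1 := left_ne_zero_of_mul hne2
    have e2 := right_ne_zero_of_mul hne2
    simp only [Complex.norm_real, Real.norm_eq_abs, Real.log_abs] at hn
    rw [hn, norm_mul, norm_mul, norm_mul, norm_inv, Real.log_mul, Real.log_mul, Real.log_mul,
      Real.log_inv, Complex.norm_real, Real.norm_eq_abs, Real.log_abs]
    · ring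
    all_goals simp only [ne_eq, norm_eq_zero, inv_eq_zero, mul_eq_zero, not_or]
    · exact left_ne_zero_of_mul e2
    · exact right_ne_zero_of_mul e2
    · exact left_ne_zero_of_mul e1
    · exact hw0
    · exact ⟨left_ne_zero_of_mul e1, hw0⟩
    · exact ⟨left_ne_zero_of_mul e2, right_ne_zero_of_mul e2⟩
  have hi3 : Integrable (fun θ : ℝ => Real.log ‖Complex.exp (θ * Complex.I) - w‖ +
      Real.log ‖Complex.exp (-(θ * Complex.I)) - w‖) (volume.restrict (Set.Ioo 0 Real.pi)) :=
    hi1.add hi2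
  rw [integral_congr_ae hkey, integral_add (integrable_const _) hi3,
    integral_add hi1 hi2, hval, Real.posLog_eq_log (by rwa [abs_norm])]
  simp [Real.pi_pos.le]
  ring

/-- The arcsine potential on the interval. -/
lemma integral_log_arcsine_of_mem {a s x : ℝ} (has : a < s) (hx : x ∈ Set.Icc a s) :
    ∫ y in Set.Ioo a s, Real.log (x - y) * ((√(y - a))⁻¹ * (√(s - y))⁻¹) =
      Real.pi * Real.log ((s - a) / 4) := by
  set t := (x - (a + s) / 2) / ((s - a) / 2) with ht
  have hr : 0 < (s - a) / 2 := by linarith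
  have h1 : -1 ≤ t := by rw [ht, le_div_iff₀ hr]; linarith [hx.1]
  have h2 : t ≤ 1 := by rw [ht, div_le_iff₀ hr]; linarith [hx.2]
  have hxt : x = (a + s) / 2 + (s - a) / 2 * t := by
    have : s - a ≠ 0 := by linarith
    rw [ht]; field_simp; ring
  -- Points of the interval correspond to `w` on the unit circle, where `log ‖w‖ = 0` and the
  -- potential is constant.
  have hnorm : ‖Complex.exp (Real.arccos t * Complex.I)‖ = 1 := Complex.norm_exp_ofReal_mul_I _
  rw [integral_log_arcsine has (w := Complex.exp (Real.arccos t * Complex.I)) hnorm.ge, hnorm]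
  · simp
  · have hc := Complex.cos (Real.arccos t : ℂ)
    have h3 : (t : ℂ) = (Complex.exp (Real.arccos t * Complex.I) +
        (Complex.exp (Real.arccos t * Complex.I))⁻¹) / 2 := by
      rw [← Complex.exp_neg, ← neg_mul, ← Complex.cos, ← Complex.ofReal_cos,
        Real.cos_arccos h1 h2]
    rw [hxt]
    push_cast
    linear_combination ((s : ℂ) - a) / 2 * h3

/-- The arcsine potential to the right of the interval. -/
lemma integral_log_arcsine_of_gt {a s x : ℝ} (has : a < s) (hx : s ≤ x) :
    ∫ y in Set.Ioo a s, Real.log (x - y) * ((√(y - a))⁻¹ * (√(s - y))⁻¹) =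
      Real.pi * (2 * Real.log ((√(x - a) + √(x - s)) / 2)) := by
  set p := √(x - a) with hp
  set q := √(x - s) with hq
  have hp2 : p ^ 2 = x - a := Real.sq_sqrt (by linarith)
  have hq2 : q ^ 2 = x - s := Real.sq_sqrt (by linarith)
  have hp0 : 0 < p := Real.sqrt_pos.2 (by linarith)
  have hq0 : 0 ≤ q := Real.sqrt_nonneg _
  have hqp : q < p := Real.sqrt_lt_sqrt (by linarith) (by linarith)
  clear_value p q
  -- Outside the interval `w` is real: `w = (p + q) / (p - q)` solves the Joukowski equation, since
  -- `x - a = p²` and `x - s = q²`.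
  have hW : 1 ≤ (p + q) / (p - q) := by rw [le_div_iff₀ (by linarith)]; linarith
  have hW0 : 0 < (p + q) / (p - q) := by linarith
  rw [integral_log_arcsine has (w := (((p + q) / (p - q) : ℝ) : ℂ))]
  · rw [Complex.norm_real, Real.norm_of_nonneg hW0.le, ← Real.log_mul (by linarith) hW0.ne']
    rw [show (2 : ℝ) * Real.log ((p + q) / 2) = Real.log (((p + q) / 2) ^ 2) by
      rw [Real.log_pow]; norm_num]
    congr 2
    have : s - a = (p - q) * (p + q) := by linear_combination hq2 - hp2
    rw [this]
    have : p - q ≠ 0 := by linarith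
    field_simp
    ring
  · rw [Complex.norm_real, Real.norm_of_nonneg hW0.le]; exact hW
  · norm_cast
    have h1 : p - q ≠ 0 := by linarith
    have h2 : p + q ≠ 0 := by linarith
    obtain rfl : a = x - p ^ 2 := by linarith
    obtain rfl : s = x - q ^ 2 := by linarith
    field_simp
    ring

/-- The arcsine potential to the left of the interval. -/
lemma integral_log_arcsine_of_lt {a s x : ℝ} (has : a < s) (hx : x ≤ a) :
    ∫ y in Set.Ioo a s, Real.log (x - y) * ((√(y - a))⁻¹ * (√(s - y))⁻¹) =
      Real.pi * (2 * Real.log ((√(a - x) + √(s - x)) / 2)) := by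
  set p := √(s - x) with hp
  set q := √(a - x) with hq
  have hp2 : p ^ 2 = s - x := Real.sq_sqrt (by linarith)
  have hq2 : q ^ 2 = a - x := Real.sq_sqrt (by linarith)
  have hp0 : 0 < p := Real.sqrt_pos.2 (by linarith)
  have hq0 : 0 ≤ q := Real.sqrt_nonneg _
  have hqp : q < p := Real.sqrt_lt_sqrt (by linarith) (by linarith)
  clear_value p q
  have hW : 1 ≤ (p + q) / (p - q) := by rw [le_div_iff₀ (by linarith)]; linarith
  have hW0 : 0 < (p + q) / (p - q) := by linarith
  rw [integral_log_arcsine has (w := ((-((p + q) / (p - q)) : ℝ) : ℂ))]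
  · rw [Complex.norm_real, norm_neg, Real.norm_of_nonneg hW0.le, ← Real.log_mul (by linarith) hW0.ne']
    rw [show (2 : ℝ) * Real.log ((q + p) / 2) = Real.log (((q + p) / 2) ^ 2) by
      rw [Real.log_pow]; norm_num]
    congr 2
    have : s - a = (p - q) * (p + q) := by linear_combination hq2 - hp2
    rw [this]
    have : p - q ≠ 0 := by linarith
    field_simp
    ring
  · rw [Complex.norm_real, norm_neg, Real.norm_of_nonneg hW0.le]; exact hW
  · norm_cast
    have h1 : p - q ≠ 0 := by linarith
    have h2 : p + q ≠ 0 := by linarith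
    obtain rfl : a = x + q ^ 2 := by linarith
    obtain rfl : s = x + p ^ 2 := by linarith
    field_simp
    ring

/-- The arcsine potential at `x ≥ a` as an integral along `(a, x)`. -/
lemma integral_log_arcsine_eq_right {a s x : ℝ} (has : a < s) (hx : a ≤ x) :
    ∫ y in Set.Ioo a s, Real.log (x - y) * ((√(y - a))⁻¹ * (√(s - y))⁻¹) =
      Real.pi * (Real.log ((s - a) / 4) +
        ∫ t in Set.Ioo a x, (√(t - a))⁻¹ * (√(t - s))⁻¹) := by
  rcases le_or_gt x s with h | h
  -- For `x ≤ s` the kernel `(√(t - s))⁻¹` takes its default value `0`, so the formula covers points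
  -- inside and outside the interval alike.
  · rw [integral_log_arcsine_of_mem has ⟨hx, h⟩, setIntegral_eq_zero_of_forall_eq_zero, add_zero]
    intro t ht
    rw [inv_sqrt_sub_eq_zero (ht.2.le.trans h), mul_zero]
  · rw [integral_log_arcsine_of_gt has h.le]
    congr 1
    have hsub : Set.Ioo s x ⊆ Set.Ioo a x := Set.Ioo_subset_Ioo_left has.le
    rw [setIntegral_eq_of_subset_of_forall_sdiff_eq_zero measurableSet_Ioo hsub (by
      rintro t ⟨ht, ht'⟩
      rw [inv_sqrt_sub_eq_zero (not_lt.1 fun h => ht' ⟨h, ht.2⟩), mul_zero]),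
      ← integral_Ioc_eq_integral_Ioo, ← intervalIntegral.integral_of_le h.le]
    have hd : ∀ t ∈ Set.Ioo s x, HasDerivAt (fun t => 2 * Real.log (√(t - a) + √(t - s)))
        ((√(t - a))⁻¹ * (√(t - s))⁻¹) t := by
      intro t ht
      have h1 : 0 < t - a := by linarith [ht.1]
      have h2 : 0 < t - s := by linarith [ht.1]
      have h3 : 0 < √(t - a) := Real.sqrt_pos.2 h1
      have h4 : 0 < √(t - s) := Real.sqrt_pos.2 h2
      have e1 := ((hasDerivAt_id t).sub_const a).sqrt h1.ne'
      have e2 := ((hasDerivAt_id t).sub_const s).sqrt h2.ne'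
      have h5 : √(t - a) + √(t - s) ≠ 0 := by positivity
      refine (((e1.add e2).log h5).const_mul 2).congr_deriv ?_
      simp only [id, Pi.add_apply]
      field_simp
      ring
    have hc : ContinuousOn (fun t => 2 * Real.log (√(t - a) + √(t - s))) (Set.Icc s x) := by
      have : ∀ t ∈ Set.Icc s x, √(t - a) + √(t - s) ≠ 0 := fun t ht => by
        have : 0 < √(t - a) := Real.sqrt_pos.2 (by linarith [ht.1])
        positivity
      fun_prop (disch := assumption)
    rw [intervalIntegral.integral_eq_sub_of_hasDerivAt_of_le h.le hc hd]
    · have e1 : 0 < √(s - a) := Real.sqrt_pos.2 (by linarith)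
      have e2 : 0 < √(x - a) + √(x - s) := by
        have : 0 < √(x - a) := Real.sqrt_pos.2 (by linarith)
        positivity
      rw [sub_self, Real.sqrt_zero, add_zero, Real.log_div e2.ne' two_ne_zero,
        Real.log_div (by linarith) (by norm_num), Real.log_sqrt (by linarith),
        show (4 : ℝ) = 2 ^ 2 by norm_num, Real.log_pow]
      push_cast
      ring
    · refine intervalIntegral.intervalIntegrable_deriv_of_nonneg
        (g := fun t => 2 * Real.log (√(t - a) + √(t - s))) ?_ ?_ ?_
      · rwa [Set.uIcc_of_le h.le]
      · rwa [min_eq_left h.le, max_eq_right h.le]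
      · intro t _; positivity

/-- The arcsine potential at `x ≤ a` as an integral along `(x, a)`. -/
lemma integral_log_arcsine_eq_left {a s x : ℝ} (has : a < s) (hx : x ≤ a) :
    ∫ y in Set.Ioo a s, Real.log (x - y) * ((√(y - a))⁻¹ * (√(s - y))⁻¹) =
      Real.pi * (Real.log ((s - a) / 4) +
        ∫ t in Set.Ioo x a, (√(a - t))⁻¹ * (√(s - t))⁻¹) := by
  rw [integral_log_arcsine_of_lt has hx]
  congr 1
  rw [← integral_Ioc_eq_integral_Ioo, ← intervalIntegral.integral_of_le hx]
  have hd : ∀ t ∈ Set.Ioo x a, HasDerivAt (fun t => -(2 * Real.log (√(a - t) + √(s - t))))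
      ((√(a - t))⁻¹ * (√(s - t))⁻¹) t := by
    intro t ht
    have h1 : 0 < a - t := by linarith [ht.2]
    have h2 : 0 < s - t := by linarith [ht.2]
    have h3 : 0 < √(a - t) := Real.sqrt_pos.2 h1
    have h4 : 0 < √(s - t) := Real.sqrt_pos.2 h2
    have e1 := ((hasDerivAt_id t).const_sub a).sqrt h1.ne'
    have e2 := ((hasDerivAt_id t).const_sub s).sqrt h2.ne'
    have h5 : √(a - t) + √(s - t) ≠ 0 := by positivity
    refine (((e1.add e2).log h5).const_mul 2).neg.congr_deriv ?_
    simp only [id, Pi.add_apply]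
    field_simp
    ring
  have hc : ContinuousOn (fun t => -(2 * Real.log (√(a - t) + √(s - t)))) (Set.Icc x a) := by
    have : ∀ t ∈ Set.Icc x a, √(a - t) + √(s - t) ≠ 0 := fun t ht => by
      have : 0 < √(s - t) := Real.sqrt_pos.2 (by linarith [ht.2])
      positivity
    fun_prop (disch := assumption)
  rw [intervalIntegral.integral_eq_sub_of_hasDerivAt_of_le hx hc hd]
  · have e1 : 0 < √(s - a) := Real.sqrt_pos.2 (by linarith)
    have e2 : 0 < √(a - x) + √(s - x) := by
      have : 0 < √(s - x) := Real.sqrt_pos.2 (by linarith)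
      positivity
    rw [sub_self, Real.sqrt_zero, zero_add, Real.log_div e2.ne' two_ne_zero,
      Real.log_div (by linarith) (by norm_num), Real.log_sqrt (by linarith),
      show (4 : ℝ) = 2 ^ 2 by norm_num, Real.log_pow]
    push_cast
    ring
  · refine intervalIntegral.intervalIntegrable_deriv_of_nonneg
      (g := fun t => -(2 * Real.log (√(a - t) + √(s - t)))) ?_ ?_ ?_
    · rwa [Set.uIcc_of_le hx]
    · rwa [min_eq_left hx, max_eq_right hx]
    · intro t _; positivity

/-! ### Integrability of logarithmic and power singularities -/

/-- The exponent `1/4` is small enough that, multiplied by the edge singularity `(y - a)^(-1/2)`, it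
still leaves an integrable power `3/4 < 1`. -/
lemma abs_log_le_rpow_add (u : ℝ) : |Real.log u| ≤ 4 * |u| ^ (-(1 / 4) : ℝ) + |u| := by
  rcases eq_or_ne u 0 with rfl | hu
  · simp
  have hu0 : 0 < |u| := abs_pos.2 hu
  have hp : 0 < |u| ^ (-(1 / 4) : ℝ) := Real.rpow_pos_of_pos hu0 _
  rw [← Real.log_abs u]
  rcases le_total 1 |u| with h | h
  · rw [abs_of_nonneg (Real.log_nonneg h)]
    linarith [Real.log_le_self hu0.le]
  · rw [abs_of_nonpos (Real.log_nonpos hu0.le h), ← Real.log_inv]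
    have := Real.log_le_rpow_div (inv_nonneg.2 hu0.le) (show (0 : ℝ) < 1 / 4 by norm_num)
    rw [Real.inv_rpow hu0.le, ← Real.rpow_neg hu0.le] at this
    linarith

lemma integrableOn_abs_rpow_Ioo :
    IntegrableOn (fun u : ℝ => |u| ^ (-(3 / 4) : ℝ)) (Set.Ioo (-1) 1) := by
  have h1 : IntegrableOn (fun u : ℝ => |u| ^ (-(3 / 4) : ℝ)) (Set.Ioo 0 1) := by
    refine ((intervalIntegral.integrableOn_Ioo_rpow_iff (s := -(3 / 4)) one_pos).2
      (by norm_num)).congr_fun (fun u hu => ?_) measurableSet_Ioo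
    simp only [abs_of_pos hu.1]
  have h2 : IntegrableOn (fun u : ℝ => |u| ^ (-(3 / 4) : ℝ)) (Set.Ioo (-1) 0) := by
    have hmp : MeasurePreserving (fun x : ℝ => -x) volume volume := Measure.measurePreserving_neg _
    have hme : MeasurableEmbedding (fun x : ℝ => -x) :=
      (MeasurableEquiv.neg ℝ).measurableEmbedding
    have := (hmp.integrableOn_comp_preimage hme).2 h1
    simpa [Function.comp_def] using this
  have h3 : IntegrableOn (fun u : ℝ => |u| ^ (-(3 / 4) : ℝ)) {0} := by simp
  refine ((h2.union h3).union h1).mono_set ?_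
  intro u hu
  rcases lt_trichotomy u 0 with h | h | h
  · exact Or.inl (Or.inl ⟨hu.1, h⟩)
  · exact Or.inl (Or.inr h)
  · exact Or.inr ⟨h, hu.2⟩

/-- Away from the singularity the power is at most `1`; near it, translation invariance makes the
bound independent of `x`. -/
lemma integrableOn_abs_sub_rpow (a b : ℝ) : ∃ C : ℝ, ∀ x : ℝ,
    IntegrableOn (fun y : ℝ => |x - y| ^ (-(3 / 4) : ℝ)) (Set.Ioo a b) ∧
      ∫ y in Set.Ioo a b, |x - y| ^ (-(3 / 4) : ℝ) ≤ C := by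
  set h : ℝ → ℝ := (Set.Ioo (-1 : ℝ) 1).indicator (fun u => |u| ^ (-(3 / 4) : ℝ)) with hh
  have hi : Integrable h := integrableOn_abs_rpow_Ioo.integrable_indicator measurableSet_Ioo
  have hn : ∀ u, 0 ≤ h u := fun u => Set.indicator_nonneg (fun _ _ => by positivity) u
  have hle : ∀ u : ℝ, |u| ^ (-(3 / 4) : ℝ) ≤ 1 + h u := by
    intro u
    by_cases hu : u ∈ Set.Ioo (-1 : ℝ) 1
    · rw [hh, Set.indicator_of_mem hu]; linarith
    · have : 1 ≤ |u| := by
        by_contra! hlt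
        exact hu (abs_lt.1 hlt)
      have := Real.rpow_le_one_of_one_le_of_nonpos this (show (-(3 / 4) : ℝ) ≤ 0 by norm_num)
      linarith [hn u]
  refine ⟨(∫ y in Set.Ioo a b, (1 : ℝ)) + ∫ u, h u, fun x => ?_⟩
  have hix : Integrable (fun y => h (x - y)) := hi.comp_sub_left x
  have h1 : IntegrableOn (fun _ : ℝ => (1 : ℝ)) (Set.Ioo a b) :=
    integrableOn_const (by simp)
  have hdom : IntegrableOn (fun y => 1 + h (x - y)) (Set.Ioo a b) := h1.add hix.integrableOn
  have hmain : IntegrableOn (fun y : ℝ => |x - y| ^ (-(3 / 4) : ℝ)) (Set.Ioo a b) := by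
    refine Integrable.mono' hdom
      (by fun_prop : Measurable fun y : ℝ => |x - y| ^ (-(3 / 4) : ℝ)).aestronglyMeasurable (ae_of_all _ fun y => ?_)
    rw [Real.norm_of_nonneg (by positivity)]
    exact hle _
  refine ⟨hmain, (integral_mono hmain hdom fun y => hle _).trans ?_⟩
  rw [integral_add h1 hix.integrableOn]
  have : ∫ y in Set.Ioo a b, h (x - y) ≤ ∫ y, h (x - y) :=
    setIntegral_le_integral hix (ae_of_all _ fun y => hn _)
  rw [integral_sub_left_eq_self h volume x] at this
  linarith

/-- Replacing the larger base by the smaller one turns the product into a single power `-3/4`. -/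
lemma rpow_mul_inv_sqrt_le (A : ℝ) {B : ℝ} (hA : 0 ≤ A) (hB : 0 < B) :
    A ^ (-(1 / 4) : ℝ) * (√B)⁻¹ ≤ A ^ (-(3 / 4) : ℝ) + B ^ (-(3 / 4) : ℝ) := by
  have hs : (√B)⁻¹ = B ^ (-(1 / 2) : ℝ) := by rw [Real.sqrt_eq_rpow, Real.rpow_neg hB.le]
  rw [hs]
  have hB3 : 0 < B ^ (-(3 / 4) : ℝ) := Real.rpow_pos_of_pos hB _
  rcases hA.eq_or_lt with rfl | hA
  · rw [Real.zero_rpow (by norm_num), zero_mul]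
    positivity
  have hA3 : 0 < A ^ (-(3 / 4) : ℝ) := Real.rpow_pos_of_pos hA _
  have e : ∀ x : ℝ, 0 < x → x ^ (-(1 / 4) : ℝ) * x ^ (-(1 / 2) : ℝ) = x ^ (-(3 / 4) : ℝ) := by
    intro x hx
    rw [← Real.rpow_add hx]
    norm_num
  rcases le_total A B with h | h
  · have := Real.rpow_le_rpow_of_nonpos hA h (show (-(1 / 2) : ℝ) ≤ 0 by norm_num)
    have := mul_le_mul_of_nonneg_left this (Real.rpow_pos_of_pos hA (-(1 / 4))).le
    rw [e A hA] at this
    linarith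
  · have := Real.rpow_le_rpow_of_nonpos hB h (show (-(1 / 4) : ℝ) ≤ 0 by norm_num)
    have := mul_le_mul_of_nonneg_right this (Real.rpow_pos_of_pos hB (-(1 / 2))).le
    rw [e B hB] at this
    linarith

lemma integrableOn_rpow_mul_inv_sqrt (a b : ℝ) : ∃ C : ℝ, ∀ x : ℝ,
    IntegrableOn (fun y : ℝ => |x - y| ^ (-(1 / 4) : ℝ) * (√(y - a))⁻¹) (Set.Ioo a b) ∧
      ∫ y in Set.Ioo a b, |x - y| ^ (-(1 / 4) : ℝ) * (√(y - a))⁻¹ ≤ C := by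
  obtain ⟨C, hC⟩ := integrableOn_abs_sub_rpow a b
  refine ⟨C + C, fun x => ?_⟩
  have hle : ∀ y ∈ Set.Ioo a b, |x - y| ^ (-(1 / 4) : ℝ) * (√(y - a))⁻¹ ≤
      |x - y| ^ (-(3 / 4) : ℝ) + |a - y| ^ (-(3 / 4) : ℝ) := by
    intro y hy
    have := rpow_mul_inv_sqrt_le |x - y| (abs_nonneg _) (sub_pos.2 hy.1)
    rwa [abs_sub_comm a y, abs_of_pos (sub_pos.2 hy.1)]
  have hdom : IntegrableOn (fun y : ℝ => |x - y| ^ (-(3 / 4) : ℝ) + |a - y| ^ (-(3 / 4) : ℝ))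
    (Set.Ioo a b) := (hC x).1.add (hC a).1
  have hmain : IntegrableOn (fun y : ℝ => |x - y| ^ (-(1 / 4) : ℝ) * (√(y - a))⁻¹)
      (Set.Ioo a b) := by
    refine Integrable.mono' hdom
      (by fun_prop : Measurable fun y : ℝ =>
        |x - y| ^ (-(1 / 4) : ℝ) * (√(y - a))⁻¹).aestronglyMeasurable ?_
    filter_upwards [ae_restrict_mem measurableSet_Ioo] with y hy
    rw [Real.norm_of_nonneg (by positivity)]
    exact hle y hy
  refine ⟨hmain, (setIntegral_mono_on hmain hdom measurableSet_Ioo hle).trans ?_⟩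
  rw [integral_add (hC x).1 (hC a).1]
  exact add_le_add (hC x).2 (hC a).2

lemma integrableOn_log_mul_inv_sqrt (a b x : ℝ) :
    IntegrableOn (fun y : ℝ => Real.log (x - y) * (√(y - a))⁻¹) (Set.Ioo a b) := by
  obtain ⟨C, hC⟩ := integrableOn_rpow_mul_inv_sqrt a b
  have h2 : IntegrableOn (fun y : ℝ => |x - y| * (√(y - a))⁻¹) (Set.Ioo a b) := by
    refine (integrableOn_inv_sqrt_sub a b).1.bdd_mul (c := |x| + (|a| + |b|))
      (by fun_prop : Measurable fun y : ℝ => |x - y|).aestronglyMeasurable ?_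
    filter_upwards [ae_restrict_mem measurableSet_Ioo] with y hy
    rw [Real.norm_of_nonneg (abs_nonneg _)]
    have h1 : |x - y| ≤ |x| + |y| := abs_sub _ _
    have h3 : |y| ≤ |a| + |b| := by
      rw [abs_le]
      constructor
      · linarith [neg_abs_le a, abs_nonneg b, hy.1]
      · linarith [le_abs_self b, abs_nonneg a, hy.2]
    linarith
  refine Integrable.mono' (((hC x).1.const_mul 4).add h2)
    (by fun_prop : Measurable fun y : ℝ =>
        Real.log (x - y) * (√(y - a))⁻¹).aestronglyMeasurable (ae_of_all _ fun y => ?_)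
  rw [norm_mul, Real.norm_eq_abs, Real.norm_of_nonneg (inv_nonneg.2 (Real.sqrt_nonneg _))]
  refine (mul_le_mul_of_nonneg_right (abs_log_le_rpow_add (x - y))
    (inv_nonneg.2 (Real.sqrt_nonneg _))).trans (le_of_eq ?_)
  simp only [Pi.add_apply]
  ring

/-! ### The limit law as a superposition of arcsine laws -/

/-- The conditions satisfied by the endpoints `a < b` of the limiting spectrum. -/
structure AdmissiblePair (α a b : ℝ) : Prop where
  nonneg : 0 ≤ α
  left_pos : 0 < α → 0 < a
  lt : a < b
  phi_nonneg : 0 ≤ phiFun α b a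
  psi_eq_zero : psiFun α b a = 0

lemma AdmissiblePair.right_pos {α a b : ℝ} (h : AdmissiblePair α a b) (hα : 0 < α) : 0 < b :=
  (h.left_pos hα).trans h.lt

lemma limitDensity_bracket {α a b : ℝ} (h : AdmissiblePair α a b) (y : ℝ) :
    2 * y + b - a - 2 * α * √(a / b) * (1 / y) =
      2 * y + b - a - 2 * α * √a * (√b)⁻¹ * y⁻¹ := by
  rcases h.nonneg.eq_or_lt with rfl | hα
  · simp
  · rw [Real.sqrt_div (h.left_pos hα).le]
    ring

/-- The bracket increases with `x` and equals `φ(b, a)` at `x = a`, so `φ ≥ 0` is exactly its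
nonnegativity on the support. -/
lemma phiFun_le_bracket {α a b x : ℝ} (h : AdmissiblePair α a b) (hx : a ≤ x) :
    phiFun α b a ≤ 2 * x + b - a - 2 * α * √a * (√b)⁻¹ * x⁻¹ := by
  unfold phiFun
  rcases h.nonneg.eq_or_lt with rfl | hα
  · simp; linarith
  · have ha := h.left_pos hα
    have hb := h.right_pos hα
    have h1 : 2 * α * √a * (√b)⁻¹ * x⁻¹ ≤ 2 * α * √a * (√b)⁻¹ * a⁻¹ := by gcongr
    have h2 : 2 * α * √a * (√b)⁻¹ * a⁻¹ = 2 * α / √(a * b) := by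
      have e : √a * √a = a := Real.mul_self_sqrt ha.le
      rw [Real.sqrt_mul ha.le]
      have : 0 < √a := Real.sqrt_pos.2 ha
      have : 0 < √b := Real.sqrt_pos.2 hb
      nth_rewrite 2 [← e]
      field_simp
    linarith

lemma bracket_le_phiFun {α a b x : ℝ} (h : AdmissiblePair α a b) (hx : x ≤ a)
    (h0 : 0 < α → 0 < x) :
    2 * x + b - a - 2 * α * √a * (√b)⁻¹ * x⁻¹ ≤ phiFun α b a := by
  unfold phiFun
  rcases h.nonneg.eq_or_lt with rfl | hα
  · simp; linarith
  · have ha := h.left_pos hα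
    have hb := h.right_pos hα
    have hx0 := h0 hα
    have h1 : 2 * α * √a * (√b)⁻¹ * a⁻¹ ≤ 2 * α * √a * (√b)⁻¹ * x⁻¹ := by gcongr
    have h2 : 2 * α * √a * (√b)⁻¹ * a⁻¹ = 2 * α / √(a * b) := by
      have e : √a * √a = a := Real.mul_self_sqrt ha.le
      rw [Real.sqrt_mul ha.le]
      have : 0 < √a := Real.sqrt_pos.2 ha
      have : 0 < √b := Real.sqrt_pos.2 hb
      nth_rewrite 2 [← e]
      field_simp
    linarith

lemma limitDensity_nonneg {α a b x : ℝ} (h : AdmissiblePair α a b) (hx : a ≤ x) :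
    0 ≤ limitDensity α a b x := by
  unfold limitDensity
  rw [limitDensity_bracket h]
  have := h.phi_nonneg.trans (phiFun_le_bracket h hx)
  positivity

lemma limitDensity_pos {α a b x : ℝ} (h : AdmissiblePair α a b) (hx : x ∈ Set.Ioo a b) :
    0 < limitDensity α a b x := by
  unfold limitDensity
  rw [limitDensity_bracket h]
  have h1 : 0 < (b - x) / (x - a) := div_pos (sub_pos.2 hx.2) (sub_pos.2 hx.1)
  -- Since `φ(b, a)` may vanish, strict positivity is taken from the growth of the bracket between
  -- the midpoint and `x`.
  have h3 : a < (a + x) / 2 := by linarith [hx.1]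
  have h2 : 0 < 2 * x + b - a - 2 * α * √a * (√b)⁻¹ * x⁻¹ := by
    have e := h.phi_nonneg.trans (phiFun_le_bracket h h3.le)
    have : 2 * α * √a * (√b)⁻¹ * x⁻¹ ≤ 2 * α * √a * (√b)⁻¹ * ((a + x) / 2)⁻¹ := by
      rcases h.nonneg.eq_or_lt with rfl | hα
      · simp
      · have ha := h.left_pos hα
        have hb := h.right_pos hα
        have : 0 < (a + x) / 2 := ha.trans h3
        have : (a + x) / 2 ≤ x := by linarith [hx.1]
        gcongr
    linarith [hx.1]
  have := Real.sqrt_pos.2 h1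
  positivity

lemma measurable_limitDensity (α a b : ℝ) : Measurable (limitDensity α a b) := by
  unfold limitDensity; fun_prop

lemma limitDensity_le {α a b : ℝ} (h : AdmissiblePair α a b) :
    ∃ C, 0 < C ∧ ∀ x, a < x → x ≤ b → limitDensity α a b x ≤ C * (√(x - a))⁻¹ := by
  refine ⟨1 / (2 * Real.pi) * √(b - a) * (|3 * b - a| + 1), ?_, fun x hx hxb => ?_⟩
  · have := Real.sqrt_pos.2 (sub_pos.2 h.lt)
    positivity
  · unfold limitDensity
    rw [limitDensity_bracket h, Real.sqrt_div (by linarith)]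
    have h1 : √(b - x) ≤ √(b - a) := Real.sqrt_le_sqrt (by linarith)
    have h2 : 2 * x + b - a - 2 * α * √a * (√b)⁻¹ * x⁻¹ ≤ |3 * b - a| + 1 := by
      have : 0 ≤ 2 * α * √a * (√b)⁻¹ * x⁻¹ := by
        rcases h.nonneg.eq_or_lt with rfl | hα
        · simp
        · have := (h.left_pos hα).trans hx
          positivity
      linarith [le_abs_self (3 * b - a)]
    have h3 := h.phi_nonneg.trans (phiFun_le_bracket h hx.le)
    calc 1 / (2 * Real.pi) * (√(b - x) / √(x - a)) *
          (2 * x + b - a - 2 * α * √a * (√b)⁻¹ * x⁻¹)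
        ≤ 1 / (2 * Real.pi) * (√(b - a) / √(x - a)) * (|3 * b - a| + 1) := by gcongr
      _ = _ := by ring

/-- The Abel integral of `q` in closed form reproduces the bracket, which exhibits the density as
the mixture of the arcsine densities `π⁻¹ / √((y - a)(s - y))` with weight `q(s)`. -/
lemma limitDensity_eq {α a b y : ℝ} (h : AdmissiblePair α a b) (hy : y ∈ Set.Ioo a b) :
    limitDensity α a b y = Real.pi⁻¹ * (√(y - a))⁻¹ *
      ∫ s in Set.Ioo a b, mixingDensity α a s * (√(s - y))⁻¹ := by
  rw [integral_mixingDensity_right_of_mem h.nonneg h.left_pos hy.1.le hy.2.le]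
  unfold limitDensity
  rw [limitDensity_bracket h, Real.sqrt_div (by linarith [hy.2])]
  ring

lemma integral_limitLaw {α a b : ℝ} (h : AdmissiblePair α a b) (g : ℝ → ℝ) :
    ∫ y, g y ∂(limitLaw α a b) = ∫ y in Set.Ioo a b, limitDensity α a b y * g y := by
  unfold limitLaw
  rw [integral_withDensity_eq_integral_toReal_smul (measurable_limitDensity α a b).ennreal_ofReal
    (ae_of_all _ fun _ => ENNReal.ofReal_lt_top), integral_Ioc_eq_integral_Ioo]
  refine setIntegral_congr_fun measurableSet_Ioo fun y hy => ?_
  simp only [smul_eq_mul]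
  rw [ENNReal.toReal_ofReal (limitDensity_nonneg h hy.1.le)]

lemma integrable_limitLaw_of_mul_inv_sqrt {α a b : ℝ} (h : AdmissiblePair α a b) {g : ℝ → ℝ}
    (hg : Measurable g) (hi : IntegrableOn (fun y => g y * (√(y - a))⁻¹) (Set.Ioo a b)) :
    Integrable g (limitLaw α a b) := by
  unfold limitLaw
  obtain ⟨C, hC, hle⟩ := limitDensity_le h
  rw [integrable_withDensity_iff (measurable_limitDensity α a b).ennreal_ofReal
    (ae_of_all _ fun _ => ENNReal.ofReal_lt_top)]
  refine Integrable.mono' (g := fun y => C * ‖g y * (√(y - a))⁻¹‖) ?_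
    (hg.mul (measurable_limitDensity α a b).ennreal_ofReal.ennreal_toReal).aestronglyMeasurable ?_
  · have : IntegrableOn (fun y => g y * (√(y - a))⁻¹) (Set.Ioc a b) :=
      (integrableOn_Ioc_iff_integrableOn_Ioo enorm_ne_top).2 hi
    exact this.norm.const_mul C
  · filter_upwards [ae_restrict_mem measurableSet_Ioc] with y hy
    rw [ENNReal.toReal_ofReal (limitDensity_nonneg h hy.1.le), norm_mul, norm_mul,
      Real.norm_of_nonneg (limitDensity_nonneg h hy.1.le),
      Real.norm_of_nonneg (inv_nonneg.2 (Real.sqrt_nonneg _))]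
    calc ‖g y‖ * limitDensity α a b y ≤ ‖g y‖ * (C * (√(y - a))⁻¹) := by
          gcongr; exact hle y hy.1 hy.2
      _ = _ := by ring

/-- Integrals against the limit law are mixtures of arcsine integrals. -/
lemma integral_limitLaw_eq_mixture {α a b : ℝ} (h : AdmissiblePair α a b) {g : ℝ → ℝ}
    (hg : Measurable g) (hi : IntegrableOn (fun y => g y * (√(y - a))⁻¹) (Set.Ioo a b)) :
    ∫ y, g y ∂(limitLaw α a b) = ∫ s in Set.Ioo a b, mixingDensity α a s *
      (Real.pi⁻¹ * ∫ y in Set.Ioo a s, g y * ((√(y - a))⁻¹ * (√(s - y))⁻¹)) ∧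
    IntegrableOn (fun s => mixingDensity α a s *
      (Real.pi⁻¹ * ∫ y in Set.Ioo a s, g y * ((√(y - a))⁻¹ * (√(s - y))⁻¹))) (Set.Ioo a b) := by
  obtain ⟨M, hM0, hM⟩ := abs_mixingDensity_le h.nonneg h.left_pos b
  set F : ℝ → ℝ → ℝ := fun y s => Real.pi⁻¹ * (g y * (√(y - a))⁻¹) *
    (mixingDensity α a s * (√(s - y))⁻¹) with hF
  have hmeas : Measurable (Function.uncurry F) := by
    have := measurable_mixingDensity α a
    simp only [hF, Function.uncurry_def]
    fun_prop
  have hFs : ∀ y ∈ Set.Ioo a b, Integrable (fun s => F y s) (volume.restrict (Set.Ioo a b)) :=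
    fun y hy => (IntegrableOn.mixingDensity_mul h.nonneg h.left_pos
        (integrableOn_inv_sqrt_sub_Ioo hy.1.le).1 le_rfl le_rfl).const_mul _
  -- As `q` can change sign, Fubini rests on `|q| ≤ M` and on the value of the remaining inverse
  -- square root integral.
  have hint : Integrable (Function.uncurry F)
      ((volume.restrict (Set.Ioo a b)).prod (volume.restrict (Set.Ioo a b))) := by
    rw [integrable_prod_iff hmeas.aestronglyMeasurable]
    constructor
    · filter_upwards [ae_restrict_mem measurableSet_Ioo] with y hy
      exact hFs y hy
    · refine Integrable.mono' (g := fun y => Real.pi⁻¹ * ‖g y * (√(y - a))⁻¹‖ *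
        (M * (2 * √(b - a)))) ((hi.norm.const_mul _).mul_const _)
        hmeas.norm.aestronglyMeasurable.integral_prod_right' ?_
      filter_upwards [ae_restrict_mem measurableSet_Ioo] with y hy
      rw [Real.norm_of_nonneg (integral_nonneg fun _ => norm_nonneg _)]
      have hy1 := integrableOn_inv_sqrt_sub_Ioo (b := b) hy.1.le
      calc ∫ s in Set.Ioo a b, ‖Function.uncurry F (y, s)‖
          ≤ ∫ s in Set.Ioo a b, Real.pi⁻¹ * ‖g y * (√(y - a))⁻¹‖ * (M * (√(s - y))⁻¹) := by
            refine setIntegral_mono_on (hFs y hy).norm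
              ((hy1.1.const_mul M).const_mul _) measurableSet_Ioo fun s hs => ?_
            simp only [Function.uncurry, hF]
            rw [norm_mul, norm_mul, Real.norm_of_nonneg (inv_nonneg.2 Real.pi_pos.le),
              norm_mul (mixingDensity α a s), Real.norm_eq_abs (mixingDensity α a s),
              Real.norm_of_nonneg (inv_nonneg.2 (Real.sqrt_nonneg (s - y)))]
            have := hM s (Set.Ioo_subset_Icc_self hs)
            gcongr
        _ = Real.pi⁻¹ * ‖g y * (√(y - a))⁻¹‖ * (M * (2 * √(b - y))) := by
            rw [integral_const_mul, integral_const_mul, hy1.2]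
        _ ≤ _ := by
            have : √(b - y) ≤ √(b - a) := Real.sqrt_le_sqrt (by linarith [hy.1])
            gcongr
  have hinner : ∀ s ∈ Set.Ioo a b, ∫ y in Set.Ioo a b, F y s = mixingDensity α a s *
      (Real.pi⁻¹ * ∫ y in Set.Ioo a s, g y * ((√(y - a))⁻¹ * (√(s - y))⁻¹)) := by
    intro s hs
    have hsub : Set.Ioo a s ⊆ Set.Ioo a b := Set.Ioo_subset_Ioo_right hs.2.le
    rw [setIntegral_eq_of_subset_of_forall_sdiff_eq_zero measurableSet_Ioo hsub (by
      rintro y ⟨hy, hy'⟩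
      simp only [hF]
      rw [inv_sqrt_sub_eq_zero (not_lt.1 fun h => hy' ⟨hy.1, h⟩), mul_zero, mul_zero]),
      ← integral_const_mul, ← integral_const_mul]
    refine integral_congr_ae (ae_of_all _ fun y => ?_)
    simp only [hF]
    ring
  constructor
  · rw [integral_limitLaw h]
    calc ∫ y in Set.Ioo a b, limitDensity α a b y * g y
        = ∫ y in Set.Ioo a b, ∫ s in Set.Ioo a b, F y s := by
          refine setIntegral_congr_fun measurableSet_Ioo fun y hy => ?_
          simp only [hF]
          rw [integral_const_mul, limitDensity_eq h hy]
          ring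
      _ = ∫ s in Set.Ioo a b, ∫ y in Set.Ioo a b, F y s := integral_integral_swap hint
      _ = _ := setIntegral_congr_fun measurableSet_Ioo hinner
  · exact (hint.integral_prod_right.congr (by
      filter_upwards [ae_restrict_mem measurableSet_Ioo] with s hs using hinner s hs) : _)

/-- Half of `ψ(·, a)` is a primitive of `q` and `ψ(a, a) = -2`, so the integral is one precisely
because `ψ(b, a) = 0`. -/
lemma integral_mixingDensity {α a b : ℝ} (h : AdmissiblePair α a b) :
    ∫ s in Set.Ioo a b, mixingDensity α a s = 1 := by
  have hi := IntegrableOn.mixingDensity_mul (b := b) h.nonneg h.left_pos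
    (integrableOn_const (μ := volume) (s := Set.Ioo a b) (C := (1 : ℝ)) (by simp)) le_rfl le_rfl
  simp only [mul_one] at hi
  rw [← integral_Ioc_eq_integral_Ioo, ← intervalIntegral.integral_of_le h.lt.le]
  have hd : ∀ s ∈ Set.Ioo a b, HasDerivAt (fun s => 3 / 8 * (s - a) ^ 2 + a / 2 * (s - a) +
      α * √a * (√s)⁻¹) (mixingDensity α a s) s := by
    intro s hs
    unfold mixingDensity
    have e1 := (((hasDerivAt_id s).sub_const a).pow 2).const_mul (3 / 8)
    have e2 := ((hasDerivAt_id s).sub_const a).const_mul (a / 2)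
    rcases h.nonneg.eq_or_lt with rfl | hα
    · simp only [zero_mul, add_zero]
      refine (e1.add e2).congr_deriv ?_
      simp only [id]
      push_cast
      ring
    · have hs0 : 0 < s := (h.left_pos hα).trans hs.1
      have hv : 0 < √s := Real.sqrt_pos.2 hs0
      have e3 := (((hasDerivAt_id s).sqrt hs0.ne').inv hv.ne').const_mul (α * √a)
      refine ((e1.add e2).add e3).congr_deriv ?_
      simp only [id]
      have e : √s ^ 2 = s := Real.sq_sqrt hs0.le
      rw [e]
      field_simp
      ring
  rw [intervalIntegral.integral_eq_sub_of_hasDerivAt_of_le h.lt.le ?_ hd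
    ((intervalIntegrable_iff_integrableOn_Ioo_of_le h.lt.le).2 hi)]
  · have hψ := h.psi_eq_zero
    unfold psiFun at hψ
    rcases h.nonneg.eq_or_lt with rfl | hα
    · simp only [mul_zero, zero_mul] at hψ ⊢
      linarith
    · have : √a * (√a)⁻¹ = 1 := mul_inv_cancel₀ (Real.sqrt_pos.2 (h.left_pos hα)).ne'
      rw [div_eq_mul_inv] at hψ
      linear_combination hψ / 2 - α * this
  · rcases h.nonneg.eq_or_lt with rfl | hα
    · simp only [zero_mul]; fun_prop
    · have : ∀ s ∈ Set.Icc a b, √s ≠ 0 := fun s hs =>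
        (Real.sqrt_pos.2 ((h.left_pos hα).trans_le hs.1)).ne'
      fun_prop (disch := assumption)

lemma integrableOn_limitDensity {α a b : ℝ} (h : AdmissiblePair α a b) :
    IntegrableOn (limitDensity α a b) (Set.Ioc a b) := by
  obtain ⟨C, hC, hle⟩ := limitDensity_le h
  refine Integrable.mono' (g := fun y => C * (√(y - a))⁻¹)
    (((integrableOn_Ioc_iff_integrableOn_Ioo enorm_ne_top).2 (integrableOn_inv_sqrt_sub a b).1).const_mul C)
    (measurable_limitDensity α a b).aestronglyMeasurable ?_
  filter_upwards [ae_restrict_mem measurableSet_Ioc] with y hy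
  rw [Real.norm_of_nonneg (limitDensity_nonneg h hy.1.le)]
  exact hle y hy.1 hy.2

theorem isProbabilityMeasure_limitLaw {α a b : ℝ} (h : AdmissiblePair α a b) :
    IsProbabilityMeasure (limitLaw α a b) := by
  have h1 := (integral_limitLaw_eq_mixture h (g := fun _ => 1) measurable_const
    (by simpa using (integrableOn_inv_sqrt_sub a b).1)).1
  rw [integral_limitLaw h] at h1
  have h2 : ∀ s ∈ Set.Ioo a b, mixingDensity α a s *
      (Real.pi⁻¹ * ∫ y in Set.Ioo a s, 1 * ((√(y - a))⁻¹ * (√(s - y))⁻¹)) =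
      mixingDensity α a s := by
    intro s hs
    rw [integral_Ioo_arcsine_subst hs.1 (fun _ => 1)]
    simp [Real.pi_pos.le, Real.pi_ne_zero]
  rw [setIntegral_congr_fun measurableSet_Ioo h2, integral_mixingDensity h] at h1
  simp only [mul_one] at h1
  constructor
  unfold limitLaw
  rw [withDensity_apply _ MeasurableSet.univ, Measure.restrict_univ,
    ← ofReal_integral_eq_lintegral_ofReal (integrableOn_limitDensity h), integral_Ioc_eq_integral_Ioo,
    h1, ENNReal.ofReal_one]
  filter_upwards [ae_restrict_mem measurableSet_Ioc] with y hy using limitDensity_nonneg h hy.1.le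

lemma limitLaw_ae_mem (α a b : ℝ) : ∀ᵐ y ∂(limitLaw α a b), y ∈ Set.Ioc a b :=
  (withDensity_absolutelyContinuous _ _).ae_le (ae_restrict_mem measurableSet_Ioc)

theorem support_limitLaw {α a b : ℝ} (h : AdmissiblePair α a b) :
    (limitLaw α a b).support = Set.Icc a b := by
  apply subset_antisymm
  · apply Measure.support_subset_of_isClosed isClosed_Icc
    filter_upwards [limitLaw_ae_mem α a b] with y hy using Set.Ioc_subset_Icc_self hy
  · intro x hx
    rw [Measure.mem_support_iff_forall]
    intro U hU
    obtain ⟨V, hVU, hVo, hxV⟩ := mem_nhds_iff.1 hU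
    have hne : (V ∩ Set.Ioo a b).Nonempty := by
      have : x ∈ closure (Set.Ioo a b) := by rwa [closure_Ioo h.lt.ne]
      exact mem_closure_iff.1 this V hVo hxV
    have hpos : 0 < volume (V ∩ Set.Ioo a b) := (hVo.inter isOpen_Ioo).measure_pos _ hne
    refine lt_of_lt_of_le ?_ (measure_mono (Set.inter_subset_left.trans hVU : V ∩ Set.Ioo a b ⊆ U))
    have hm : MeasurableSet (V ∩ Set.Ioo a b) := (hVo.inter isOpen_Ioo).measurableSet
    unfold limitLaw
    rw [withDensity_apply _ hm, Measure.restrict_restrict hm, lintegral_pos_iff_support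
      (measurable_limitDensity α a b).ennreal_ofReal]
    have : V ∩ Set.Ioo a b ⊆ Function.support fun x => ENNReal.ofReal (limitDensity α a b x) := by
      intro y hy
      simpa using limitDensity_pos h hy.2
    refine lt_of_lt_of_le ?_ (measure_mono this)
    rw [Measure.restrict_apply hm]
    refine lt_of_lt_of_le hpos (measure_mono fun y hy => ⟨hy, hy, Set.Ioo_subset_Ioc_self hy.2⟩)

/-- The bound is uniform in `x`, so it survives integration against any probability measure, in
particular an empirical one. This controls the truncation of the logarithm. -/
lemma limitLaw_rpow_bound {α a b : ℝ} (h : AdmissiblePair α a b) : ∃ M : ℝ, ∀ x : ℝ,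
    Integrable (fun y : ℝ => |x - y| ^ (-(1 / 4) : ℝ)) (limitLaw α a b) ∧
      ∫ y, |x - y| ^ (-(1 / 4) : ℝ) ∂(limitLaw α a b) ≤ M := by
  obtain ⟨C, hC, hle⟩ := limitDensity_le h
  obtain ⟨D, hD⟩ := integrableOn_rpow_mul_inv_sqrt a b
  refine ⟨C * D, fun x => ?_⟩
  have hi := integrable_limitLaw_of_mul_inv_sqrt h (g := fun y : ℝ => |x - y| ^ (-(1 / 4) : ℝ))
    (by fun_prop) (hD x).1
  refine ⟨hi, ?_⟩
  rw [integral_limitLaw h]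
  calc ∫ y in Set.Ioo a b, limitDensity α a b y * |x - y| ^ (-(1 / 4) : ℝ)
      ≤ ∫ y in Set.Ioo a b, C * (|x - y| ^ (-(1 / 4) : ℝ) * (√(y - a))⁻¹) := by
        refine integral_mono_of_nonneg ?_ ((hD x).1.const_mul C) ?_
        · filter_upwards [ae_restrict_mem measurableSet_Ioo] with y hy
          exact mul_nonneg (limitDensity_nonneg h hy.1.le) (by positivity)
        · filter_upwards [ae_restrict_mem measurableSet_Ioo] with y hy
          have := mul_le_mul_of_nonneg_right (hle y hy.1 hy.2.le)
            (by positivity : 0 ≤ |x - y| ^ (-(1 / 4) : ℝ))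
          linarith
    _ = C * ∫ y in Set.Ioo a b, (|x - y| ^ (-(1 / 4) : ℝ) * (√(y - a))⁻¹) := integral_const_mul _ _
    _ ≤ C * D := by gcongr; exact (hD x).2

/-! ### The Euler-Lagrange conditions for the limit law -/

/-- The logarithmic potential `∫ log |x - y| ν(dy)`. -/
noncomputable def logPotential (ν : Measure ℝ) (x : ℝ) : ℝ := ∫ y, Real.log (x - y) ∂ν

/-- Beyond `b` the mixture lacks the part of the Abel integral over `(b, t)`, and that part is
nonnegative because `q ≥ 0` there. -/
lemma integral_mixingDensity_left_le {α a b t : ℝ} (h : AdmissiblePair α a b) (ht : a ≤ t) :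
    ∫ s in Set.Ioo a b, mixingDensity α a s * (√(t - s))⁻¹ ≤ √(t - a) * (t - α * t⁻¹) := by
  rw [← integral_mixingDensity_left h.nonneg h.left_pos ht]
  rcases le_total t b with htb | htb
  · have hsub : Set.Ioo a t ⊆ Set.Ioo a b := Set.Ioo_subset_Ioo_right htb
    rw [setIntegral_eq_of_subset_of_forall_sdiff_eq_zero measurableSet_Ioo hsub]
    rintro s ⟨hs, hs'⟩
    rw [inv_sqrt_sub_eq_zero (not_lt.1 fun h => hs' ⟨hs.1, h⟩), mul_zero]
  · have hi : IntegrableOn (fun s => mixingDensity α a s * (√(t - s))⁻¹) (Set.Ioo a t) :=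
      IntegrableOn.mixingDensity_mul (b := t) h.nonneg h.left_pos
        (integrableOn_inv_sqrt_sub' a t).1 le_rfl le_rfl
    have hsub : Set.Ioo a b ⊆ Set.Ioo a t := Set.Ioo_subset_Ioo_right htb
    have h1 := integral_inter_add_sdiff (s := Set.Ioo a t) (t := Set.Ioo a b) measurableSet_Ioo hi
    rw [Set.inter_eq_self_of_subset_right hsub] at h1
    rw [← h1]
    refine le_add_of_nonneg_right (setIntegral_nonneg (measurableSet_Ioo.diff measurableSet_Ioo) ?_)
    rintro s ⟨hs, hs'⟩
    have hbs : b ≤ s := not_lt.1 fun h => hs' ⟨hs.1, h⟩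
    exact mul_nonneg (mixingDensity_nonneg h.nonneg h.left_pos h.lt h.phi_nonneg hbs) (by positivity)

lemma integral_mixingDensity_left_eq {α a b t : ℝ} (h : AdmissiblePair α a b) (ht : a ≤ t)
    (htb : t ≤ b) :
    ∫ s in Set.Ioo a b, mixingDensity α a s * (√(t - s))⁻¹ = √(t - a) * (t - α * t⁻¹) := by
  rw [← integral_mixingDensity_left h.nonneg h.left_pos ht]
  have hsub : Set.Ioo a t ⊆ Set.Ioo a b := Set.Ioo_subset_Ioo_right htb
  rw [setIntegral_eq_of_subset_of_forall_sdiff_eq_zero measurableSet_Ioo hsub]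
  rintro s ⟨hs, hs'⟩
  rw [inv_sqrt_sub_eq_zero (not_lt.1 fun h => hs' ⟨hs.1, h⟩), mul_zero]

lemma integral_sub_inv {α u v : ℝ} (huv : u ≤ v) (h0 : 0 < α → 0 < u) (hα : 0 ≤ α) :
    IntegrableOn (fun t => t - α * t⁻¹) (Set.Ioo u v) ∧
    ∫ t in Set.Ioo u v, (t - α * t⁻¹) =
      (v ^ 2 - u ^ 2) / 2 - α * (Real.log v - Real.log u) := by
  have hd : ∀ t ∈ Set.Ioo u v, HasDerivAt (fun t => t ^ 2 / 2 - α * Real.log t)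
      (t - α * t⁻¹) t := by
    intro t ht
    have e1 := ((hasDerivAt_id t).pow 2).div_const 2
    rcases hα.eq_or_lt with rfl | hα
    · simp only [zero_mul, sub_zero]
      refine e1.congr_deriv ?_
      simp
    · have ht0 : t ≠ 0 := ((h0 hα).trans ht.1).ne'
      refine (e1.sub ((Real.hasDerivAt_log ht0).const_mul α)).congr_deriv ?_
      simp
  have hc : ContinuousOn (fun t => t ^ 2 / 2 - α * Real.log t) (Set.Icc u v) := by
    rcases hα.eq_or_lt with rfl | hα
    · simp only [zero_mul]; fun_prop
    · have : ∀ t ∈ Set.Icc u v, t ≠ 0 := fun t ht => ((h0 hα).trans_le ht.1).ne'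
      fun_prop (disch := assumption)
  have hi : ContinuousOn (fun t => t - α * t⁻¹) (Set.Icc u v) := by
    rcases hα.eq_or_lt with rfl | hα
    · simp only [zero_mul]; fun_prop
    · have : ∀ t ∈ Set.Icc u v, t ≠ 0 := fun t ht => ((h0 hα).trans_le ht.1).ne'
      fun_prop (disch := assumption)
  have hint : IntegrableOn (fun t => t - α * t⁻¹) (Set.Ioo u v) :=
    hi.integrableOn_Icc.mono_set Set.Ioo_subset_Icc_self
  refine ⟨hint, ?_⟩
  rw [← integral_Ioc_eq_integral_Ioo, ← intervalIntegral.integral_of_le huv,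
    intervalIntegral.integral_eq_sub_of_hasDerivAt_of_le huv hc hd
    ((intervalIntegrable_iff_integrableOn_Ioo_of_le huv).2 hint)]
  ring

/-- Each arcsine potential is a constant plus an integral along `(a, x)`; the constants `log((s -
a)/4)` cancel in the difference, and Fubini brings the Abel integral of `q` inside. -/
lemma logPotential_sub_right {α a b x : ℝ} (h : AdmissiblePair α a b) (hx : a ≤ x) :
    IntegrableOn (fun t => (√(t - a))⁻¹ *
      ∫ s in Set.Ioo a b, mixingDensity α a s * (√(t - s))⁻¹) (Set.Ioo a x) ∧
    logPotential (limitLaw α a b) x - logPotential (limitLaw α a b) a =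
      ∫ t in Set.Ioo a x, (√(t - a))⁻¹ *
        ∫ s in Set.Ioo a b, mixingDensity α a s * (√(t - s))⁻¹ := by
  obtain ⟨M, hM0, hM⟩ := abs_mixingDensity_le h.nonneg h.left_pos b
  obtain ⟨e1, i1⟩ := integral_limitLaw_eq_mixture h (g := fun y => Real.log (x - y)) (by fun_prop)
    (integrableOn_log_mul_inv_sqrt a b x)
  obtain ⟨e2, i2⟩ := integral_limitLaw_eq_mixture h (g := fun y => Real.log (a - y)) (by fun_prop)
    (integrableOn_log_mul_inv_sqrt a b a)
  set F : ℝ → ℝ → ℝ := fun t s => (√(t - a))⁻¹ * (mixingDensity α a s * (√(t - s))⁻¹) with hF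
  have hmeas : Measurable (Function.uncurry F) := by
    have := measurable_mixingDensity α a
    simp only [hF, Function.uncurry_def]
    fun_prop
  have hFs : ∀ t, Integrable (fun s => F t s) (volume.restrict (Set.Ioo a b)) :=
    fun t => (IntegrableOn.mixingDensity_mul h.nonneg h.left_pos
        (integrableOn_inv_sqrt_sub_Ioo' (t := t)).1 le_rfl le_rfl).const_mul _
  have hint : Integrable (Function.uncurry F)
      ((volume.restrict (Set.Ioo a x)).prod (volume.restrict (Set.Ioo a b))) := by
    rw [integrable_prod_iff hmeas.aestronglyMeasurable]
    constructor
    · exact ae_of_all _ fun t => hFs t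
    -- The inner integral is of order `√(t - a)`, which cancels the outer singularity and leaves a
    -- constant dominating function.
    · have hc : IntegrableOn (fun _ : ℝ => M * 2) (Set.Ioo a x) := integrableOn_const (by simp)
      refine Integrable.mono' hc hmeas.norm.aestronglyMeasurable.integral_prod_right' ?_
      filter_upwards [ae_restrict_mem measurableSet_Ioo] with t ht
      rw [Real.norm_of_nonneg (integral_nonneg fun _ => norm_nonneg _)]
      have ht1 := integrableOn_inv_sqrt_sub_Ioo' (t := t) (a := a) (b := b)
      have hta : 0 < √(t - a) := Real.sqrt_pos.2 (sub_pos.2 ht.1)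
      calc ∫ s in Set.Ioo a b, ‖Function.uncurry F (t, s)‖
          ≤ ∫ s in Set.Ioo a b, (√(t - a))⁻¹ * (M * (√(t - s))⁻¹) := by
            refine setIntegral_mono_on (hFs t).norm
              ((ht1.1.const_mul M).const_mul _) measurableSet_Ioo fun s hs => ?_
            simp only [Function.uncurry, hF]
            rw [norm_mul, norm_mul, Real.norm_of_nonneg (inv_nonneg.2 (Real.sqrt_nonneg (t - a))),
              Real.norm_eq_abs (mixingDensity α a s),
              Real.norm_of_nonneg (inv_nonneg.2 (Real.sqrt_nonneg (t - s)))]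
            have := hM s (Set.Ioo_subset_Icc_self hs)
            gcongr
        _ = (√(t - a))⁻¹ * (M * ∫ s in Set.Ioo a b, (√(t - s))⁻¹) := by
            rw [integral_const_mul, integral_const_mul]
        _ ≤ (√(t - a))⁻¹ * (M * (2 * √(t - a))) := by
            gcongr; exact ht1.2
        _ = M * 2 := by field_simp
  have hG : (fun t => (√(t - a))⁻¹ * ∫ s in Set.Ioo a b, mixingDensity α a s * (√(t - s))⁻¹) =
      fun t => ∫ s in Set.Ioo a b, F t s := by
    ext t
    simp only [hF]
    rw [integral_const_mul]
  rw [hG]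
  refine ⟨hint.integral_prod_left, ?_⟩
  rw [logPotential, logPotential, e1, e2, ← integral_sub i1 i2, integral_integral_swap hint]
  refine setIntegral_congr_fun measurableSet_Ioo fun s hs => ?_
  simp only [hF]
  rw [integral_log_arcsine_eq_right hs.1 hx, integral_log_arcsine_eq_right hs.1 le_rfl]
  simp only [Set.Ioo_self, Measure.restrict_empty, integral_zero_measure, add_zero]
  rw [← mul_sub, ← mul_sub, ← mul_sub, add_sub_cancel_left, ← mul_assoc (Real.pi⁻¹),
    inv_mul_cancel₀ Real.pi_ne_zero, one_mul, ← integral_const_mul]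
  refine integral_congr_ae (ae_of_all _ fun t => ?_)
  simp only
  ring

/-- Left of the support the kernel `1/√(s - t)` stays bounded after integration in `s`, so the only
singularity to dominate is `1/√(a - t)`. -/
lemma logPotential_sub_left {α a b x : ℝ} (h : AdmissiblePair α a b) (hx : x ≤ a) :
    IntegrableOn (fun t => (√(a - t))⁻¹ *
      ∫ s in Set.Ioo a b, mixingDensity α a s * (√(s - t))⁻¹) (Set.Ioo x a) ∧
    logPotential (limitLaw α a b) x - logPotential (limitLaw α a b) a =
      ∫ t in Set.Ioo x a, (√(a - t))⁻¹ *
        ∫ s in Set.Ioo a b, mixingDensity α a s * (√(s - t))⁻¹ := by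
  obtain ⟨M, hM0, hM⟩ := abs_mixingDensity_le h.nonneg h.left_pos b
  obtain ⟨e1, i1⟩ := integral_limitLaw_eq_mixture h (g := fun y => Real.log (x - y)) (by fun_prop)
    (integrableOn_log_mul_inv_sqrt a b x)
  obtain ⟨e2, i2⟩ := integral_limitLaw_eq_mixture h (g := fun y => Real.log (a - y)) (by fun_prop)
    (integrableOn_log_mul_inv_sqrt a b a)
  set F : ℝ → ℝ → ℝ := fun t s => (√(a - t))⁻¹ * (mixingDensity α a s * (√(s - t))⁻¹) with hF
  have hmeas : Measurable (Function.uncurry F) := by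
    have := measurable_mixingDensity α a
    simp only [hF, Function.uncurry_def]
    fun_prop
  have hk : ∀ t ∈ Set.Ioo x a, IntegrableOn (fun s => (√(s - t))⁻¹) (Set.Ioo a b) ∧
      ∫ s in Set.Ioo a b, (√(s - t))⁻¹ ≤ 2 * √(b - x) := by
    intro t ht
    obtain ⟨j1, j2⟩ := integrableOn_inv_sqrt_sub t b
    have hsub : Set.Ioo a b ⊆ Set.Ioo t b := Set.Ioo_subset_Ioo_left ht.2.le
    refine ⟨j1.mono_set hsub, ?_⟩
    calc _ ≤ ∫ s in Set.Ioo t b, (√(s - t))⁻¹ :=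
          setIntegral_mono_set j1 (ae_of_all _ fun s => inv_nonneg.2 (Real.sqrt_nonneg _))
            hsub.eventuallyLE
      _ ≤ _ := by
          rw [j2]
          have : √(b - t) ≤ √(b - x) := Real.sqrt_le_sqrt (by linarith [ht.1])
          linarith
  have hFs : ∀ t ∈ Set.Ioo x a, Integrable (fun s => F t s) (volume.restrict (Set.Ioo a b)) :=
    fun t ht => (IntegrableOn.mixingDensity_mul h.nonneg h.left_pos
        (hk t ht).1 le_rfl le_rfl).const_mul _
  have hint : Integrable (Function.uncurry F)
      ((volume.restrict (Set.Ioo x a)).prod (volume.restrict (Set.Ioo a b))) := by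
    rw [integrable_prod_iff hmeas.aestronglyMeasurable]
    constructor
    · filter_upwards [ae_restrict_mem measurableSet_Ioo] with t ht using hFs t ht
    · have hc : IntegrableOn (fun t : ℝ => (√(a - t))⁻¹ * (M * (2 * √(b - x)))) (Set.Ioo x a) :=
        (integrableOn_inv_sqrt_sub' x a).1.mul_const _
      refine Integrable.mono' hc hmeas.norm.aestronglyMeasurable.integral_prod_right' ?_
      filter_upwards [ae_restrict_mem measurableSet_Ioo] with t ht
      rw [Real.norm_of_nonneg (integral_nonneg fun _ => norm_nonneg _)]
      obtain ⟨j1, j2⟩ := hk t ht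
      calc ∫ s in Set.Ioo a b, ‖Function.uncurry F (t, s)‖
          ≤ ∫ s in Set.Ioo a b, (√(a - t))⁻¹ * (M * (√(s - t))⁻¹) := by
            refine setIntegral_mono_on (hFs t ht).norm
              ((j1.const_mul M).const_mul _) measurableSet_Ioo fun s hs => ?_
            simp only [Function.uncurry, hF]
            rw [norm_mul, norm_mul, Real.norm_of_nonneg (inv_nonneg.2 (Real.sqrt_nonneg (a - t))),
              Real.norm_eq_abs (mixingDensity α a s),
              Real.norm_of_nonneg (inv_nonneg.2 (Real.sqrt_nonneg (s - t)))]
            have := hM s (Set.Ioo_subset_Icc_self hs)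
            gcongr
        _ = (√(a - t))⁻¹ * (M * ∫ s in Set.Ioo a b, (√(s - t))⁻¹) := by
            rw [integral_const_mul, integral_const_mul]
        _ ≤ _ := by gcongr
  have hG : (fun t => (√(a - t))⁻¹ * ∫ s in Set.Ioo a b, mixingDensity α a s * (√(s - t))⁻¹) =
      fun t => ∫ s in Set.Ioo a b, F t s := by
    ext t
    simp only [hF]
    rw [integral_const_mul]
  rw [hG]
  refine ⟨hint.integral_prod_left, ?_⟩
  rw [logPotential, logPotential, e1, e2, ← integral_sub i1 i2, integral_integral_swap hint]
  refine setIntegral_congr_fun measurableSet_Ioo fun s hs => ?_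
  simp only [hF]
  rw [integral_log_arcsine_eq_left hs.1 hx, integral_log_arcsine_eq_left hs.1 le_rfl]
  simp only [Set.Ioo_self, Measure.restrict_empty, integral_zero_measure, add_zero]
  rw [← mul_sub, ← mul_sub, ← mul_sub, add_sub_cancel_left, ← mul_assoc (Real.pi⁻¹),
    inv_mul_cancel₀ Real.pi_ne_zero, one_mul, ← integral_const_mul]
  refine integral_congr_ae (ae_of_all _ fun t => ?_)
  simp only
  ring

/-- The external field `x² - 2 α log x` as a real function. -/
noncomputable def realField (α x : ℝ) : ℝ := x ^ 2 - 2 * α * Real.log x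

/-- On the support the effective potential is constant. -/
theorem effectivePotential_eq {α a b x : ℝ} (h : AdmissiblePair α a b) (hx : x ∈ Set.Icc a b) :
    realField α x - 2 * logPotential (limitLaw α a b) x =
      realField α a - 2 * logPotential (limitLaw α a b) a := by
  have h1 := (logPotential_sub_right h hx.1).2
  have h2 : ∫ t in Set.Ioo a x, (√(t - a))⁻¹ *
      ∫ s in Set.Ioo a b, mixingDensity α a s * (√(t - s))⁻¹ =
      ∫ t in Set.Ioo a x, (t - α * t⁻¹) := by
    refine setIntegral_congr_fun measurableSet_Ioo fun t ht => ?_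
    have : 0 < √(t - a) := Real.sqrt_pos.2 (sub_pos.2 ht.1)
    rw [integral_mixingDensity_left_eq h ht.1.le (ht.2.le.trans hx.2), ← mul_assoc,
      inv_mul_cancel₀ this.ne', one_mul]
  rw [h2, (integral_sub_inv hx.1 h.left_pos h.nonneg).2] at h1
  unfold realField
  linarith

/-- The effective potential is at least its value on the support. -/
theorem effectivePotential_ge {α a b x : ℝ} (h : AdmissiblePair α a b)
    (hedge : x < a → phiFun α b a = 0) (h0 : 0 < α → 0 < x) :
    realField α a - 2 * logPotential (limitLaw α a b) a ≤
      realField α x - 2 * logPotential (limitLaw α a b) x := by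
  rcases le_or_gt a x with hx | hx
  · obtain ⟨hi, h1⟩ := logPotential_sub_right h hx
    obtain ⟨hi2, h2⟩ := integral_sub_inv hx h.left_pos h.nonneg
    have h3 := setIntegral_mono_on hi hi2 measurableSet_Ioo fun t ht => by
      have : 0 < √(t - a) := Real.sqrt_pos.2 (sub_pos.2 ht.1)
      have := mul_le_mul_of_nonneg_left (integral_mixingDensity_left_le h ht.1.le)
        (inv_nonneg.2 this.le)
      rwa [← mul_assoc, inv_mul_cancel₀ (by positivity), one_mul] at this
    unfold realField
    linarith
  · obtain ⟨hi, h1⟩ := logPotential_sub_left h hx.le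
    obtain ⟨hi2, h2⟩ := integral_sub_inv hx.le h0 h.nonneg
    have h3 := setIntegral_mono_on hi hi2.neg measurableSet_Ioo fun t ht => by
      have hta : 0 < √(a - t) := Real.sqrt_pos.2 (sub_pos.2 ht.2)
      have ht0 : 0 < α → 0 < t := fun hα => (h0 hα).trans ht.1
      rw [integral_mixingDensity_right h.nonneg h.left_pos ht0 ht.2.le le_rfl h.lt.le]
      -- The soft edge enters here: with `φ(b, a) = 0` the bracket is nonpositive left of `a`, so
      -- the contribution of the endpoint `b` has the right sign. The contribution of the endpoint
      -- `a` is half the derivative of the field.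
      have e1 := bracket_le_phiFun h ht.2.le ht0
      rw [hedge hx] at e1
      have e2 : 2 * α * √a * (√a)⁻¹ = 2 * α := by
        rcases h.nonneg.eq_or_lt with h' | hα
        · rw [← h']; simp
        · have := h.left_pos hα
          field_simp
      rw [e2]
      have e3 : 1 / 2 * √(b - t) * (2 * t + b - a - 2 * α * √a * (√b)⁻¹ * t⁻¹) ≤ 0 :=
        mul_nonpos_of_nonneg_of_nonpos (by positivity) e1
      have e4 := mul_nonpos_of_nonneg_of_nonpos (inv_nonneg.2 hta.le) e3
      have e5 : (√(a - t))⁻¹ * (1 / 2 * √(a - t) * (2 * t + a - a - 2 * α * t⁻¹)) =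
          t - α * t⁻¹ := by
        calc _ = ((√(a - t))⁻¹ * √(a - t)) * (t - α * t⁻¹) := by ring
          _ = _ := by rw [inv_mul_cancel₀ hta.ne', one_mul]
      rw [mul_sub, e5]
      simp only [Pi.neg_apply]
      linarith
    simp only [Pi.neg_apply] at h3
    rw [integral_neg] at h3
    unfold realField
    linarith

/-! ### A regularised logarithmic kernel -/

/-- The truncation at `T` of the Frullani representation of `log (1 / |u|)`. -/
noncomputable def regLog (T u : ℝ) : ℝ :=
  ∫ t in Set.Ioc 0 T, (Real.exp (-(t * u ^ 2)) - Real.exp (-t)) / (2 * t)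

lemma abs_exp_sub_exp_le {x y : ℝ} (hx : x ≤ 0) (hy : y ≤ 0) :
    |Real.exp x - Real.exp y| ≤ |x - y| := by
  have key : ∀ x y : ℝ, x ≤ 0 → y ≤ x → |Real.exp x - Real.exp y| ≤ |x - y| := by
    intro x y hx hyx
    rw [abs_of_nonneg (sub_nonneg.2 (Real.exp_le_exp.2 hyx)), abs_of_nonneg (sub_nonneg.2 hyx)]
    have h1 : Real.exp y = Real.exp x * Real.exp (y - x) := by rw [← Real.exp_add]; ring_nf
    have h2 := Real.add_one_le_exp (y - x)
    have h3 : Real.exp x ≤ 1 := Real.exp_le_one_iff.2 hx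
    have h4 := Real.exp_pos x
    rw [h1]
    nlinarith [mul_le_mul_of_nonneg_left h2 h4.le]
  rcases le_total y x with h | h
  · exact key x y hx h
  · rw [abs_sub_comm, abs_sub_comm x y]
    exact key y x hy h

lemma abs_regLog_integrand_le {t c : ℝ} (ht : 0 < t) (hc : 0 ≤ c) :
    |(Real.exp (-(t * c)) - Real.exp (-t)) / (2 * t)| ≤ (1 + c) / 2 := by
  rw [abs_div, abs_of_pos (by positivity : 0 < 2 * t), div_le_iff₀ (by positivity)]
  refine (abs_exp_sub_exp_le (by nlinarith) (by linarith)).trans ?_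
  rw [show -(t * c) - -t = t * (1 - c) by ring, abs_mul, abs_of_pos ht]
  have : |1 - c| ≤ 1 + c := by rw [abs_le]; constructor <;> linarith
  nlinarith

lemma measurable_regLog_integrand :
    Measurable (fun p : ℝ × ℝ => (Real.exp (-(p.2 * p.1 ^ 2)) - Real.exp (-p.2)) / (2 * p.2)) := by
  fun_prop

lemma integrableOn_regLog_integrand (T u : ℝ) :
    IntegrableOn (fun t => (Real.exp (-(t * u ^ 2)) - Real.exp (-t)) / (2 * t)) (Set.Ioc 0 T) := by
  refine Integrable.mono' (g := fun _ => (1 + u ^ 2) / 2) (integrableOn_const (by simp))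
    (by fun_prop : Measurable fun t : ℝ =>
      (Real.exp (-(t * u ^ 2)) - Real.exp (-t)) / (2 * t)).aestronglyMeasurable ?_
  filter_upwards [ae_restrict_mem measurableSet_Ioc] with t ht
  exact abs_regLog_integrand_le ht.1 (sq_nonneg u)

lemma measurable_regLog (T : ℝ) : Measurable (regLog T) :=
  (measurable_regLog_integrand.stronglyMeasurable.integral_prod_right'
    (ν := volume.restrict (Set.Ioc 0 T))).measurable

lemma abs_regLog_le {T : ℝ} (hT : 0 ≤ T) (u : ℝ) : |regLog T u| ≤ T * ((1 + u ^ 2) / 2) := by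
  have := norm_setIntegral_le_of_norm_le_const (μ := volume) (s := Set.Ioc 0 T)
    (f := fun t => (Real.exp (-(t * u ^ 2)) - Real.exp (-t)) / (2 * t)) (C := (1 + u ^ 2) / 2)
    (by simp) fun t ht => abs_regLog_integrand_le ht.1 (sq_nonneg u)
  rw [Real.volume_real_Ioc_of_le hT, sub_zero] at this
  rw [mul_comm]
  exact this

/-- Holds at `u = 0` too: this is the price of including the self-interaction of the points of an
empirical measure. -/
lemma regLog_le {T : ℝ} (hT : 0 ≤ T) (u : ℝ) : regLog T u ≤ T / 2 := by
  have : regLog T u ≤ ∫ t in Set.Ioc 0 T, (1 / 2 : ℝ) := by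
    refine setIntegral_mono_on (integrableOn_regLog_integrand T u)
      (integrableOn_const (by simp)) measurableSet_Ioc fun t ht => ?_
    rw [div_le_iff₀ (by linarith [ht.1])]
    have h1 : Real.exp (-(t * u ^ 2)) ≤ 1 :=
      Real.exp_le_one_iff.2 (by nlinarith [ht.1, sq_nonneg u])
    have h2 := Real.add_one_le_exp (-t)
    linarith
  simpa [hT, div_eq_mul_inv] using this

lemma regLog_zero_nonneg (T : ℝ) : 0 ≤ regLog T 0 := by
  refine setIntegral_nonneg measurableSet_Ioc fun t ht => ?_
  have : Real.exp (-t) ≤ 1 := Real.exp_le_one_iff.2 (by linarith [ht.1])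
  have := ht.1
  simp only [ne_eq, OfNat.ofNat_ne_zero, not_false_eq_true, zero_pow, mul_zero, neg_zero,
    Real.exp_zero]
  exact div_nonneg (by linarith) (by linarith)

/-- Writing the difference of exponentials as an integral over `s ∈ [u², 1]` and integrating first
in `t` isolates the logarithm; the remainder is small for large `T`. -/
lemma regLog_eq {T u : ℝ} (hT : 0 ≤ T) (hu : u ≠ 0) :
    regLog T u = -Real.log u - 1 / 2 * ∫ s in (u ^ 2)..1, Real.exp (-(T * s)) / s := by
  have hc : 0 < u ^ 2 := by positivity
  set c := u ^ 2 with hcdef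
  have hpos : ∀ s ∈ Set.uIcc c 1, 0 < s := fun s hs =>
    lt_of_lt_of_le (lt_min hc one_pos) hs.1
  have e1 : regLog T u = ∫ t in (0 : ℝ)..T, ∫ s in c..1, 1 / 2 * Real.exp (-(t * s)) := by
    rw [intervalIntegral.integral_of_le hT, regLog]
    refine setIntegral_congr_fun measurableSet_Ioc fun t ht => ?_
    have ht0 : t ≠ 0 := ht.1.ne'
    rw [intervalIntegral.integral_eq_sub_of_hasDerivAt
      (f := fun s => -(Real.exp (-(t * s)) / (2 * t)))]
    · rw [mul_one]; ring
    · intro s _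
      have h1 : HasDerivAt (fun s => -(t * s)) (-t) s :=
          ((hasDerivAt_id s).const_mul t).neg.congr_deriv (by simp)
      refine (h1.exp.div_const (2 * t)).neg.congr_deriv ?_
      field_simp
    · exact (by fun_prop : Continuous fun s => 1 / 2 * Real.exp (-(t * s))).intervalIntegrable _ _
  have e2 : ∀ s ∈ Set.uIcc c 1, ∫ t in (0 : ℝ)..T, 1 / 2 * Real.exp (-(t * s)) =
      1 / 2 * s⁻¹ - 1 / 2 * (Real.exp (-(T * s)) / s) := by
    intro s hs
    have hs0 : s ≠ 0 := (hpos s hs).ne'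
    rw [intervalIntegral.integral_eq_sub_of_hasDerivAt
      (f := fun t => -(1 / 2 * (Real.exp (-(t * s)) / s)))]
    · rw [zero_mul, neg_zero, Real.exp_zero]; ring
    · intro t _
      have h1 : HasDerivAt (fun t => -(t * s)) (-s) t :=
          ((hasDerivAt_id t).mul_const s).neg.congr_deriv (by simp)
      refine ((h1.exp.div_const s).const_mul (1 / 2)).neg.congr_deriv ?_
      field_simp
    · exact (by fun_prop : Continuous fun t => 1 / 2 * Real.exp (-(t * s))).intervalIntegrable _ _
  have hc0 : (0 : ℝ) ∉ Set.uIcc c 1 := fun h => (hpos 0 h).false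
  have i1 : IntervalIntegrable (fun s : ℝ => 1 / 2 * s⁻¹) volume c 1 := by
    apply ContinuousOn.intervalIntegrable
    have : ∀ s ∈ Set.uIcc c 1, s ≠ 0 := fun s hs => (hpos s hs).ne'
    fun_prop (disch := assumption)
  have i2 : IntervalIntegrable (fun s : ℝ => 1 / 2 * (Real.exp (-(T * s)) / s)) volume c 1 := by
    apply ContinuousOn.intervalIntegrable
    have : ∀ s ∈ Set.uIcc c 1, s ≠ 0 := fun s hs => (hpos s hs).ne'
    fun_prop (disch := assumption)
  rw [e1, intervalIntegral_intervalIntegral_swap, intervalIntegral.integral_congr e2,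
    intervalIntegral.integral_sub i1 i2, intervalIntegral.integral_const_mul,
    intervalIntegral.integral_const_mul, integral_inv hc0, one_div c, Real.log_inv, hcdef,
    Real.log_pow]
  · push_cast; ring
  · refine (Continuous.continuousOn ?_).integrableOn_compact (isCompact_uIcc.prod isCompact_uIcc) |>.mono_set
      (Set.prod_mono Set.uIoc_subset_uIcc Set.uIoc_subset_uIcc)
    simp only [Function.uncurry_def]
    fun_prop

/-- The remainder has the favourable sign if `|u| ≤ 1`; otherwise it is at most `∫_1^∞ exp(-T s) ds
≤ 1 / T`. -/
lemma regLog_le_neg_log {T u : ℝ} (hT : 0 < T) (hu : u ≠ 0) :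
    regLog T u ≤ -Real.log u + 1 / T := by
  rw [regLog_eq hT.le hu]
  have hc : 0 < u ^ 2 := by positivity
  set c := u ^ 2
  rcases le_total c 1 with h | h
  · have : 0 ≤ ∫ s in c..1, Real.exp (-(T * s)) / s :=
      intervalIntegral.integral_nonneg h fun s hs =>
        div_nonneg (Real.exp_pos _).le (hc.le.trans hs.1)
    have : 0 < 1 / T := by positivity
    linarith
  · rw [intervalIntegral.integral_symm]
    have h1 : ∫ s in (1 : ℝ)..c, Real.exp (-(T * s)) / s ≤ ∫ s in (1 : ℝ)..c, Real.exp (-(T * s)) := by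
      refine intervalIntegral.integral_mono_on h ?_ ?_ fun s hs => ?_
      · apply ContinuousOn.intervalIntegrable
        have : ∀ s ∈ Set.uIcc 1 c, s ≠ 0 := fun s hs => by
          rw [Set.uIcc_of_le h] at hs; linarith [hs.1]
        fun_prop (disch := assumption)
      · exact (by fun_prop : Continuous fun s => Real.exp (-(T * s))).intervalIntegrable _ _
      · exact div_le_self (Real.exp_pos _).le hs.1
    have h2 : ∫ s in (1 : ℝ)..c, Real.exp (-(T * s)) =
        -(Real.exp (-(T * c)) / T) - -(Real.exp (-(T * 1)) / T) := by
      refine intervalIntegral.integral_eq_sub_of_hasDerivAt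
        (f := fun s => -(Real.exp (-(T * s)) / T)) (fun s _ => ?_) ?_
      · have h1 : HasDerivAt (fun s => -(T * s)) (-T) s :=
          ((hasDerivAt_id s).const_mul T).neg.congr_deriv (by simp)
        refine (h1.exp.div_const T).neg.congr_deriv ?_
        field_simp
      · exact (by fun_prop : Continuous fun s => Real.exp (-(T * s))).intervalIntegrable _ _
    have h3 : 0 < Real.exp (-(T * c)) / T := by positivity
    have h4 : Real.exp (-(T * 1)) / T ≤ 1 / T := by
      gcongr
      exact Real.exp_le_one_iff.2 (by linarith)
    have : 0 < 1 / T := by positivity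
    linarith

/-- From `exp(-v) ≤ v^(-1/8)`, the remainder is at most a constant times `T^(-1/8) ∫_{u²}^1 s^(-9/8)
ds`. This gives the power `|u|^(-1/4)`, whose integrals are controlled. -/
lemma neg_log_le_regLog {T : ℝ} (hT : 0 < T) (u : ℝ) :
    -Real.log u - 4 * T ^ (-(1 / 8) : ℝ) * |u| ^ (-(1 / 4) : ℝ) ≤ regLog T u := by
  rcases eq_or_ne u 0 with rfl | hu
  -- At `u = 0` both the logarithm and the negative power are `0` by default, so nonnegativity of
  -- `regLog T 0` suffices.
  · rw [abs_zero, Real.zero_rpow (by norm_num), Real.log_zero]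
    linarith [regLog_zero_nonneg T]
  rw [regLog_eq hT.le hu]
  have hc : 0 < u ^ 2 := by positivity
  have hTp : 0 < T ^ (-(1 / 8) : ℝ) := Real.rpow_pos_of_pos hT _
  have hcu : (u ^ 2) ^ (-(1 / 8) : ℝ) = |u| ^ (-(1 / 4) : ℝ) := by
    rw [← sq_abs, ← Real.rpow_natCast, ← Real.rpow_mul (abs_nonneg u)]
    norm_num
  rw [← hcu]
  set c := u ^ 2
  have hcp : 0 < c ^ (-(1 / 8) : ℝ) := Real.rpow_pos_of_pos hc _
  rcases le_total c 1 with h | h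
  · have hpos : ∀ s ∈ Set.uIcc c 1, 0 < s := fun s hs => by
      rw [Set.uIcc_of_le h] at hs; exact hc.trans_le hs.1
    have h1 : ∫ s in c..1, Real.exp (-(T * s)) / s ≤
        ∫ s in c..1, T ^ (-(1 / 8) : ℝ) * s ^ (-(9 / 8) : ℝ) := by
      refine intervalIntegral.integral_mono_on h ?_ ?_ fun s hs => ?_
      · apply ContinuousOn.intervalIntegrable
        have : ∀ s ∈ Set.uIcc c 1, s ≠ 0 := fun s hs => (hpos s hs).ne'
        fun_prop (disch := assumption)
      · apply ContinuousOn.intervalIntegrable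
        exact continuousOn_const.mul (ContinuousOn.rpow_const continuousOn_id
          fun s hs => Or.inl (hpos s hs).ne')
      · have hs0 : 0 < s := hc.trans_le hs.1
        have e1 : Real.exp (-(T * s)) ≤ (T * s) ^ (-(1 / 8) : ℝ) := by
          rw [Real.rpow_def_of_pos (by positivity)]
          apply Real.exp_le_exp.2
          have := Real.log_le_self (by positivity : 0 ≤ T * s)
          have : 0 < T * s := by positivity
          linarith
        rw [Real.mul_rpow hT.le hs0.le] at e1
        rw [div_le_iff₀ hs0]
        have e2 : s ^ (-(9 / 8) : ℝ) * s = s ^ (-(1 / 8) : ℝ) := by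
          rw [← Real.rpow_add_one hs0.ne']
          norm_num
        rw [mul_assoc, e2]
        exact e1
    rw [intervalIntegral.integral_const_mul, integral_rpow (Or.inr ⟨by norm_num, fun h0 =>
      (hpos 0 h0).false⟩)] at h1
    norm_num at h1 ⊢
    nlinarith
  · rw [intervalIntegral.integral_symm]
    have : 0 ≤ ∫ s in (1 : ℝ)..c, Real.exp (-(T * s)) / s :=
      intervalIntegral.integral_nonneg h fun s hs =>
        div_nonneg (Real.exp_pos _).le (zero_le_one.trans hs.1)
    have : 0 < T ^ (-(1 / 8) : ℝ) * c ^ (-(1 / 8) : ℝ) := by positivity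
    linarith

/-! ### Positivity of the regularised logarithmic energy -/

/-- The mutual energy for the Gaussian kernel. -/
noncomputable def gaussEnergy (t : ℝ) (ρ ν : Measure ℝ) : ℝ :=
  ∫ p, Real.exp (-(t * (p.1 - p.2) ^ 2)) ∂(ρ.prod ν)

/-- Unnormalised Gaussian smoothing of a measure. -/
noncomputable def gaussConv (t : ℝ) (ρ : Measure ℝ) (z : ℝ) : ℝ :=
  ∫ x, Real.exp (-(2 * t * (x - z) ^ 2)) ∂ρ

/-- The Gaussian energy of the difference of two measures. -/
noncomputable def gaussDist (t : ℝ) (ρ ν : Measure ℝ) : ℝ :=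
  gaussEnergy t ρ ρ - 2 * gaussEnergy t ρ ν + gaussEnergy t ν ν

lemma integral_exp_neg_mul_sq_sub {c : ℝ} (hc : 0 < c) (m : ℝ) :
    Integrable (fun z => Real.exp (-(c * (z - m) ^ 2))) ∧
      ∫ z, Real.exp (-(c * (z - m) ^ 2)) = √(Real.pi / c) := by
  have h1 := integrable_exp_neg_mul_sq hc
  have h2 := integral_gaussian c
  simp only [neg_mul] at h1 h2
  exact ⟨h1.comp_sub_right m, by
    rw [integral_sub_right_eq_self (fun z => Real.exp (-(c * z ^ 2))) m, h2]⟩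

/-- Completing the square, `2(x - z)² + 2(y - z)² = (x - y)² + 4(z - (x + y)/2)²`, writes the
Gaussian kernel as a convolution square. -/
lemma integral_gaussConv_mul {t : ℝ} (ht : 0 < t) (ρ ν : Measure ℝ) [IsProbabilityMeasure ρ]
    [IsProbabilityMeasure ν] :
    Integrable (fun z => gaussConv t ρ z * gaussConv t ν z) ∧
      ∫ z, gaussConv t ρ z * gaussConv t ν z = √(Real.pi / (4 * t)) * gaussEnergy t ρ ν := by
  set F : ℝ × ℝ → ℝ → ℝ := fun p z =>
    Real.exp (-(2 * t * (p.1 - z) ^ 2)) * Real.exp (-(2 * t * (p.2 - z) ^ 2)) with hF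
  have hFeq : ∀ p z, F p z = Real.exp (-(t * (p.1 - p.2) ^ 2)) *
      Real.exp (-(4 * t * (z - (p.1 + p.2) / 2) ^ 2)) := by
    intro p z
    simp only [hF, ← Real.exp_add]
    ring_nf
  have hmeas : Measurable (Function.uncurry F) := by
    simp only [hF, Function.uncurry_def]
    fun_prop
  have hval : ∀ p, ∫ z, F p z = √(Real.pi / (4 * t)) * Real.exp (-(t * (p.1 - p.2) ^ 2)) := by
    intro p
    simp_rw [hFeq]
    rw [integral_const_mul, (integral_exp_neg_mul_sq_sub (by positivity) _).2, mul_comm]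
  have hle1 : ∀ u : ℝ, Real.exp (-(t * u ^ 2)) ≤ 1 := fun u =>
    Real.exp_le_one_iff.2 (by nlinarith [sq_nonneg u])
  have hint : Integrable (Function.uncurry F) ((ρ.prod ν).prod volume) := by
    rw [integrable_prod_iff hmeas.aestronglyMeasurable]
    constructor
    · refine ae_of_all _ fun p => ?_
      simp only [Function.uncurry, hFeq]
      exact (integral_exp_neg_mul_sq_sub (by positivity) _).1.const_mul _
    · refine Integrable.mono' (g := fun _ => √(Real.pi / (4 * t))) (integrable_const _)
        hmeas.norm.aestronglyMeasurable.integral_prod_right' (ae_of_all _ fun p => ?_)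
      have : ∀ z, ‖Function.uncurry F (p, z)‖ = F p z := fun z => by
        simp only [Function.uncurry, hF]
        exact Real.norm_of_nonneg (by positivity)
      simp_rw [this]
      rw [hval, Real.norm_of_nonneg (by positivity)]
      exact mul_le_of_le_one_right (Real.sqrt_nonneg _) (hle1 _)
  have hz : ∀ z, ∫ p, F p z ∂(ρ.prod ν) = gaussConv t ρ z * gaussConv t ν z := by
    intro z
    exact integral_prod_mul (fun x => Real.exp (-(2 * t * (x - z) ^ 2)))
      (fun y => Real.exp (-(2 * t * (y - z) ^ 2)))
  constructor
  · exact hint.integral_prod_right.congr (ae_of_all _ hz)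
  · calc ∫ z, gaussConv t ρ z * gaussConv t ν z = ∫ z, ∫ p, F p z ∂(ρ.prod ν) := by simp_rw [hz]
      _ = ∫ p, (∫ z, F p z) ∂(ρ.prod ν) := (integral_integral_swap hint).symm
      _ = _ := by
          simp_rw [hval]
          rw [integral_const_mul]
          rfl

/-- Positive definiteness: up to a factor, the Gaussian energy of `ρ - ν` is the squared `L²` norm
of its smoothing. -/
lemma integral_gaussConv_sub_sq {t : ℝ} (ht : 0 < t) (ρ ν : Measure ℝ) [IsProbabilityMeasure ρ]
    [IsProbabilityMeasure ν] :
    Integrable (fun z => (gaussConv t ρ z - gaussConv t ν z) ^ 2) ∧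
      ∫ z, (gaussConv t ρ z - gaussConv t ν z) ^ 2 =
        √(Real.pi / (4 * t)) * gaussDist t ρ ν := by
  obtain ⟨i1, e1⟩ := integral_gaussConv_mul ht ρ ρ
  obtain ⟨i2, e2⟩ := integral_gaussConv_mul ht ρ ν
  obtain ⟨i3, e3⟩ := integral_gaussConv_mul ht ν ν
  have hfun : (fun z => (gaussConv t ρ z - gaussConv t ν z) ^ 2) = fun z =>
      gaussConv t ρ z * gaussConv t ρ z - 2 * (gaussConv t ρ z * gaussConv t ν z) +
        gaussConv t ν z * gaussConv t ν z := by
    ext z; ring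
  have i4 : Integrable fun z => gaussConv t ρ z * gaussConv t ρ z -
    2 * (gaussConv t ρ z * gaussConv t ν z) := i1.sub (i2.const_mul 2)
  rw [hfun]
  refine ⟨i4.add i3, ?_⟩
  rw [integral_add i4 i3, integral_sub i1 (i2.const_mul 2), integral_const_mul, e1, e2, e3]
  unfold gaussDist
  ring

lemma gaussDist_nonneg {t : ℝ} (ht : 0 < t) (ρ ν : Measure ℝ) [IsProbabilityMeasure ρ]
    [IsProbabilityMeasure ν] : 0 ≤ gaussDist t ρ ν := by
  have h := (integral_gaussConv_sub_sq ht ρ ν).2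
  have h1 : 0 ≤ ∫ z, (gaussConv t ρ z - gaussConv t ν z) ^ 2 :=
    integral_nonneg fun z => sq_nonneg _
  rw [h] at h1
  exact nonneg_of_mul_nonneg_right h1 (Real.sqrt_pos.2 (by positivity))

/-- The mutual energy for the regularised logarithmic kernel. -/
noncomputable def regEnergy (T : ℝ) (ρ ν : Measure ℝ) : ℝ :=
  ∫ p, regLog T (p.1 - p.2) ∂(ρ.prod ν)

/-- The regularised logarithmic energy of the difference of two measures. -/
noncomputable def regDist (T : ℝ) (ρ ν : Measure ℝ) : ℝ :=
  regEnergy T ρ ρ - 2 * regEnergy T ρ ν + regEnergy T ν ν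

lemma integrable_sub_sq {ρ ν : Measure ℝ} [IsProbabilityMeasure ρ] [IsProbabilityMeasure ν]
    (hρ : Integrable (fun x => x ^ 2) ρ) (hν : Integrable (fun x => x ^ 2) ν) :
    Integrable (fun p : ℝ × ℝ => (p.1 - p.2) ^ 2) (ρ.prod ν) := by
  have h1 : Integrable (fun p : ℝ × ℝ => p.1 ^ 2) (ρ.prod ν) := hρ.comp_fst ν
  have h2 : Integrable (fun p : ℝ × ℝ => p.2 ^ 2) (ρ.prod ν) := hν.comp_snd ρ
  refine Integrable.mono' ((h1.const_mul 2).add (h2.const_mul 2))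
    (by fun_prop : Measurable fun p : ℝ × ℝ => (p.1 - p.2) ^ 2).aestronglyMeasurable
    (ae_of_all _ fun p => ?_)
  rw [Real.norm_of_nonneg (sq_nonneg _)]
  simp only [Pi.add_apply]
  nlinarith [sq_nonneg (p.1 + p.2)]

lemma integrable_regLog_sub {ρ ν : Measure ℝ} [IsProbabilityMeasure ρ] [IsProbabilityMeasure ν]
    (hρ : Integrable (fun x => x ^ 2) ρ) (hν : Integrable (fun x => x ^ 2) ν) {T : ℝ}
    (hT : 0 ≤ T) : Integrable (fun p : ℝ × ℝ => regLog T (p.1 - p.2)) (ρ.prod ν) := by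
  have h := integrable_sub_sq hρ hν
  refine Integrable.mono' (((integrable_const (1 : ℝ)).add h).div_const 2 |>.const_mul T)
    ((measurable_regLog T).comp (by fun_prop)).aestronglyMeasurable
    (ae_of_all _ fun p => abs_regLog_le hT _)

/-- Second moments justify Fubini, since the integrand is at most `(1 + (x - y)²) / 2` uniformly in
`t`. -/
lemma regEnergy_eq {ρ ν : Measure ℝ} [IsProbabilityMeasure ρ] [IsProbabilityMeasure ν]
    (hρ : Integrable (fun x => x ^ 2) ρ) (hν : Integrable (fun x => x ^ 2) ν) (T : ℝ) :
    IntegrableOn (fun t => (gaussEnergy t ρ ν - Real.exp (-t)) / (2 * t)) (Set.Ioc 0 T) ∧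
      regEnergy T ρ ν =
        ∫ t in Set.Ioc 0 T, (gaussEnergy t ρ ν - Real.exp (-t)) / (2 * t) := by
  have hsq := integrable_sub_sq hρ hν
  set F : ℝ × ℝ → ℝ → ℝ := fun p t =>
    (Real.exp (-(t * (p.1 - p.2) ^ 2)) - Real.exp (-t)) / (2 * t) with hF
  have hmeas : Measurable (Function.uncurry F) := by
    simp only [hF, Function.uncurry_def]
    fun_prop
  have hint : Integrable (Function.uncurry F)
      ((ρ.prod ν).prod (volume.restrict (Set.Ioc 0 T))) := by
    have hdom : Integrable (fun q : (ℝ × ℝ) × ℝ => (1 + (q.1.1 - q.1.2) ^ 2) / 2)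
        ((ρ.prod ν).prod (volume.restrict (Set.Ioc 0 T))) :=
      (((integrable_const (1 : ℝ)).add hsq).div_const 2).comp_fst _
    refine Integrable.mono' hdom hmeas.aestronglyMeasurable ?_
    have : ∀ᵐ q ∂((ρ.prod ν).prod (volume.restrict (Set.Ioc 0 T))), q.2 ∈ Set.Ioc 0 T :=
      Measure.quasiMeasurePreserving_snd.ae (ae_restrict_mem measurableSet_Ioc)
    filter_upwards [this] with q hq
    exact abs_regLog_integrand_le hq.1 (sq_nonneg _)
  have hexp : ∀ t ∈ Set.Ioc 0 T,
      Integrable (fun p : ℝ × ℝ => Real.exp (-(t * (p.1 - p.2) ^ 2))) (ρ.prod ν) := by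
    intro t ht
    refine Integrable.mono' (g := fun _ => 1) (integrable_const _)
      (by fun_prop : Measurable fun p : ℝ × ℝ =>
        Real.exp (-(t * (p.1 - p.2) ^ 2))).aestronglyMeasurable (ae_of_all _ fun p => ?_)
    rw [Real.norm_of_nonneg (Real.exp_pos _).le]
    exact Real.exp_le_one_iff.2 (by nlinarith [ht.1, sq_nonneg (p.1 - p.2)])
  have hin : ∀ t ∈ Set.Ioc 0 T,
      ∫ p, F p t ∂(ρ.prod ν) = (gaussEnergy t ρ ν - Real.exp (-t)) / (2 * t) := by
    intro t ht
    simp only [hF]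
    rw [integral_div, integral_sub (hexp t ht) (integrable_const _), integral_const]
    simp [gaussEnergy]
  constructor
  · refine hint.integral_prod_right.congr ?_
    filter_upwards [ae_restrict_mem measurableSet_Ioc] with t ht using hin t ht
  · calc regEnergy T ρ ν = ∫ p, (∫ t in Set.Ioc 0 T, F p t) ∂(ρ.prod ν) := rfl
      _ = ∫ t in Set.Ioc 0 T, ∫ p, F p t ∂(ρ.prod ν) := integral_integral_swap hint
      _ = _ := setIntegral_congr_fun measurableSet_Ioc hin

/-- The terms `exp(-t)` cancel because both measures have mass one. -/
lemma regDist_eq {ρ ν : Measure ℝ} [IsProbabilityMeasure ρ] [IsProbabilityMeasure ν]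
    (hρ : Integrable (fun x => x ^ 2) ρ) (hν : Integrable (fun x => x ^ 2) ν) (T : ℝ) :
    IntegrableOn (fun t => gaussDist t ρ ν / (2 * t)) (Set.Ioc 0 T) ∧
      regDist T ρ ν = ∫ t in Set.Ioc 0 T, gaussDist t ρ ν / (2 * t) := by
  obtain ⟨i1, e1⟩ := regEnergy_eq hρ hρ T
  obtain ⟨i2, e2⟩ := regEnergy_eq hρ hν T
  obtain ⟨i3, e3⟩ := regEnergy_eq hν hν T
  have hfun : (fun t => gaussDist t ρ ν / (2 * t)) = fun t =>
      (gaussEnergy t ρ ρ - Real.exp (-t)) / (2 * t) -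
        2 * ((gaussEnergy t ρ ν - Real.exp (-t)) / (2 * t)) +
        (gaussEnergy t ν ν - Real.exp (-t)) / (2 * t) := by
    ext t; unfold gaussDist; ring
  have i4 : IntegrableOn (fun t => (gaussEnergy t ρ ρ - Real.exp (-t)) / (2 * t) -
        2 * ((gaussEnergy t ρ ν - Real.exp (-t)) / (2 * t))) (Set.Ioc 0 T) :=
    i1.sub (i2.const_mul 2)
  rw [hfun]
  refine ⟨i4.add i3, ?_⟩
  rw [integral_add i4 i3, integral_sub i1 (i2.const_mul 2), integral_const_mul, regDist, e1, e2, e3]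

lemma regDist_nonneg {ρ ν : Measure ℝ} [IsProbabilityMeasure ρ] [IsProbabilityMeasure ν]
    (hρ : Integrable (fun x => x ^ 2) ρ) (hν : Integrable (fun x => x ^ 2) ν) (T : ℝ) :
    0 ≤ regDist T ρ ν := by
  rw [(regDist_eq hρ hν T).2]
  exact setIntegral_nonneg measurableSet_Ioc fun t ht =>
    div_nonneg (gaussDist_nonneg ht.1 ρ ν) (by linarith [ht.1])

/-- The integrand is nonnegative, so a fixed window of parameters gives a lower bound valid for
every larger truncation `T`. -/
lemma le_regDist_of_le_gaussDist {ρ ν : Measure ℝ} [IsProbabilityMeasure ρ]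
    [IsProbabilityMeasure ν] (hρ : Integrable (fun x => x ^ 2) ρ)
    (hν : Integrable (fun x => x ^ 2) ν) {T T₀ c : ℝ} (hT₀ : 0 < T₀) (hT : T₀ + 1 ≤ T)
    (hc : 0 ≤ c) (h : ∀ t ∈ Set.Icc T₀ (T₀ + 1), c ≤ gaussDist t ρ ν) :
    c / (2 * (T₀ + 1)) ≤ regDist T ρ ν := by
  obtain ⟨i, e⟩ := regDist_eq hρ hν T
  rw [e]
  have hsub : Set.Ioc T₀ (T₀ + 1) ⊆ Set.Ioc 0 T := Set.Ioc_subset_Ioc hT₀.le hT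
  calc c / (2 * (T₀ + 1)) = ∫ t in Set.Ioc T₀ (T₀ + 1), c / (2 * (T₀ + 1)) := by simp
    _ ≤ ∫ t in Set.Ioc T₀ (T₀ + 1), gaussDist t ρ ν / (2 * t) := by
        refine setIntegral_mono_on (integrableOn_const (by simp)) (i.mono_set hsub)
          measurableSet_Ioc fun t ht => ?_
        have h1 := h t (Set.Ioc_subset_Icc_self ht)
        have h2 : 0 < t := hT₀.trans ht.1
        exact div_le_div₀ (hc.trans h1) h1 (by positivity) (by linarith [ht.2])
    _ ≤ _ := setIntegral_mono_set i (by
        filter_upwards [ae_restrict_mem measurableSet_Ioc] with t ht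
        exact div_nonneg (gaussDist_nonneg ht.1 ρ ν) (by linarith [ht.1])) hsub.eventuallyLE

/-! ### Separation of probability measures by the regularised energy -/

lemma abs_gaussian_average_sub_le {f : ℝ → ℝ} (hf : Continuous f) {M δ η : ℝ}
    (hM : ∀ x, |f x| ≤ M) (hδ : 0 < δ) (hη : 0 ≤ η)
    (hu : ∀ x z, |x - z| < δ → |f x - f z| ≤ η)
    {t : ℝ} (ht : 0 < t) (x : ℝ) :
    |√(2 * t / Real.pi) * (∫ z, f z * Real.exp (-(2 * t * (x - z) ^ 2))) - f x| ≤
      η + 4 * M / (δ ^ 2 * t) := by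
  have hM0 : 0 ≤ M := (abs_nonneg _).trans (hM 0)
  have hsymm : ∀ z, (x - z) ^ 2 = (z - x) ^ 2 := fun z => by ring
  simp_rw [hsymm]
  obtain ⟨i1, e1⟩ := integral_exp_neg_mul_sq_sub (show 0 < 2 * t by positivity) x
  obtain ⟨i2, e2⟩ := integral_exp_neg_mul_sq_sub ht x
  have i3 : Integrable fun z => f z * Real.exp (-(2 * t * (z - x) ^ 2)) :=
    i1.bdd_mul (c := M) hf.aestronglyMeasurable (ae_of_all _ hM)
  have hsq : √(2 * t / Real.pi) * √(Real.pi / (2 * t)) = 1 := by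
    rw [← Real.sqrt_mul (by positivity), div_mul_div_cancel₀ Real.pi_ne_zero, div_self (by positivity),
      Real.sqrt_one]
  have hfx : f x = √(2 * t / Real.pi) * ∫ z, f x * Real.exp (-(2 * t * (z - x) ^ 2)) := by
    rw [integral_const_mul, e1, mul_left_comm, hsq, mul_one]
  have hpt : ∀ z, |(f z - f x) * Real.exp (-(2 * t * (z - x) ^ 2))| ≤
      η * Real.exp (-(2 * t * (z - x) ^ 2)) +
        2 * M / (δ ^ 2 * t) * Real.exp (-(t * (z - x) ^ 2)) := by
    intro z
    rw [abs_mul, abs_of_pos (Real.exp_pos _)]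
    rcases lt_or_ge |z - x| δ with h | h
    · have h1 := hu z x h
      have h2 : 0 ≤ 2 * M / (δ ^ 2 * t) * Real.exp (-(t * (z - x) ^ 2)) := by positivity
      have h3 := mul_le_mul_of_nonneg_right h1 (Real.exp_pos (-(2 * t * (z - x) ^ 2))).le
      linarith
    · have h1 : |f z - f x| ≤ 2 * M := by
        have := abs_sub (f z) (f x)
        linarith [hM z, hM x]
      -- Half of the exponent keeps the bound integrable; the other half is at most `1 / (δ² t)`,
      -- since `|z - x| ≥ δ`.
      have h2 : Real.exp (-(2 * t * (z - x) ^ 2)) ≤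
          1 / (δ ^ 2 * t) * Real.exp (-(t * (z - x) ^ 2)) := by
        have e : Real.exp (-(2 * t * (z - x) ^ 2)) =
            Real.exp (-(t * (z - x) ^ 2)) * Real.exp (-(t * (z - x) ^ 2)) := by
          rw [← Real.exp_add]; ring_nf
        rw [e]
        refine mul_le_mul_of_nonneg_right ?_ (Real.exp_pos _).le
        rw [Real.exp_neg, ← one_div]
        apply one_div_le_one_div_of_le (by positivity)
        have h4 : δ ^ 2 ≤ (z - x) ^ 2 := by rw [← sq_abs (z - x)]; gcongr
        have h5 := Real.add_one_le_exp (t * (z - x) ^ 2)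
        nlinarith
      have h3 : 0 ≤ η * Real.exp (-(2 * t * (z - x) ^ 2)) := by positivity
      have h4 := mul_le_mul h1 h2 (Real.exp_pos _).le (by positivity)
      calc _ ≤ 2 * M * (1 / (δ ^ 2 * t) * Real.exp (-(t * (z - x) ^ 2))) := h4
        _ = 2 * M / (δ ^ 2 * t) * Real.exp (-(t * (z - x) ^ 2)) := by ring
        _ ≤ _ := by linarith
  rw [hfx, ← mul_sub, ← integral_sub i3 (i1.const_mul _), abs_mul, abs_of_nonneg (Real.sqrt_nonneg _)]
  simp_rw [← sub_mul]
  calc √(2 * t / Real.pi) * |∫ z, (f z - f x) * Real.exp (-(2 * t * (z - x) ^ 2))|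
      ≤ √(2 * t / Real.pi) * ∫ z, (η * Real.exp (-(2 * t * (z - x) ^ 2)) +
        2 * M / (δ ^ 2 * t) * Real.exp (-(t * (z - x) ^ 2))) := by
        gcongr
        refine (abs_integral_le_integral_abs).trans
          (integral_mono_of_nonneg (ae_of_all _ fun z => abs_nonneg _)
            ((i1.const_mul η).add (i2.const_mul _)) (ae_of_all _ hpt))
    _ = η * (√(2 * t / Real.pi) * √(Real.pi / (2 * t))) +
        2 * M / (δ ^ 2 * t) * (√(2 * t / Real.pi) * √(Real.pi / t)) := by
        rw [integral_add (i1.const_mul η) (i2.const_mul _), integral_const_mul,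
          integral_const_mul, e1, e2]
        ring
    _ ≤ η + 2 * M / (δ ^ 2 * t) * 2 := by
        rw [hsq, mul_one]
        gcongr
        rw [← Real.sqrt_mul (by positivity), Real.sqrt_le_left two_pos.le,
          show 2 * t / Real.pi * (Real.pi / t) = 2 by field_simp]
        norm_num
    _ = _ := by ring

lemma integral_mul_gaussConv {f : ℝ → ℝ} (hfi : Integrable f) {t : ℝ} (ht0 : 0 < t)
    (ρ : Measure ℝ) [IsProbabilityMeasure ρ] :
    Integrable (fun x => ∫ z, f z * Real.exp (-(2 * t * (x - z) ^ 2))) ρ ∧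
      Integrable (fun z => f z * gaussConv t ρ z) ∧
      ∫ x, (∫ z, f z * Real.exp (-(2 * t * (x - z) ^ 2))) ∂ρ = ∫ z, f z * gaussConv t ρ z := by
  have hint : Integrable (Function.uncurry fun x z => f z * Real.exp (-(2 * t * (x - z) ^ 2)))
      (ρ.prod volume) := by
    have h1 : Integrable (fun p : ℝ × ℝ => f p.2) (ρ.prod volume) := hfi.comp_snd ρ
    refine h1.mul_bdd (c := 1) ?_ (ae_of_all _ fun p => ?_)
    · exact (by fun_prop : Measurable fun p : ℝ × ℝ =>
        Real.exp (-(2 * t * (p.1 - p.2) ^ 2))).aestronglyMeasurable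
    · rw [Real.norm_of_nonneg (Real.exp_pos _).le]
      exact Real.exp_le_one_iff.2 (by nlinarith [sq_nonneg (p.1 - p.2)])
  have hz : ∀ z, ∫ x, f z * Real.exp (-(2 * t * (x - z) ^ 2)) ∂ρ = f z * gaussConv t ρ z :=
    fun z => integral_const_mul _ _
  refine ⟨hint.integral_prod_left, hint.integral_prod_right.congr (ae_of_all _ hz), ?_⟩
  rw [integral_integral_swap hint]
  simp_rw [hz]

/-- A quantitative form of the Cauchy-Schwarz inequality. -/
lemma sq_div_le_integral_sq {f g : ℝ → ℝ} {κ : ℝ} (hκ0 : 0 < κ)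
    (hf : Integrable fun z => f z ^ 2) (hg : Integrable fun z => g z ^ 2)
    (h4 : κ ≤ |∫ z, f z * g z|) : κ ^ 2 / ((∫ z, f z ^ 2) + 1) ≤ ∫ z, g z ^ 2 := by
  have hX0 : 0 ≤ ∫ z, f z ^ 2 := integral_nonneg fun z => sq_nonneg _
  obtain ⟨X, hX⟩ : ∃ X, X = ∫ z, f z ^ 2 := ⟨_, rfl⟩
  obtain ⟨Y, hY⟩ : ∃ Y, Y = ∫ z, g z ^ 2 := ⟨_, rfl⟩
  rw [← hX] at hX0 ⊢
  rw [← hY]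
  -- Weighted arithmetic-geometric mean inequality with weight `κ / (X + 1)`; the added `1` keeps
  -- the weight defined when `X = 0`.
  have h5 : |∫ z, f z * g z| ≤ κ / (X + 1) / 2 * X + (X + 1) / κ / 2 * Y := by
    have e0 : κ / (X + 1) / 2 * X + (X + 1) / κ / 2 * Y =
        ∫ z, (κ / (X + 1) / 2 * f z ^ 2 + (X + 1) / κ / 2 * g z ^ 2) := by
      rw [integral_add (hf.const_mul _) (hg.const_mul _), integral_const_mul,
        integral_const_mul, hX, hY]
    rw [e0]
    refine abs_integral_le_integral_abs.trans (integral_mono_of_nonneg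
      (ae_of_all _ fun z => abs_nonneg _) ((hf.const_mul _).add (hg.const_mul _))
      (ae_of_all _ fun z => ?_))
    simp only
    obtain ⟨l, hl⟩ : ∃ l, l = κ / (X + 1) := ⟨_, rfl⟩
    have hl0 : 0 < l := by rw [hl]; positivity
    have hl1 : (X + 1) / κ = 1 / l := by rw [hl]; field_simp
    rw [hl1, ← hl, abs_mul, ← sq_abs (f z), ← sq_abs (g z)]
    have : 0 ≤ (l * |f z| - |g z|) ^ 2 / (2 * l) := by positivity
    have e : (l * |f z| - |g z|) ^ 2 / (2 * l) =
        l / 2 * |f z| ^ 2 + 1 / l / 2 * |g z| ^ 2 - |f z| * |g z| := by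
      field_simp
      ring
    linarith
  have e1 : κ / (X + 1) / 2 * X ≤ κ / 2 := by
    rw [div_div, div_mul_eq_mul_div, div_le_div_iff₀ (by positivity) two_pos]
    nlinarith
  have e2 : κ / 2 ≤ (X + 1) / κ / 2 * Y := by linarith
  rw [div_le_iff₀ (by positivity)]
  have e3 : (X + 1) / κ / 2 * Y = (Y * (X + 1)) / (2 * κ) := by ring
  rw [e3, div_le_div_iff₀ two_pos (by positivity)] at e2
  nlinarith

lemma abs_integral_mul_gaussConv_sub_le {f : ℝ → ℝ} (hfi : Integrable f) {t η : ℝ} (ht0 : 0 < t)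
    (hsm : ∀ x, |√(2 * t / Real.pi) * (∫ z, f z * Real.exp (-(2 * t * (x - z) ^ 2))) - f x| ≤ η)
    (ρ : Measure ℝ) [IsProbabilityMeasure ρ] (hfρ : Integrable f ρ) :
    |√(2 * t / Real.pi) * (∫ z, f z * gaussConv t ρ z) - ∫ x, f x ∂ρ| ≤ η := by
  obtain ⟨j1, j2, j3⟩ := integral_mul_gaussConv hfi ht0 ρ
  rw [← j3, ← integral_const_mul, ← integral_sub (j1.const_mul _) hfρ]
  have := norm_integral_le_of_norm_le_const (μ := ρ) (f := fun x => √(2 * t / Real.pi) *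
    (∫ z, f z * Real.exp (-(2 * t * (x - z) ^ 2))) - f x) (ae_of_all _ hsm)
  rwa [probReal_univ, mul_one] at this

/-- Smoothing costs at most `ε / 4` for each measure, leaving `ε / 2` of the discrepancy. -/
lemma le_abs_integral_mul_sub {f : ℝ → ℝ} (hfi : Integrable f) {t ε : ℝ} (ht0 : 0 < t)
    (hsm : ∀ x, |√(2 * t / Real.pi) * (∫ z, f z * Real.exp (-(2 * t * (x - z) ^ 2))) - f x| ≤
      ε / 4)
    (ρ ν : Measure ℝ) [IsProbabilityMeasure ρ] [IsProbabilityMeasure ν] (hfρ : Integrable f ρ)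
    (hfν : Integrable f ν) (hdiff : ε ≤ |∫ x, f x ∂ρ - ∫ x, f x ∂ν|) :
    ε / 2 ≤ √(2 * t / Real.pi) * |∫ z, f z * (gaussConv t ρ z - gaussConv t ν z)| := by
  have h1 := abs_integral_mul_gaussConv_sub_le hfi ht0 hsm ρ hfρ
  have h2 := abs_integral_mul_gaussConv_sub_le hfi ht0 hsm ν hfν
  have e : ∫ z, f z * (gaussConv t ρ z - gaussConv t ν z) =
      (∫ z, f z * gaussConv t ρ z) - ∫ z, f z * gaussConv t ν z := by
    rw [← integral_sub (integral_mul_gaussConv hfi ht0 ρ).2.1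
      (integral_mul_gaussConv hfi ht0 ν).2.1]
    simp_rw [mul_sub]
  rw [e]
  generalize (∫ z, f z * gaussConv t ρ z) = A at *
  generalize (∫ z, f z * gaussConv t ν z) = B at *
  have hs := Real.sqrt_nonneg (2 * t / Real.pi)
  generalize √(2 * t / Real.pi) = S at *
  rw [abs_le] at h1 h2
  have h3 : |S * (A - B)| = S * |A - B| := by rw [abs_mul, abs_of_nonneg hs]
  rw [← h3]
  rcases le_abs.1 hdiff with h | h
  · linarith [le_abs_self (S * (A - B))]
  · linarith [neg_abs_le (S * (A - B))]

/-- If two probability measures disagree on a test function, their Gaussian energy distance is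
bounded below on a whole interval of parameters. -/
lemma exists_le_gaussDist {f : ℝ → ℝ} (hf : Continuous f) (hfc : HasCompactSupport f) {ε : ℝ}
    (hε : 0 < ε) : ∃ T₀ c : ℝ, 0 < T₀ ∧ 0 < c ∧ ∀ ρ ν : Measure ℝ, IsProbabilityMeasure ρ →
      IsProbabilityMeasure ν → ε ≤ |∫ x, f x ∂ρ - ∫ x, f x ∂ν| →
      ∀ t ∈ Set.Icc T₀ (T₀ + 1), c ≤ gaussDist t ρ ν := by
  obtain ⟨M, hM⟩ := hf.bounded_above_of_compact_support hfc
  have hM0 : 0 ≤ M := (norm_nonneg _).trans (hM 0)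
  have huc : UniformContinuous f := hfc.uniformContinuous_of_continuous hf
  have hε8 : 0 < ε / 8 := by linarith
  obtain ⟨δ, hδ, hu⟩ := Metric.uniformContinuous_iff.1 huc (ε / 8) hε8
  have hfi : Integrable f := hf.integrable_of_hasCompactSupport hfc
  have hfi2 : Integrable fun z => f z ^ 2 := by
    simp_rw [sq]
    exact hfi.bdd_mul (c := M) hf.aestronglyMeasurable (ae_of_all _ hM)
  have hX0 : 0 ≤ ∫ z, f z ^ 2 := integral_nonneg fun z => sq_nonneg _
  -- For `t ≥ T₀` the tail `4M / (δ² t)` is at most `ε / 8`; the modulus of continuity accounts for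
  -- another `ε / 8`.
  obtain ⟨T₀, hT₀⟩ : ∃ T₀, T₀ = 1 + 32 * M / (δ ^ 2 * ε) := ⟨_, rfl⟩
  have hT₀0 : 0 < T₀ := by rw [hT₀]; positivity
  -- The normalising factor is replaced by its largest value on the window, at `t = T₀ + 1`.
  obtain ⟨κ, hκ⟩ : ∃ κ, κ = ε / 2 / √(2 * (T₀ + 1) / Real.pi) := ⟨_, rfl⟩
  have hκ0 : 0 < κ := by
    have : 0 < √(2 * (T₀ + 1) / Real.pi) := Real.sqrt_pos.2 (by positivity)
    rw [hκ]; positivity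
  have hS0 : 0 < √(Real.pi / (4 * T₀)) := Real.sqrt_pos.2 (by positivity)
  refine ⟨T₀, κ ^ 2 / ((∫ z, f z ^ 2) + 1) / √(Real.pi / (4 * T₀)), hT₀0, by positivity, ?_⟩
  intro ρ ν hρ hν hdiff t ht
  have ht0 : 0 < t := hT₀0.trans_le ht.1
  have hsm : ∀ x, |√(2 * t / Real.pi) * (∫ z, f z * Real.exp (-(2 * t * (x - z) ^ 2))) - f x| ≤
      ε / 4 := by
    intro x
    refine (abs_gaussian_average_sub_le hf hM hδ (by positivity : 0 ≤ ε / 8)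
      (fun x z h => (hu h).le) ht0 x).trans ?_
    have : 4 * M / (δ ^ 2 * t) ≤ ε / 8 := by
      rw [div_le_iff₀ (by positivity)]
      have h1 : 32 * M / (δ ^ 2 * ε) ≤ t := by linarith [ht.1]
      rw [div_le_iff₀ (by positivity)] at h1
      nlinarith
    linarith
  have hfm : ∀ ρ : Measure ℝ, IsProbabilityMeasure ρ → Integrable f ρ := fun ρ _ =>
    Integrable.mono' (integrable_const M) hf.aestronglyMeasurable (ae_of_all _ hM)
  have h3 := le_abs_integral_mul_sub hfi ht0 hsm ρ ν (hfm ρ hρ) (hfm ν hν) hdiff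
  obtain ⟨k1, k2⟩ := integral_gaussConv_sub_sq ht0 ρ ν
  have h4 : κ ≤ |∫ z, f z * (gaussConv t ρ z - gaussConv t ν z)| := by
    rw [hκ, div_le_iff₀ (Real.sqrt_pos.2 (by positivity)), mul_comm]
    refine h3.trans (mul_le_mul_of_nonneg_right (Real.sqrt_le_sqrt ?_) (abs_nonneg _))
    have := ht.2
    gcongr
  have h6 := sq_div_le_integral_sq hκ0 hfi2 k1 h4
  rw [k2] at h6
  rw [div_le_iff₀ hS0]
  have h7 : √(Real.pi / (4 * t)) ≤ √(Real.pi / (4 * T₀)) := by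
    apply Real.sqrt_le_sqrt
    have := ht.1
    gcongr
  have := mul_le_mul_of_nonneg_right h7 (gaussDist_nonneg ht0 ρ ν)
  linarith

lemma exists_le_regDist {f : ℝ → ℝ} (hf : Continuous f) (hfc : HasCompactSupport f) {ε : ℝ}
    (hε : 0 < ε) : ∃ T₁ c : ℝ, 0 < c ∧ ∀ ρ ν : Measure ℝ, IsProbabilityMeasure ρ →
      IsProbabilityMeasure ν → Integrable (fun x => x ^ 2) ρ → Integrable (fun x => x ^ 2) ν →
      ε ≤ |∫ x, f x ∂ρ - ∫ x, f x ∂ν| → ∀ T, T₁ ≤ T → c ≤ regDist T ρ ν := by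
  obtain ⟨T₀, c, hT₀, hc, h⟩ := exists_le_gaussDist hf hfc hε
  refine ⟨T₀ + 1, c / (2 * (T₀ + 1)), by positivity, ?_⟩
  intro ρ ν hρ hν hρ2 hν2 hd T hT
  exact le_regDist_of_le_gaussDist hρ2 hν2 hT₀ hT hc.le (h ρ ν hρ hν hd)

/-! ### Measures with bounded logarithmic potential -/

/-- A quantitative regularity condition ensuring that the logarithmic potential is finite. -/
structure IsLogRegular (ν : Measure ℝ) (M : ℝ) : Prop where
  integrable_sq : Integrable (fun x => x ^ 2) ν
  singleton : ∀ x, ν {x} = 0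
  integrable_rpow : ∀ x, Integrable (fun y : ℝ => |x - y| ^ (-(1 / 4) : ℝ)) ν
  integral_rpow_le : ∀ x, ∫ y, |x - y| ^ (-(1 / 4) : ℝ) ∂ν ≤ M

lemma integrable_abs_of_sq {ρ : Measure ℝ} [IsProbabilityMeasure ρ]
    (hρ : Integrable (fun x => x ^ 2) ρ) : Integrable (fun x => |x|) ρ := by
  refine Integrable.mono' ((integrable_const (1 : ℝ)).add hρ)
    (by fun_prop : Measurable fun x : ℝ => |x|).aestronglyMeasurable (ae_of_all _ fun x => ?_)
  simp only [Pi.add_apply, Real.norm_eq_abs, abs_abs]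
  nlinarith [sq_nonneg (|x| - 1), sq_abs x, abs_nonneg x]

lemma measurable_logPotential (ν : Measure ℝ) [IsProbabilityMeasure ν] :
    Measurable (logPotential ν) :=
  ((by fun_prop : Measurable fun p : ℝ × ℝ => Real.log (p.1 - p.2)).stronglyMeasurable
    |>.integral_prod_right' (ν := ν)).measurable

namespace IsLogRegular

variable {ν : Measure ℝ} {M : ℝ}

lemma integrable_dominating [IsProbabilityMeasure ν] (h : IsLogRegular ν M) (x : ℝ) :
    Integrable (fun y => 4 * |x - y| ^ (-(1 / 4) : ℝ) + (|x| + |y|)) ν :=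
  ((h.integrable_rpow x).const_mul 4).add
    ((integrable_const _).add (integrable_abs_of_sq h.integrable_sq))

lemma abs_log_sub_le (x y : ℝ) :
    |Real.log (x - y)| ≤ 4 * |x - y| ^ (-(1 / 4) : ℝ) + (|x| + |y|) :=
  (abs_log_le_rpow_add _).trans (by gcongr; exact abs_sub _ _)

lemma integrable_log [IsProbabilityMeasure ν] (h : IsLogRegular ν M) (x : ℝ) :
    Integrable (fun y => Real.log (x - y)) ν :=
  Integrable.mono' (h.integrable_dominating x)
    (by fun_prop : Measurable fun y => Real.log (x - y)).aestronglyMeasurable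
    (ae_of_all _ fun y => abs_log_sub_le x y)

lemma integral_abs_log_le [IsProbabilityMeasure ν] (h : IsLogRegular ν M) (x : ℝ) :
    ∫ y, |Real.log (x - y)| ∂ν ≤ 4 * M + |x| + ∫ y, |y| ∂ν := by
  have h1 := integrable_abs_of_sq h.integrable_sq
  calc ∫ y, |Real.log (x - y)| ∂ν ≤ ∫ y, (4 * |x - y| ^ (-(1 / 4) : ℝ) + (|x| + |y|)) ∂ν :=
        integral_mono (h.integrable_log x).abs (h.integrable_dominating x)
          fun y => abs_log_sub_le x y
    _ = 4 * ∫ y, |x - y| ^ (-(1 / 4) : ℝ) ∂ν + (|x| + ∫ y, |y| ∂ν) := by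
        have h2 : Integrable (fun y => |x| + |y|) ν := (integrable_const _).add h1
        rw [integral_add ((h.integrable_rpow x).const_mul 4) h2,
          integral_const_mul, integral_add (integrable_const _) h1, integral_const, probReal_univ,
          one_smul]
    _ ≤ _ := by linarith [h.integral_rpow_le x]

lemma abs_logPotential_le [IsProbabilityMeasure ν] (h : IsLogRegular ν M) (x : ℝ) :
    |logPotential ν x| ≤ 4 * M + |x| + ∫ y, |y| ∂ν :=
  abs_integral_le_integral_abs.trans (h.integral_abs_log_le x)

lemma integrable_logPotential [IsProbabilityMeasure ν] (h : IsLogRegular ν M) {ρ : Measure ℝ} [IsProbabilityMeasure ρ]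
    (hρ : Integrable (fun x => x ^ 2) ρ) : Integrable (logPotential ν) ρ :=
  Integrable.mono' (((integrable_const (4 * M)).add (integrable_abs_of_sq hρ)).add
    (integrable_const (∫ y, |y| ∂ν))) (measurable_logPotential ν).aestronglyMeasurable
    (ae_of_all _ fun x => h.abs_logPotential_le x)

lemma integrable_log_prod [IsProbabilityMeasure ν] (h : IsLogRegular ν M) {ρ : Measure ℝ} [IsProbabilityMeasure ρ]
    (hρ : Integrable (fun x => x ^ 2) ρ) :
    Integrable (fun p : ℝ × ℝ => Real.log (p.1 - p.2)) (ρ.prod ν) := by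
  have hm : Measurable fun p : ℝ × ℝ => Real.log (p.1 - p.2) := by fun_prop
  rw [integrable_prod_iff hm.aestronglyMeasurable]
  refine ⟨ae_of_all _ fun x => h.integrable_log x, ?_⟩
  refine Integrable.mono' (((integrable_const (4 * M)).add (integrable_abs_of_sq hρ)).add
    (integrable_const (∫ y, |y| ∂ν))) hm.norm.aestronglyMeasurable.integral_prod_right'
    (ae_of_all _ fun x => ?_)
  rw [Real.norm_of_nonneg (integral_nonneg fun _ => norm_nonneg _)]
  exact h.integral_abs_log_le x

lemma integral_log_prod [IsProbabilityMeasure ν] (h : IsLogRegular ν M) {ρ : Measure ℝ} [IsProbabilityMeasure ρ]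
    (hρ : Integrable (fun x => x ^ 2) ρ) :
    ∫ p, Real.log (p.1 - p.2) ∂(ρ.prod ν) = ∫ x, logPotential ν x ∂ρ :=
  integral_prod _ (h.integrable_log_prod hρ)

lemma integral_rpow_prod [IsProbabilityMeasure ν] (h : IsLogRegular ν M) {ρ : Measure ℝ} [IsProbabilityMeasure ρ] :
    Integrable (fun p : ℝ × ℝ => |p.1 - p.2| ^ (-(1 / 4) : ℝ)) (ρ.prod ν) ∧
      ∫ p, |p.1 - p.2| ^ (-(1 / 4) : ℝ) ∂(ρ.prod ν) ≤ M := by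
  have hm : Measurable fun p : ℝ × ℝ => |p.1 - p.2| ^ (-(1 / 4) : ℝ) := by fun_prop
  have hi : Integrable (fun p : ℝ × ℝ => |p.1 - p.2| ^ (-(1 / 4) : ℝ)) (ρ.prod ν) := by
    rw [integrable_prod_iff hm.aestronglyMeasurable]
    refine ⟨ae_of_all _ fun x => h.integrable_rpow x, ?_⟩
    refine Integrable.mono' (integrable_const M)
      hm.norm.aestronglyMeasurable.integral_prod_right' (ae_of_all _ fun x => ?_)
    rw [Real.norm_of_nonneg (integral_nonneg fun _ => norm_nonneg _)]
    refine le_trans (le_of_eq ?_) (h.integral_rpow_le x)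
    refine integral_congr_ae (ae_of_all _ fun y => ?_)
    exact Real.norm_of_nonneg (by positivity)
  refine ⟨hi, ?_⟩
  rw [integral_prod _ hi]
  have := integral_mono hi.integral_prod_left (integrable_const M) fun x => h.integral_rpow_le x
  simpa using this

/-- The mutual regularised energy is almost the mutual logarithmic energy. -/
lemma neg_integral_logPotential_le [IsProbabilityMeasure ν] (h : IsLogRegular ν M) {ρ : Measure ℝ}
    [IsProbabilityMeasure ρ] (hρ : Integrable (fun x => x ^ 2) ρ) {T : ℝ} (hT : 0 < T) :
    -(∫ x, logPotential ν x ∂ρ) - 4 * T ^ (-(1 / 8) : ℝ) * M ≤ regEnergy T ρ ν := by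
  have h1 := h.integrable_log_prod hρ
  obtain ⟨h2, h3⟩ := h.integral_rpow_prod (ρ := ρ)
  have hTp : 0 < T ^ (-(1 / 8) : ℝ) := Real.rpow_pos_of_pos hT _
  calc -(∫ x, logPotential ν x ∂ρ) - 4 * T ^ (-(1 / 8) : ℝ) * M
      ≤ -(∫ x, logPotential ν x ∂ρ) - 4 * T ^ (-(1 / 8) : ℝ) *
        ∫ p, |p.1 - p.2| ^ (-(1 / 4) : ℝ) ∂(ρ.prod ν) := by gcongr
    _ = ∫ p, (-Real.log (p.1 - p.2) - 4 * T ^ (-(1 / 8) : ℝ) *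
        |p.1 - p.2| ^ (-(1 / 4) : ℝ)) ∂(ρ.prod ν) := by
        have h1' : Integrable (fun p : ℝ × ℝ => -Real.log (p.1 - p.2)) (ρ.prod ν) := h1.neg
        rw [integral_sub h1' (h2.const_mul _), integral_const_mul, integral_neg,
          h.integral_log_prod hρ]
    _ ≤ _ := integral_mono (h1.neg.sub (h2.const_mul _))
        (integrable_regLog_sub hρ h.integrable_sq hT.le) fun p => neg_log_le_regLog hT _

lemma ae_prod_ne [IsProbabilityMeasure ν] (h : IsLogRegular ν M) : ∀ᵐ p ∂(ν.prod ν), p.1 - p.2 ≠ 0 := by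
  have hm : MeasurableSet {p : ℝ × ℝ | p.1 - p.2 = 0} :=
    measurableSet_eq_fun (by fun_prop) measurable_const
  have : (ν.prod ν) {p : ℝ × ℝ | p.1 - p.2 = 0} = 0 := by
    rw [Measure.measure_prod_null hm]
    refine ae_of_all _ fun x => ?_
    refine measure_mono_null (t := {x}) (fun y hy => ?_) (h.singleton x)
    simp only [Set.mem_preimage, Set.mem_ofPred_eq] at hy
    simp only [Set.mem_singleton_iff]
    linarith
  exact measure_eq_zero_iff_ae_notMem.1 this

lemma regEnergy_self_le [IsProbabilityMeasure ν] (h : IsLogRegular ν M) {T : ℝ} (hT : 0 < T) :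
    regEnergy T ν ν ≤ -(∫ x, logPotential ν x ∂ν) + 1 / T := by
  have h1 := h.integrable_log_prod h.integrable_sq
  calc regEnergy T ν ν ≤ ∫ p, (-Real.log (p.1 - p.2) + 1 / T) ∂(ν.prod ν) := by
        refine integral_mono_ae (integrable_regLog_sub h.integrable_sq h.integrable_sq hT.le)
          (h1.neg.add (integrable_const _)) ?_
        filter_upwards [h.ae_prod_ne] with p hp using regLog_le_neg_log hT hp
    _ = _ := by
        have h1' : Integrable (fun p : ℝ × ℝ => -Real.log (p.1 - p.2)) (ν.prod ν) := h1.neg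
        rw [integral_add h1' (integrable_const _), integral_neg,
          h.integral_log_prod h.integrable_sq]
        simp

/-- The error made by truncating the logarithmic kernel at level `T`. -/
noncomputable def truncError (M T : ℝ) : ℝ := 8 * T ^ (-(1 / 8) : ℝ) * M + 1 / T

lemma tendsto_truncError (M : ℝ) : Tendsto (truncError M) atTop (𝓝 0) := by
  have h1 : Tendsto (fun T : ℝ => T ^ (-(1 / 8) : ℝ)) atTop (𝓝 0) :=
    tendsto_rpow_neg_atTop (by norm_num)
  have h2 : Tendsto (fun T : ℝ => 1 / T) atTop (𝓝 0) := by
    simpa using tendsto_inv_atTop_zero (𝕜 := ℝ)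
  have := ((h1.const_mul 8).mul_const M).add h2
  rw [mul_zero, zero_mul, add_zero] at this
  exact this

/-- Lower bound of the regularised energy by linearisation at `ν`. -/
theorem regEnergy_ge [IsProbabilityMeasure ν] (h : IsLogRegular ν M) {ρ : Measure ℝ} [IsProbabilityMeasure ρ]
    (hρ : Integrable (fun x => x ^ 2) ρ) {T : ℝ} (hT : 0 < T) :
    regDist T ρ ν - 2 * (∫ x, logPotential ν x ∂ρ) + ∫ x, logPotential ν x ∂ν - truncError M T ≤
      regEnergy T ρ ρ := by
  -- By definition of `regDist`, the energy of `ρ` is `regDist` plus twice the mutual energy minus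
  -- that of `ν`. So the mutual term needs a lower bound and the self term an upper bound.
  have h1 := h.neg_integral_logPotential_le hρ hT
  have h2 := h.regEnergy_self_le hT
  unfold regDist truncError
  linarith

end IsLogRegular

/-! ### Energies with values in the extended reals -/

section ERealIntegral

variable {X : Type*} [MeasurableSpace X] {μ : Measure X} {k : X → EReal} {g : X → ℝ}

lemma EReal.toENNReal_coe_real (x : ℝ) : (x : EReal).toENNReal = ENNReal.ofReal x := by
  rw [EReal.toENNReal_of_ne_top (EReal.coe_ne_top x), EReal.toReal_coe]

lemma coe_integral_eq_sub (hg : Integrable g μ) :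
    ((∫ z, g z ∂μ : ℝ) : EReal) = ((∫⁻ z, ENNReal.ofReal (g z) ∂μ : ENNReal) : EReal) -
      ((∫⁻ z, ENNReal.ofReal (-g z) ∂μ : ENNReal) : EReal) := by
  have hneg : ∫⁻ z, ENNReal.ofReal (-g z) ∂μ ≠ ⊤ := hg.neg.lintegral_lt_top.ne
  rw [integral_eq_lintegral_pos_part_sub_lintegral_neg_part hg, EReal.coe_sub,
    EReal.coe_ennreal_toReal hg.lintegral_lt_top.ne, EReal.coe_ennreal_toReal hneg]

/-- Monotonicity of lower integrals needs no measurability or integrability of `k`, so kernels with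
infinite values are compared directly with real integrands. -/
lemma coe_integral_le_of_le (hg : Integrable g μ) (h : ∀ᵐ z ∂μ, (g z : EReal) ≤ k z) :
    ((∫ z, g z ∂μ : ℝ) : EReal) ≤ ((∫⁻ z, (k z).toENNReal ∂μ : ENNReal) : EReal) -
      ((∫⁻ z, (-k z).toENNReal ∂μ : ENNReal) : EReal) := by
  rw [coe_integral_eq_sub hg]
  refine EReal.sub_le_sub (EReal.coe_ennreal_le_coe_ennreal_iff.2 (lintegral_mono_ae ?_))
    (EReal.coe_ennreal_le_coe_ennreal_iff.2 (lintegral_mono_ae ?_))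
  · filter_upwards [h] with z hz
    rw [← EReal.toENNReal_coe_real]
    exact EReal.toENNReal_le_toENNReal hz
  · filter_upwards [h] with z hz
    rw [← EReal.toENNReal_coe_real, EReal.coe_neg]
    exact EReal.toENNReal_le_toENNReal (EReal.neg_le_neg_iff.2 hz)

lemma le_coe_integral_of_le (hg : Integrable g μ) (h : ∀ᵐ z ∂μ, k z ≤ (g z : EReal)) :
    ((∫⁻ z, (k z).toENNReal ∂μ : ENNReal) : EReal) -
      ((∫⁻ z, (-k z).toENNReal ∂μ : ENNReal) : EReal) ≤ ((∫ z, g z ∂μ : ℝ) : EReal) := by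
  rw [coe_integral_eq_sub hg]
  refine EReal.sub_le_sub (EReal.coe_ennreal_le_coe_ennreal_iff.2 (lintegral_mono_ae ?_))
    (EReal.coe_ennreal_le_coe_ennreal_iff.2 (lintegral_mono_ae ?_))
  · filter_upwards [h] with z hz
    rw [← EReal.toENNReal_coe_real]
    exact EReal.toENNReal_le_toENNReal hz
  · filter_upwards [h] with z hz
    rw [← EReal.toENNReal_coe_real, EReal.coe_neg]
    exact EReal.toENNReal_le_toENNReal (EReal.neg_le_neg_iff.2 hz)

end ERealIntegral

/-! ### Finite and infinite values of the field and of the energy kernel -/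

lemma externalField_eq_coe {α x : ℝ} (hα : 0 ≤ α) (hx : 0 < α → 0 < x) :
    externalField α x = (realField α x : EReal) := by
  unfold externalField realField
  rcases hα.eq_or_lt with rfl | hα
  · simp
  · rw [ENNReal.log_ofReal_of_pos (hx hα), ← EReal.coe_neg, ← EReal.coe_mul, ← EReal.coe_add]
    congr 1
    ring

lemma externalField_eq_top {α x : ℝ} (hα : 0 < α) (hx : x ≤ 0) : externalField α x = ⊤ := by
  unfold externalField
  rw [ENNReal.ofReal_of_nonpos hx, ENNReal.log_zero, EReal.neg_bot,
    EReal.coe_mul_top_of_pos (by positivity), EReal.add_top_of_ne_bot (EReal.coe_ne_bot _)]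

lemma externalField_ne_bot {α : ℝ} (hα : 0 ≤ α) (x : ℝ) : externalField α x ≠ ⊥ := by
  by_cases h : 0 < α → 0 < x
  · rw [externalField_eq_coe hα h]; exact EReal.coe_ne_bot _
  · push Not at h
    rw [externalField_eq_top h.1 h.2]; simp

lemma half_mul_ne_bot {z : EReal} (hz : z ≠ ⊥) : ((1 / 2 : ℝ) : EReal) * z ≠ ⊥ := by
  induction z with
  | bot => exact absurd rfl hz
  | top => rw [EReal.coe_mul_top_of_pos (by norm_num)]; simp
  | coe x => rw [← EReal.coe_mul]; exact EReal.coe_ne_bot _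

lemma energyKernel_eq_coe {α x y : ℝ} (hα : 0 ≤ α) (hx : 0 < α → 0 < x) (hy : 0 < α → 0 < y)
    (hxy : x - y ≠ 0) : energyKernel (externalField α) x y =
      ((-Real.log (x - y) + 1 / 2 * (realField α x + realField α y) : ℝ) : EReal) := by
  unfold energyKernel
  rw [externalField_eq_coe hα hx, externalField_eq_coe hα hy,
    ENNReal.log_ofReal_of_pos (abs_pos.2 hxy), Real.log_abs]
  push_cast
  rfl

lemma energyKernel_diag {α x : ℝ} (hα : 0 ≤ α) : energyKernel (externalField α) x x = ⊤ := by
  unfold energyKernel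
  rw [sub_self, abs_zero, ENNReal.ofReal_zero, ENNReal.log_zero, EReal.neg_bot]
  refine EReal.top_add_of_ne_bot (half_mul_ne_bot ?_)
  rw [Ne, EReal.add_eq_bot_iff, not_or]
  exact ⟨externalField_ne_bot hα x, externalField_ne_bot hα x⟩

lemma energyKernel_eq_top {α x y : ℝ} (hα : 0 < α) (hx : x ≤ 0) :
    energyKernel (externalField α) x y = ⊤ := by
  unfold energyKernel
  rw [externalField_eq_top hα hx, EReal.top_add_of_ne_bot (externalField_ne_bot hα.le y),
    EReal.coe_mul_top_of_pos (by norm_num)]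
  refine EReal.add_top_of_ne_bot ?_
  rw [Ne, EReal.neg_eq_bot_iff, ENNReal.log_eq_top_iff]
  exact ENNReal.ofReal_ne_top

lemma coe_le_energyKernel {α x y r : ℝ} (hα : 0 ≤ α) (hx : 0 < α → 0 < x) (hy : 0 < α → 0 < y)
    (h : x - y ≠ 0 → r ≤ -Real.log (x - y) + 1 / 2 * (realField α x + realField α y)) :
    (r : EReal) ≤ energyKernel (externalField α) x y := by
  by_cases hxy : x - y = 0
  · obtain rfl : x = y := sub_eq_zero.1 hxy
    rw [energyKernel_diag hα]
    exact le_top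
  · rw [energyKernel_eq_coe hα hx hy hxy]
    exact EReal.coe_le_coe_iff.2 (h hxy)

lemma measurable_realField (α : ℝ) : Measurable (realField α) := by
  unfold realField; fun_prop

/-- The field dominates the logarithm at infinity. -/
lemma half_sq_sub_le_realField {α : ℝ} (hα : 0 ≤ α) (x : ℝ) :
    x ^ 2 / 2 - 2 * (α + 1) ^ 2 ≤ realField α x - 2 * Real.log (1 + |x|) := by
  have h1 : Real.log (1 + |x|) ≤ |x| := by
    have := Real.log_le_sub_one_of_pos (by positivity : 0 < 1 + |x|)
    linarith
  have h2 : α * Real.log x ≤ α * |x| := by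
    rw [← Real.log_abs]
    exact mul_le_mul_of_nonneg_left (Real.log_le_self (abs_nonneg x)) hα
  unfold realField
  nlinarith [sq_nonneg (|x| - 2 * (α + 1)), sq_abs x]

lemma log_sub_le (x y : ℝ) : Real.log (x - y) ≤ Real.log (1 + |x|) + Real.log (1 + |y|) := by
  rw [← Real.log_mul (by positivity) (by positivity), ← Real.log_abs]
  rcases eq_or_ne (x - y) 0 with h | h
  · rw [h, abs_zero, Real.log_zero]
    apply Real.log_nonneg
    nlinarith [abs_nonneg x, abs_nonneg y, mul_nonneg (abs_nonneg x) (abs_nonneg y)]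
  · apply Real.log_le_log (abs_pos.2 h)
    have := abs_sub x y
    nlinarith [abs_nonneg x, abs_nonneg y, mul_nonneg (abs_nonneg x) (abs_nonneg y)]

/-- Data certifying that `ν` satisfies the Euler-Lagrange conditions with constant `ℓ` for the
field `Q_α` on `[σ, ∞)`. -/
structure IsExtremal (α σ : ℝ) (ν : Measure ℝ) (ℓ M : ℝ) : Prop where
  nonneg : 0 ≤ α
  domain : 0 ≤ σ ∨ α = 0
  regular : IsLogRegular ν M
  mem : ∀ᵐ x ∂ν, σ ≤ x ∧ (0 < α → 0 < x)
  le : ∀ x, σ ≤ x → (0 < α → 0 < x) → ℓ ≤ realField α x - 2 * logPotential ν x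
  eq : ∀ᵐ x ∂ν, realField α x - 2 * logPotential ν x = ℓ

lemma ae_prod_and {X Y : Type*} [MeasurableSpace X] [MeasurableSpace Y] {μ : Measure X}
    {ν : Measure Y} [SFinite μ] [SFinite ν] {p : X → Prop} {q : Y → Prop} (hp : ∀ᵐ x ∂μ, p x)
    (hq : ∀ᵐ y ∂ν, q y) : ∀ᵐ z ∂(μ.prod ν), p z.1 ∧ q z.2 :=
  (Measure.quasiMeasurePreserving_fst.ae hp).and (Measure.quasiMeasurePreserving_snd.ae hq)

/-! ### An extremal measure is the unique minimiser -/

namespace IsExtremal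

variable {α σ ℓ M : ℝ} {ν : Measure ℝ}

/-- The minimal energy. -/
noncomputable def minEnergy (ν : Measure ℝ) (ℓ : ℝ) : ℝ := ℓ + ∫ x, logPotential ν x ∂ν

lemma integrable_realField [IsProbabilityMeasure ν] (h : IsExtremal α σ ν ℓ M) :
    Integrable (realField α) ν ∧
      ∫ x, realField α x ∂ν = ℓ + 2 * ∫ x, logPotential ν x ∂ν := by
  have hU := h.regular.integrable_logPotential h.regular.integrable_sq
  have e : realField α =ᵐ[ν] fun x => ℓ + 2 * logPotential ν x := by
    filter_upwards [h.eq] with x hx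
    linarith
  refine ⟨((integrable_const ℓ).add (hU.const_mul 2)).congr e.symm, ?_⟩
  rw [integral_congr_ae e, integral_add (integrable_const ℓ) (hU.const_mul 2), integral_const_mul]
  simp

/-- The Euler-Lagrange equality gives `∫ Q dν = ℓ + 2 ∫ U dν`, so the energy `-∫ U dν + ∫ Q dν` is
`ℓ + ∫ U dν`; the diagonal, where the kernel is infinite, is a null set. -/
lemma logEnergy_le [IsProbabilityMeasure ν] (h : IsExtremal α σ ν ℓ M) :
    logEnergy (externalField α) ν ≤ (minEnergy ν ℓ : EReal) := by
  obtain ⟨hQ, hQv⟩ := h.integrable_realField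
  have h1 := h.regular.integrable_log_prod h.regular.integrable_sq
  have h1' : Integrable (fun p : ℝ × ℝ => -Real.log (p.1 - p.2)) (ν.prod ν) := h1.neg
  have hQ1 : Integrable (fun p : ℝ × ℝ => realField α p.1) (ν.prod ν) := hQ.comp_fst ν
  have hQ2 : Integrable (fun p : ℝ × ℝ => realField α p.2) (ν.prod ν) := hQ.comp_snd ν
  have hQQ : Integrable (fun p : ℝ × ℝ => 1 / 2 * (realField α p.1 + realField α p.2))
    (ν.prod ν) := (hQ1.add hQ2).const_mul _
  have hval : ∫ p, (-Real.log (p.1 - p.2) + 1 / 2 * (realField α p.1 + realField α p.2))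
      ∂(ν.prod ν) = minEnergy ν ℓ := by
    rw [integral_add h1' hQQ, integral_neg, h.regular.integral_log_prod h.regular.integrable_sq,
      integral_const_mul, integral_add hQ1 hQ2, integral_fun_fst, integral_fun_snd, hQv]
    simp [minEnergy]
    ring
  rw [← hval]
  refine le_coe_integral_of_le (h1'.add hQQ) ?_
  filter_upwards [h.regular.ae_prod_ne, ae_prod_and h.mem h.mem] with p hp hd
  exact (energyKernel_eq_coe h.nonneg hd.1.2 hd.2.2 hp).le

/-- The kernel is bounded below, so finite energy means that its positive part is integrable. This
forces `ρ` off the region where the field is infinite and, by quadratic growth, gives second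
moments. -/
lemma finite_energy {ρ : Measure ℝ} [IsProbabilityMeasure ρ] (hα : 0 ≤ α)
    (hρ : ρ (Set.Ici σ)ᶜ = 0)
    (hfin : logEnergy (externalField α) ρ < ⊤) :
    (∀ᵐ x ∂ρ, σ ≤ x ∧ (0 < α → 0 < x)) ∧ Integrable (fun x => x ^ 2) ρ ∧
      Integrable (realField α) ρ := by
  set C := 2 * (α + 1) ^ 2 with hC
  set k := fun z : ℝ × ℝ => energyKernel (externalField α) z.1 z.2 with hk
  -- Half of the field in each variable absorbs `log|x - y| ≤ log(1 + |x|) + log(1 + |y|)`; the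
  -- shift `C` makes `H x ≥ x² / 2`.
  set H : ℝ → ℝ := fun x => realField α x - 2 * Real.log (1 + |x|) + C with hH
  have hHm : Measurable H := by
    have := measurable_realField α
    simp only [hH]; fun_prop
  have hσ : ∀ᵐ x ∂ρ, σ ≤ x := by
    filter_upwards [measure_eq_zero_iff_ae_notMem.1 hρ] with x hx
    simpa using hx
  have hH0 : ∀ x, x ^ 2 / 2 ≤ H x := fun x => by
    have := half_sq_sub_le_realField hα x
    simp only [hH]; linarith
  have hklow : ∀ x y, (0 < α → 0 < x) → (0 < α → 0 < y) →
      ((1 / 2 * (H x + H y) - C : ℝ) : EReal) ≤ energyKernel (externalField α) x y := by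
    intro x y hx hy
    refine coe_le_energyKernel hα hx hy fun _ => ?_
    have := log_sub_le x y
    simp only [hH]
    linarith
  have hkC : ∀ z, ((-C : ℝ) : EReal) ≤ k z := by
    rintro ⟨x, y⟩
    by_cases hx : 0 < α → 0 < x
    · by_cases hy : 0 < α → 0 < y
      · refine le_trans (EReal.coe_le_coe_iff.2 ?_) (hklow x y hx hy)
        have := hH0 x
        have := hH0 y
        nlinarith [sq_nonneg x, sq_nonneg y]
      · push Not at hy
        have e : k (x, y) = k (y, x) := by
          simp only [hk, energyKernel, abs_sub_comm x y, add_comm (externalField α x)]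
        rw [e]
        simp only [hk]
        rw [energyKernel_eq_top hy.1 hy.2]
        exact le_top
    · push Not at hx
      simp only [hk]
      rw [energyKernel_eq_top hx.1 hx.2]
      exact le_top
  have hN : ∫⁻ z, (-k z).toENNReal ∂(ρ.prod ρ) ≠ ⊤ := by
    have : ∫⁻ z, (-k z).toENNReal ∂(ρ.prod ρ) ≤ ∫⁻ _, ENNReal.ofReal C ∂(ρ.prod ρ) := by
      refine lintegral_mono fun z => ?_
      rw [← EReal.toENNReal_coe_real]
      apply EReal.toENNReal_le_toENNReal
      have := EReal.neg_le_neg_iff.2 (hkC z)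
      rwa [← EReal.coe_neg, neg_neg] at this
    refine ne_top_of_le_ne_top ?_ this
    simp
  have hP : ∫⁻ z, (k z).toENNReal ∂(ρ.prod ρ) ≠ ⊤ := by
    intro hP
    have : logEnergy (externalField α) ρ = ⊤ := by
      unfold logEnergy
      simp only [hk] at hP hN
      rw [hP, EReal.coe_ennreal_top, EReal.top_sub]
      rwa [Ne, EReal.coe_ennreal_eq_top_iff]
    exact hfin.ne this
  have hdomain : ∀ᵐ x ∂ρ, 0 < α → 0 < x := by
    rcases hα.eq_or_lt with h0 | hα'
    · exact ae_of_all _ fun x hx => absurd h0 hx.ne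
    · have hz : ρ (Set.Iic 0) = 0 := by
        by_contra hne
        apply hP
        rw [eq_top_iff]
        calc (⊤ : ENNReal) = ⊤ * ρ.prod ρ (Set.Iic 0 ×ˢ Set.univ) := by
              rw [Measure.prod_prod, measure_univ, mul_one, ENNReal.top_mul hne]
          _ = ∫⁻ z, (Set.Iic (0 : ℝ) ×ˢ (Set.univ : Set ℝ)).indicator (fun _ => ⊤) z ∂(ρ.prod ρ) := by
              rw [lintegral_indicator_const (measurableSet_Iic.prod MeasurableSet.univ)]
          _ ≤ _ := by
              refine lintegral_mono fun z => ?_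
              by_cases hz : z ∈ Set.Iic (0 : ℝ) ×ˢ (Set.univ : Set ℝ)
              · simp only [hk]
                rw [energyKernel_eq_top hα' hz.1, EReal.toENNReal_top]
                exact le_top
              · rw [Set.indicator_of_notMem hz]
                exact bot_le
      filter_upwards [measure_eq_zero_iff_ae_notMem.1 hz] with x hx _
      simpa using hx
  have hHint : Integrable H ρ := by
    refine ⟨hHm.aestronglyMeasurable, ?_⟩
    rw [hasFiniteIntegral_iff_ofReal (ae_of_all _ fun x =>
      (by positivity : (0 : ℝ) ≤ x ^ 2 / 2).trans (hH0 x))]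
    have h1 : ∫⁻ x, ENNReal.ofReal (H x) ∂ρ = ∫⁻ z, ENNReal.ofReal (H z.1) ∂(ρ.prod ρ) :=
      ((measurePreserving_fst (μ := ρ) (ν := ρ)).lintegral_comp hHm.ennreal_ofReal).symm
    rw [h1]
    have h2 : ∫⁻ z, ENNReal.ofReal (H z.1) ∂(ρ.prod ρ) ≤
        ∫⁻ z, (2 * (k z).toENNReal + ENNReal.ofReal (2 * C)) ∂(ρ.prod ρ) := by
      refine lintegral_mono_ae ?_
      filter_upwards [ae_prod_and hdomain hdomain] with z hz
      have e1 := EReal.toENNReal_le_toENNReal (hklow z.1 z.2 hz.1 hz.2)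
      rw [EReal.toENNReal_coe_real] at e1
      have e2 := hH0 z.2
      calc ENNReal.ofReal (H z.1)
          ≤ ENNReal.ofReal (2 * (1 / 2 * (H z.1 + H z.2) - C) + 2 * C) := by
            apply ENNReal.ofReal_le_ofReal
            nlinarith [sq_nonneg z.2]
        _ ≤ ENNReal.ofReal (2 * (1 / 2 * (H z.1 + H z.2) - C)) + ENNReal.ofReal (2 * C) :=
            ENNReal.ofReal_add_le
        _ = 2 * ENNReal.ofReal (1 / 2 * (H z.1 + H z.2) - C) + ENNReal.ofReal (2 * C) := by
            rw [ENNReal.ofReal_mul two_pos.le]; simp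
        _ ≤ _ := by gcongr
    refine lt_of_le_of_lt h2 ?_
    rw [lintegral_add_right _ measurable_const, lintegral_const_mul' _ _ (by simp)]
    simp only [lintegral_const, measure_univ, mul_one]
    exact ENNReal.add_lt_top.2 ⟨ENNReal.mul_lt_top (by simp) hP.lt_top, ENNReal.ofReal_lt_top⟩
  have hsq : Integrable (fun x => x ^ 2) ρ := by
    refine Integrable.mono' (hHint.const_mul 2)
      (by fun_prop : Measurable fun x : ℝ => x ^ 2).aestronglyMeasurable (ae_of_all _ fun x => ?_)
    rw [Real.norm_of_nonneg (sq_nonneg x)]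
    linarith [hH0 x]
  refine ⟨hσ.and hdomain, hsq, ?_⟩
  have hlog : Integrable (fun x => Real.log (1 + |x|)) ρ := by
    refine Integrable.mono' (integrable_abs_of_sq hsq)
      (by fun_prop : Measurable fun x : ℝ => Real.log (1 + |x|)).aestronglyMeasurable
      (ae_of_all _ fun x => ?_)
    rw [Real.norm_of_nonneg (Real.log_nonneg (by linarith [abs_nonneg x]))]
    have := Real.log_le_sub_one_of_pos (by positivity : 0 < 1 + |x|)
    linarith
  have := (hHint.sub (integrable_const C)).add (hlog.const_mul 2)
  refine this.congr (ae_of_all _ fun x => ?_)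
  simp only [Pi.add_apply, Pi.sub_apply, hH]
  ring

/-- The energy exceeds the minimal one at least by the distance to `ν`. -/
lemma minEnergy_add_regDist_le [IsProbabilityMeasure ν] (h : IsExtremal α σ ν ℓ M)
    {ρ : Measure ℝ} [IsProbabilityMeasure ρ] (hρ : ρ (Set.Ici σ)ᶜ = 0)
    (hfin : logEnergy (externalField α) ρ < ⊤) :
    Integrable (fun x => x ^ 2) ρ ∧ ∀ T, 0 < T →
      ((minEnergy ν ℓ + regDist T ρ ν - (IsLogRegular.truncError M T + 1 / T) : ℝ) : EReal) ≤
        logEnergy (externalField α) ρ := by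
  obtain ⟨hmem, hsq, hQ⟩ := finite_energy h.nonneg hρ hfin
  refine ⟨hsq, fun T hT => ?_⟩
  have hK := integrable_regLog_sub hsq hsq hT.le
  have hQ1 : Integrable (fun p : ℝ × ℝ => realField α p.1) (ρ.prod ρ) := hQ.comp_fst ρ
  have hQ2 : Integrable (fun p : ℝ × ℝ => realField α p.2) (ρ.prod ρ) := hQ.comp_snd ρ
  have hQQ : Integrable (fun p : ℝ × ℝ => 1 / 2 * (realField α p.1 + realField α p.2))
    (ρ.prod ρ) := (hQ1.add hQ2).const_mul _
  have hKT : Integrable (fun p : ℝ × ℝ => regLog T (p.1 - p.2) - 1 / T) (ρ.prod ρ) :=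
    hK.sub (integrable_const _)
  have hval : ∫ p, (regLog T (p.1 - p.2) - 1 / T +
      1 / 2 * (realField α p.1 + realField α p.2)) ∂(ρ.prod ρ) =
      regEnergy T ρ ρ - 1 / T + ∫ x, realField α x ∂ρ := by
    rw [integral_add hKT hQQ, integral_sub hK (integrable_const _), integral_const_mul,
      integral_add hQ1 hQ2, integral_fun_fst, integral_fun_snd]
    simp [regEnergy]
    ring
  have hU := h.regular.integrable_logPotential hsq
  -- The Euler-Lagrange inequality, integrated against the competitor.
  have hgℓ : ℓ ≤ ∫ x, realField α x ∂ρ - 2 * ∫ x, logPotential ν x ∂ρ := by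
    rw [← integral_const_mul, ← integral_sub hQ (hU.const_mul 2)]
    have := integral_mono_ae (integrable_const ℓ) (hQ.sub (hU.const_mul 2))
      (hmem.mono fun x hx => h.le x hx.1 hx.2)
    simpa using this
  have hmain := h.regular.regEnergy_ge hsq hT
  refine le_trans (EReal.coe_le_coe_iff.2 ?_) (coe_integral_le_of_le (hKT.add hQQ) ?_)
  · change _ ≤ ∫ p, (regLog T (p.1 - p.2) - 1 / T +
      1 / 2 * (realField α p.1 + realField α p.2)) ∂(ρ.prod ρ)
    rw [hval]
    unfold minEnergy
    linarith
  · filter_upwards [ae_prod_and hmem hmem] with p hp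
    refine coe_le_energyKernel h.nonneg hp.1.2 hp.2.2 fun hne => ?_
    have := regLog_le_neg_log hT hne
    simp only [Pi.add_apply]
    linarith

lemma minEnergy_le_logEnergy [IsProbabilityMeasure ν] (h : IsExtremal α σ ν ℓ M)
    {ρ : Measure ℝ} [IsProbabilityMeasure ρ] (hρ : ρ (Set.Ici σ)ᶜ = 0) :
    (minEnergy ν ℓ : EReal) ≤ logEnergy (externalField α) ρ := by
  by_cases hfin : logEnergy (externalField α) ρ < ⊤
  swap
  · rw [not_lt_top_iff.1 hfin]; exact le_top
  obtain ⟨hsq, hT⟩ := h.minEnergy_add_regDist_le hρ hfin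
  have hlim : Tendsto (fun T : ℝ => minEnergy ν ℓ - (IsLogRegular.truncError M T + 1 / T)) atTop
      (𝓝 (minEnergy ν ℓ - (0 + 0))) := by
    have h2 : Tendsto (fun T : ℝ => 1 / T) atTop (𝓝 0) := by
      simpa using tendsto_inv_atTop_zero (𝕜 := ℝ)
    exact tendsto_const_nhds.sub ((IsLogRegular.tendsto_truncError M).add h2)
  rw [add_zero, sub_zero] at hlim
  refine le_of_tendsto ((continuous_coe_real_ereal.tendsto _).comp hlim) ?_
  filter_upwards [eventually_gt_atTop 0] with T hT0
  refine le_trans (EReal.coe_le_coe_iff.2 ?_) (hT T hT0)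
  have := regDist_nonneg hsq h.regular.integrable_sq T
  linarith

/-- A measure satisfying the Euler-Lagrange conditions is the unique equilibrium measure. -/
theorem isEquilibriumMeasure_iff [IsProbabilityMeasure ν] (h : IsExtremal α σ ν ℓ M)
    (ρ : Measure ℝ) : IsEquilibriumMeasure (Set.Ici σ) (externalField α) ρ ↔ ρ = ν := by
  have hν : ν (Set.Ici σ)ᶜ = 0 := by
    have : ∀ᵐ x ∂ν, x ∈ Set.Ici σ := h.mem.mono fun x hx => hx.1
    exact this
  constructor
  · rintro ⟨hρp, hρ, hmin⟩
    have hle := (hmin ν inferInstance hν).trans h.logEnergy_le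
    obtain ⟨hsq, hT⟩ := h.minEnergy_add_regDist_le hρ (hle.trans_lt (EReal.coe_lt_top _))
    refine Measure.ext_of_integral_eq_on_compactlySupported fun f => ?_
    by_contra hne
    have hε : 0 < |∫ x, f x ∂ρ - ∫ x, f x ∂ν| := abs_pos.2 (sub_ne_zero.2 hne)
    obtain ⟨T₁, c, hc, hreg⟩ := exists_le_regDist f.continuous f.hasCompactSupport hε
    have hlim : Tendsto (fun T : ℝ => IsLogRegular.truncError M T + 1 / T) atTop
        (𝓝 (0 + 0)) := by
      have h2 : Tendsto (fun T : ℝ => 1 / T) atTop (𝓝 0) := by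
        simpa using tendsto_inv_atTop_zero (𝕜 := ℝ)
      exact (IsLogRegular.tendsto_truncError M).add h2
    rw [add_zero] at hlim
    -- The lower bound `c` does not depend on `T`, so `T` can be taken with truncation error below
    -- `c`, contradicting minimality.
    obtain ⟨T, h1, h2, h3⟩ := ((hlim.eventually (gt_mem_nhds hc)).and
      ((eventually_gt_atTop 0).and (eventually_ge_atTop T₁))).exists
    have h4 := hreg ρ ν hρp inferInstance hsq h.regular.integrable_sq le_rfl T h3
    have h5 := EReal.coe_le_coe_iff.1 ((hT T h2).trans hle)
    linarith
  · rintro rfl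
    exact ⟨inferInstance, hν, fun ρ hρ hρσ => h.logEnergy_le.trans
      (haveI := hρ; h.minEnergy_le_logEnergy hρσ)⟩

end IsExtremal

/-! ### The rescaled eigenvalue weight and its Hamiltonian -/

/-- The eigenvalue weight at `√n x`, up to a constant factor. -/
noncomputable def gibbsWeight (β m : ℝ) (n : ℕ) (x : Fin n → ℝ) : ℝ :=
  (∏ i, |x i| ^ (β * m)) * Real.exp (-(β / 2) * (n * ∑ i, x i ^ 2)) * absVandermonde n x ^ β

/-- The Hamiltonian of the rescaled eigenvalue weight. -/
noncomputable def hamiltonian (m : ℝ) (n : ℕ) (x : Fin n → ℝ) : ℝ :=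
  n * ∑ i, x i ^ 2 - 2 * m * ∑ i, Real.log (x i) - ∑ i, ∑ j, Real.log (x i - x j)

lemma absVandermonde_nonneg (n : ℕ) (x : Fin n → ℝ) : 0 ≤ absVandermonde n x :=
  Finset.prod_nonneg fun _ _ => Finset.prod_nonneg fun _ _ => abs_nonneg _

lemma measurable_absVandermonde (n : ℕ) : Measurable (absVandermonde n) := by
  unfold absVandermonde
  fun_prop

lemma gibbsWeight_nonneg (β m : ℝ) (n : ℕ) (x : Fin n → ℝ) : 0 ≤ gibbsWeight β m n x := by
  have := absVandermonde_nonneg n x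
  unfold gibbsWeight
  positivity

lemma measurable_gibbsWeight (β m : ℝ) (n : ℕ) : Measurable (gibbsWeight β m n) := by
  have := measurable_absVandermonde n
  unfold gibbsWeight
  fun_prop

lemma measurable_eigenvalueWeight (β m : ℝ) (n : ℕ) : Measurable (eigenvalueWeight β m n) := by
  have := measurable_absVandermonde n
  unfold eigenvalueWeight
  fun_prop

lemma exists_eigenvalueWeight_smul (β m : ℝ) (n : ℕ) (hn : 0 < n) : ∃ κ : ℝ, 0 < κ ∧
    ∀ x : Fin n → ℝ, eigenvalueWeight β m n (√(n : ℝ) • x) = κ * gibbsWeight β m n x := by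
  have hs : 0 < √(n : ℝ) := Real.sqrt_pos.2 (by exact_mod_cast hn)
  obtain ⟨s, hsd⟩ : ∃ s, s = √(n : ℝ) := ⟨_, rfl⟩
  have hs2 : s ^ 2 = n := by rw [hsd, Real.sq_sqrt (Nat.cast_nonneg n)]
  rw [← hsd] at hs ⊢
  refine ⟨(∏ _i : Fin n, s ^ (β * m)) * (∏ i : Fin n, ∏ _j ∈ Finset.Ioi i, s) ^ β, ?_,
    fun x => ?_⟩
  · have h1 : 0 < ∏ i : Fin n, ∏ _j ∈ Finset.Ioi i, s :=
      Finset.prod_pos fun _ _ => Finset.prod_pos fun _ _ => hs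
    have h2 : 0 < ∏ _i : Fin n, s ^ (β * m) :=
      Finset.prod_pos fun _ _ => Real.rpow_pos_of_pos hs _
    positivity
  · have h1 : ∏ i, |(s • x) i| ^ (β * m) =
        (∏ _i : Fin n, s ^ (β * m)) * ∏ i, |x i| ^ (β * m) := by
      rw [← Finset.prod_mul_distrib]
      refine Finset.prod_congr rfl fun i _ => ?_
      rw [Pi.smul_apply, smul_eq_mul, abs_mul, abs_of_pos hs, Real.mul_rpow hs.le (abs_nonneg _)]
    have h2 : absVandermonde n (s • x) =
        (∏ i : Fin n, ∏ _j ∈ Finset.Ioi i, s) * absVandermonde n x := by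
      unfold absVandermonde
      rw [← Finset.prod_mul_distrib]
      refine Finset.prod_congr rfl fun i _ => ?_
      rw [← Finset.prod_mul_distrib]
      refine Finset.prod_congr rfl fun j _ => ?_
      rw [Pi.smul_apply, Pi.smul_apply, smul_eq_mul, smul_eq_mul, ← mul_sub, abs_mul,
        abs_of_pos hs]
    have h3 : ∑ i, (s • x) i ^ 2 = n * ∑ i, x i ^ 2 := by
      rw [Finset.mul_sum]
      refine Finset.sum_congr rfl fun i _ => ?_
      rw [Pi.smul_apply, smul_eq_mul, mul_pow, hs2]
    unfold eigenvalueWeight gibbsWeight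
    rw [h1, h2, h3, Real.mul_rpow (Finset.prod_nonneg fun _ _ => Finset.prod_nonneg fun _ _ => hs.le)
      (absVandermonde_nonneg n x)]
    ring

lemma injective_of_absVandermonde_ne_zero {n : ℕ} {x : Fin n → ℝ} (h : absVandermonde n x ≠ 0) :
    Function.Injective x := by
  unfold absVandermonde at h
  simp only [Finset.prod_ne_zero_iff, Finset.mem_univ, forall_const, Finset.mem_Ioi,
    abs_ne_zero] at h
  intro i j hij
  by_contra hne
  rcases lt_or_gt_of_ne hne with h' | h'
  · exact h i j h' (sub_eq_zero.2 hij)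
  · exact h j i h' (sub_eq_zero.2 hij.symm)

/-- The full double sum is harmless because the diagonal terms are `Real.log 0 = 0`. -/
lemma sum_log_sub_eq {n : ℕ} (x : Fin n → ℝ) :
    ∑ i, ∑ j, Real.log (x i - x j) = 2 * ∑ i, ∑ j ∈ Finset.Ioi i, Real.log |x i - x j| := by
  have h := Finset.sum_sum_Ioi_add_eq_sum_sum_off_diag (fun i j => Real.log (x j - x i))
  have h1 : ∀ i : Fin n, ∑ j ∈ {i}ᶜ, Real.log (x i - x j) = ∑ j, Real.log (x i - x j) := by
    intro i
    refine Finset.sum_subset (Finset.subset_univ _) fun j _ hj => ?_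
    have : j = i := by simpa using hj
    rw [this, sub_self, Real.log_zero]
  rw [Finset.mul_sum, ← Finset.sum_congr rfl fun i _ => h1 i, ← h]
  refine Finset.sum_congr rfl fun i _ => ?_
  rw [Finset.mul_sum]
  refine Finset.sum_congr rfl fun j _ => ?_
  rw [Real.log_abs, ← Real.log_neg_eq_log (x j - x i), neg_sub]
  ring

/-- A zero coordinate is allowed when `m = 0`: then the power is `1` and the logarithmic term is
absent. -/
lemma gibbsWeight_eq_exp {β m : ℝ} {n : ℕ} {x : Fin n → ℝ} (hx : Function.Injective x)
    (h0 : m = 0 ∨ ∀ i, x i ≠ 0) :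
    gibbsWeight β m n x = Real.exp (-(β / 2) * hamiltonian m n x) := by
  have h1 : ∏ i, |x i| ^ (β * m) = Real.exp (β * m * ∑ i, Real.log (x i)) := by
    rcases h0 with rfl | h0
    · simp
    · rw [Finset.mul_sum, Real.exp_sum]
      refine Finset.prod_congr rfl fun i _ => ?_
      rw [Real.rpow_def_of_pos (abs_pos.2 (h0 i)), Real.log_abs, mul_comm]
  have hne : ∀ i, ∀ j ∈ Finset.Ioi i, |x i - x j| ≠ 0 := fun i j hj =>
    abs_ne_zero.2 (sub_ne_zero.2 (hx.ne (Finset.mem_Ioi.1 hj).ne))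
  have hV : 0 < absVandermonde n x :=
    Finset.prod_pos fun i _ => Finset.prod_pos fun j hj =>
      lt_of_le_of_ne (abs_nonneg _) (hne i j hj).symm
  have h2 : absVandermonde n x ^ β =
      Real.exp (β / 2 * ∑ i, ∑ j, Real.log (x i - x j)) := by
    rw [Real.rpow_def_of_pos hV, sum_log_sub_eq]
    congr 1
    unfold absVandermonde
    rw [Real.log_prod fun i _ => Finset.prod_ne_zero_iff.2 (hne i)]
    rw [Finset.sum_congr rfl fun i _ => Real.log_prod (hne i)]
    ring
  unfold gibbsWeight hamiltonian
  rw [h1, h2, ← Real.exp_add, ← Real.exp_add]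
  congr 1
  ring

/-- Configurations without a Hamiltonian representation have weight zero, where upper bounds are
trivial. -/
lemma injective_of_gibbsWeight_ne_zero {β m : ℝ} (hβ : 0 < β) {n : ℕ} {x : Fin n → ℝ}
    (h : gibbsWeight β m n x ≠ 0) : Function.Injective x ∧ (m = 0 ∨ ∀ i, x i ≠ 0) := by
  unfold gibbsWeight at h
  refine ⟨injective_of_absVandermonde_ne_zero fun h0 => h ?_, ?_⟩
  · rw [h0, Real.zero_rpow hβ.ne', mul_zero]
  · by_contra! hm
    obtain ⟨i, hi⟩ := hm.2
    apply h
    rw [Finset.prod_eq_zero (Finset.mem_univ i), zero_mul, zero_mul]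
    rw [hi, abs_zero, Real.zero_rpow (mul_ne_zero hβ.ne' hm.1)]

/-! ### Empirical measures -/

/-- The empirical measure of a configuration. -/
noncomputable def empirical (n : ℕ) (x : Fin n → ℝ) : Measure ℝ :=
  (n : ENNReal)⁻¹ • ∑ i : Fin n, Measure.dirac (x i)

lemma integrable_empirical {n : ℕ} (hn : 0 < n) (x : Fin n → ℝ) (f : ℝ → ℝ) :
    Integrable f (empirical n x) := by
  refine Integrable.smul_measure ?_ (by simp [hn.ne'])
  rw [integrable_finsetSum_measure]
  exact fun i _ => integrable_dirac (by simp)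

lemma integral_empirical (n : ℕ) (x : Fin n → ℝ) (f : ℝ → ℝ) :
    ∫ t, f t ∂(empirical n x) = (n : ℝ)⁻¹ * ∑ i, f (x i) := by
  unfold empirical
  rw [integral_smul_measure, integral_finsetSum_measure fun i _ => integrable_dirac (by simp)]
  simp

lemma isProbabilityMeasure_empirical {n : ℕ} (hn : 0 < n) (x : Fin n → ℝ) :
    IsProbabilityMeasure (empirical n x) := by
  constructor
  simp only [empirical, Measure.smul_apply, Measure.coe_finsetSum, Finset.sum_apply,
    measure_univ, smul_eq_mul, Finset.sum_const, Finset.card_univ, Fintype.card_fin, nsmul_eq_mul,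
    mul_one]
  exact ENNReal.inv_mul_cancel (by exact_mod_cast hn.ne') (by simp)

lemma regEnergy_empirical {n : ℕ} (hn : 0 < n) (x : Fin n → ℝ) {T : ℝ} (hT : 0 ≤ T) :
    (n : ℝ) ^ 2 * regEnergy T (empirical n x) (empirical n x) =
      ∑ i, ∑ j, regLog T (x i - x j) := by
  have := isProbabilityMeasure_empirical hn x
  have hn' : (n : ℝ) ≠ 0 := by exact_mod_cast hn.ne'
  unfold regEnergy
  rw [integral_prod _ (integrable_regLog_sub (integrable_empirical hn x _)
    (integrable_empirical hn x _) hT)]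
  simp only [integral_empirical]
  rw [← Finset.mul_sum]
  field_simp

/-- The Hamiltonian is bounded below by the regularised energy of the empirical measure. -/
lemma regEnergy_le_hamiltonian {m T : ℝ} {n : ℕ} (hn : 0 < n) {x : Fin n → ℝ}
    (hx : Function.Injective x) (hT : 0 < T) :
    n * ∑ i, realField (m / n) (x i) + (n : ℝ) ^ 2 *
      (regEnergy T (empirical n x) (empirical n x) - 1 / T - T / (2 * n)) ≤
      hamiltonian m n x := by
  have hn' : (0 : ℝ) < n := by exact_mod_cast hn
  -- On the diagonal the logarithm is `0` by default while `regLog T 0 ≤ T / 2`; these `n` terms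
  -- produce the error `T / (2n)`.
  have h1 : ∀ i j, regLog T (x i - x j) ≤ -Real.log (x i - x j) + 1 / T +
      if i = j then T / 2 else 0 := by
    intro i j
    split_ifs with h
    · rw [h, sub_self, Real.log_zero]
      have := regLog_le hT.le 0
      have : 0 < 1 / T := by positivity
      linarith
    · have := regLog_le_neg_log hT (sub_ne_zero.2 (hx.ne h))
      linarith
  have h2 : ∑ i, ∑ j, regLog T (x i - x j) ≤
      -∑ i, ∑ j, Real.log (x i - x j) + (n : ℝ) ^ 2 * (1 / T) + n * (T / 2) := by
    refine (Finset.sum_le_sum fun i _ => Finset.sum_le_sum fun j _ => h1 i j).trans (le_of_eq ?_)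
    simp only [Finset.sum_add_distrib, Finset.sum_neg_distrib, Finset.sum_ite_eq,
      Finset.mem_univ, if_true, Finset.sum_const, Finset.card_univ, Fintype.card_fin,
      nsmul_eq_mul]
    ring
  have h3 : (n : ℝ) * ∑ i, realField (m / n) (x i) =
      n * ∑ i, x i ^ 2 - 2 * m * ∑ i, Real.log (x i) := by
    unfold realField
    rw [Finset.sum_sub_distrib, ← Finset.mul_sum]
    field_simp
  have h4 : (n : ℝ) ^ 2 * (T / (2 * n)) = n * (T / 2) := by field_simp
  rw [mul_sub, mul_sub, regEnergy_empirical hn x hT.le, h3, h4]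
  unfold hamiltonian
  linarith

/-! ### Lower bounds for the effective potential and the Hamiltonian -/

namespace IsLogRegular

variable {ν : Measure ℝ} {M : ℝ}

lemma logPotential_le [IsProbabilityMeasure ν] (h : IsLogRegular ν M) (x : ℝ) :
    logPotential ν x ≤ Real.log (1 + |x|) + ∫ y, |y| ∂ν := by
  have h1 := integrable_abs_of_sq h.integrable_sq
  have h2 := integral_mono (h.integrable_log x)
    ((integrable_const (Real.log (1 + |x|))).add h1) fun y => by
      refine (log_sub_le x y).trans ?_
      simp only [Pi.add_apply]
      have := Real.log_le_sub_one_of_pos (by positivity : 0 < 1 + |y|)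
      linarith
  refine h2.trans (le_of_eq ?_)
  simp only [Pi.add_apply]
  rw [integral_add (integrable_const _) h1]
  simp

/-- The effective potential grows quadratically, uniformly in the charge. -/
lemma exists_half_sq_sub_le [IsProbabilityMeasure ν] (h : IsLogRegular ν M) (α ℓ : ℝ) :
    ∃ K, 0 ≤ K ∧ ∀ α', 0 ≤ α' → α' ≤ α + 1 → ∀ x,
      x ^ 2 / 2 - K ≤ realField α' x - 2 * logPotential ν x - ℓ := by
  have h1 : 0 ≤ ∫ y, |y| ∂ν := integral_nonneg fun _ => abs_nonneg _
  refine ⟨2 * (α + 2) ^ 2 + 2 * ∫ y, |y| ∂ν + |ℓ|, by positivity, fun α' h0 hle x => ?_⟩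
  have h2 := half_sq_sub_le_realField h0 x
  have h3 := h.logPotential_le x
  have h4 : (α' + 1) ^ 2 ≤ (α + 2) ^ 2 := by
    apply pow_le_pow_left₀ <;> linarith
  linarith [le_abs_self ℓ]

end IsLogRegular

namespace IsExtremal

variable {α σ ℓ M : ℝ} {ν : Measure ℝ}

/-- The effective potential for a nearby charge is almost nonnegative. -/
lemma exists_le_effectivePotential [IsProbabilityMeasure ν] (h : IsExtremal α σ ν ℓ M) :
    ∃ K, 0 ≤ K ∧
      (∀ α', 0 ≤ α' → α' ≤ α + 1 → ∀ x,
        x ^ 2 / 2 - K ≤ realField α' x - 2 * logPotential ν x - ℓ) ∧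
      ∀ α', 0 ≤ α' → α' ≤ α + 1 → ∀ x, σ ≤ x → (0 < α → 0 < x) →
        -(K * |α' - α|) ≤ realField α' x - 2 * logPotential ν x - ℓ := by
  obtain ⟨K, hK, hq⟩ := h.regular.exists_half_sq_sub_le α ℓ
  have hα := h.nonneg
  -- For `α = 0` the factor is `1`, as `0⁻¹ = 0`; otherwise `α⁻¹` comes from interpolating between
  -- the charges `0` and `α`.
  refine ⟨K * (1 + α⁻¹), by positivity, fun α' h0 h1 x => ?_, fun α' h0 h1 x hσ hx => ?_⟩
  · have := hq α' h0 h1 x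
    have : 0 ≤ K * α⁻¹ := by positivity
    linarith
  · have hg := h.le x hσ hx
    have hi : 0 ≤ α⁻¹ := by positivity
    rcases le_total α α' with hle | hle
    · have h2 := hq (α + 1) (by linarith) le_rfl x
      rw [abs_of_nonneg (sub_nonneg.2 hle)]
      -- The field is affine in the charge: the value at `α'` interpolates between `α`, where the
      -- potential is nonnegative, and `α + 1`, where it is at least `-K`.
      have e : realField α' x = (1 - (α' - α)) * realField α x + (α' - α) * realField (α + 1) x := by
        unfold realField; ring
      rw [e]
      have a1 : 0 ≤ (1 - (α' - α)) * (realField α x - 2 * logPotential ν x - ℓ) :=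
        mul_nonneg (by linarith) (by linarith)
      have a2 : (α' - α) * (-K) ≤ (α' - α) * (realField (α + 1) x - 2 * logPotential ν x - ℓ) :=
        mul_le_mul_of_nonneg_left (by nlinarith [sq_nonneg x]) (by linarith)
      have a3 : 0 ≤ K * α⁻¹ * (α' - α) := by
        have := sub_nonneg.2 hle
        positivity
      nlinarith
    · rcases hα.eq_or_lt with h00 | hpos
      · obtain rfl : α' = α := le_antisymm hle (by linarith)
        simp only [sub_self, abs_zero, mul_zero, neg_zero]
        linarith
      · have h2 := hq 0 le_rfl (by linarith) x
        rw [abs_of_nonpos (sub_nonpos.2 hle)]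
        obtain ⟨t, ht⟩ : ∃ t, t = α⁻¹ * (α - α') := ⟨_, rfl⟩
        have ht0 : 0 ≤ t := by
          rw [ht]; exact mul_nonneg hi (by linarith)
        have hαt : α * t = α - α' := by rw [ht]; field_simp
        have ht1 : t ≤ 1 := by nlinarith
        have e : realField α' x = (1 - t) * realField α x + t * realField 0 x := by
          unfold realField
          linear_combination (-2 * Real.log x) * hαt
        rw [e]
        have a1 : 0 ≤ (1 - t) * (realField α x - 2 * logPotential ν x - ℓ) :=
          mul_nonneg (by linarith) (by linarith)
        have a2 : t * (-K) ≤ t * (realField 0 x - 2 * logPotential ν x - ℓ) :=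
          mul_le_mul_of_nonneg_left (by nlinarith [sq_nonneg x]) ht0
        have a3 : 0 ≤ K * (α - α') := mul_nonneg hK (by linarith)
        have a4 : K * (1 + α⁻¹) * -(α' - α) = K * (α - α') + K * t := by rw [ht]; ring
        rw [a4]
        linarith

/-- Lower bound of the Hamiltonian in terms of the distance to the extremal measure. -/
lemma hamiltonian_ge [IsProbabilityMeasure ν] (h : IsExtremal α σ ν ℓ M) {m T : ℝ} {n : ℕ}
    (hn : 0 < n) {x : Fin n → ℝ} (hx : Function.Injective x) (hT : 0 < T) :
    (n : ℝ) ^ 2 * (minEnergy ν ℓ + regDist T (empirical n x) ν -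
      (IsLogRegular.truncError M T + 1 / T + T / (2 * n))) +
      n * ∑ i, (realField (m / n) (x i) - 2 * logPotential ν (x i) - ℓ) ≤
      hamiltonian m n x := by
  have hn' : (0 : ℝ) < n := by exact_mod_cast hn
  have := isProbabilityMeasure_empirical hn x
  refine le_trans ?_ (regEnergy_le_hamiltonian hn hx hT)
  have h1 := h.regular.regEnergy_ge (integrable_empirical hn x _) hT
  rw [integral_empirical] at h1
  have h2 : (n : ℝ) * ∑ i, (realField (m / n) (x i) - 2 * logPotential ν (x i) - ℓ) =
      n * ∑ i, realField (m / n) (x i) -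
        (n : ℝ) ^ 2 * (2 * ((n : ℝ)⁻¹ * ∑ i, logPotential ν (x i)) + ℓ) := by
    rw [Finset.sum_sub_distrib, Finset.sum_sub_distrib, ← Finset.mul_sum]
    simp only [Finset.sum_const, Finset.card_univ, Fintype.card_fin, nsmul_eq_mul]
    field_simp
    ring
  rw [h2]
  have h3 := mul_le_mul_of_nonneg_left h1 (sq_nonneg (n : ℝ))
  unfold minEnergy
  nlinarith

end IsExtremal

/-- The product of Gaussian weights dominating the eigenvalue weight. -/
lemma lintegral_prod_gaussian {c : ℝ} (hc : 0 < c) (n : ℕ) :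
    ∫⁻ x : Fin n → ℝ, ENNReal.ofReal (∏ i, Real.exp (-c * x i ^ 2)) =
      ENNReal.ofReal (√(Real.pi / c) ^ n) := by
  have hi : Integrable (fun x : Fin n → ℝ => ∏ i, Real.exp (-c * x i ^ 2)) :=
    Integrable.fintype_prod (f := fun _ t => Real.exp (-c * t ^ 2))
      fun _ => integrable_exp_neg_mul_sq hc
  rw [← ofReal_integral_eq_lintegral_ofReal hi (ae_of_all _ fun x => by positivity),
    integral_fintype_prod_volume_eq_pow (fun t => Real.exp (-c * t ^ 2)), integral_gaussian]
  simp

namespace IsExtremal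

variable {α σ ℓ M : ℝ} {ν : Measure ℝ}

/-- Finiteness of the partition function and smallness of the weight of the configurations whose
empirical measure is far from the extremal measure. -/
lemma exists_lintegral_gibbsWeight_le [IsProbabilityMeasure ν] (h : IsExtremal α σ ν ℓ M) {β : ℝ}
    (hβ : 0 < β) :
    ∃ K D : ℝ, 0 < D ∧ ∀ (m : ℝ) (n : ℕ), 0 < n → 0 ≤ m → m / n ≤ α + 1 →
      (∫⁻ x, ENNReal.ofReal (gibbsWeight β m n x) < ⊤) ∧
      ∀ (T c : ℝ) (A : Set (Fin n → ℝ)), 0 < T → (0 < α → 0 < m) → MeasurableSet A →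
        (∀ x ∈ A, (∀ i, σ ≤ x i) ∧ c ≤ regDist T (empirical n x) ν) →
        ∫⁻ x in A, ENNReal.ofReal (gibbsWeight β m n x) ≤
          ENNReal.ofReal (Real.exp (-(β / 2) * ((n : ℝ) ^ 2 * (minEnergy ν ℓ + c -
            (IsLogRegular.truncError M T + 1 / T + T / (2 * n) + K * |m / n - α|)))) *
            D ^ n) := by
  obtain ⟨K, hK, hq, hg⟩ := h.exists_le_effectivePotential
  refine ⟨K, Real.exp (β / 2 * K) * √(Real.pi / (β / 4)), ?_, fun m n hn hm hmn => ⟨?_, ?_⟩⟩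
  · have : 0 < Real.pi / (β / 4) := by positivity
    have := Real.sqrt_pos.2 this
    positivity
  · have hn' : (0 : ℝ) < n := by exact_mod_cast hn
    have hn1 : (1 : ℝ) ≤ n := by exact_mod_cast hn
    -- For mere finiteness, `T = 1` and the quadratic growth of the potential are enough, without
    -- the constraint `x i ≥ σ`.
    obtain ⟨B, hB⟩ : ∃ B, B = (n : ℝ) ^ 2 * (minEnergy ν ℓ -
      (IsLogRegular.truncError M 1 + 1 / 1 + 1 / (2 * n))) - n * (n * K) := ⟨_, rfl⟩
    have hb : ∀ x : Fin n → ℝ, gibbsWeight β m n x ≤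
        Real.exp (-(β / 2) * B) * ∏ i, Real.exp (-(β / 4) * x i ^ 2) := by
      intro x
      by_cases h0 : gibbsWeight β m n x = 0
      · rw [h0]; positivity
      obtain ⟨hx, hx0⟩ := injective_of_gibbsWeight_ne_zero hβ h0
      have := isProbabilityMeasure_empirical hn x
      rw [gibbsWeight_eq_exp hx hx0, ← Real.exp_sum, ← Real.exp_add]
      apply Real.exp_le_exp.2
      have h1 := h.hamiltonian_ge (m := m) hn hx one_pos
      have h2 := regDist_nonneg (integrable_empirical hn x _) h.regular.integrable_sq (1 : ℝ)
      have h3 : ∑ i, (x i ^ 2 / 2) - n * K ≤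
          ∑ i, (realField (m / n) (x i) - 2 * logPotential ν (x i) - ℓ) := by
        have := Finset.sum_le_sum fun i (_ : i ∈ Finset.univ) =>
          hq (m / n) (by positivity) hmn (x i)
        rw [Finset.sum_sub_distrib] at this
        simpa using this
      have h4 : 0 ≤ ∑ i, (x i ^ 2 / 2) := Finset.sum_nonneg fun _ _ => by positivity
      have h5 : ∑ i, -(β / 4) * x i ^ 2 = -(β / 2) * ∑ i, (x i ^ 2 / 2) := by
        rw [Finset.mul_sum]
        exact Finset.sum_congr rfl fun i _ => by ring
      rw [h5, ← mul_add]
      apply mul_le_mul_of_nonpos_left _ (by linarith)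
      have h6 := mul_le_mul_of_nonneg_left h3 hn'.le
      have h7 := mul_le_mul_of_nonneg_left h2 (sq_nonneg (n : ℝ))
      rw [hB]
      nlinarith
    calc ∫⁻ x, ENNReal.ofReal (gibbsWeight β m n x)
        ≤ ∫⁻ x : Fin n → ℝ, ENNReal.ofReal (Real.exp (-(β / 2) * B)) *
          ENNReal.ofReal (∏ i, Real.exp (-(β / 4) * x i ^ 2)) := by
          refine lintegral_mono fun x => ?_
          rw [← ENNReal.ofReal_mul (Real.exp_nonneg _)]
          exact ENNReal.ofReal_le_ofReal (hb x)
      _ < ⊤ := by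
          rw [lintegral_const_mul' _ _ ENNReal.ofReal_ne_top, lintegral_prod_gaussian (by positivity)]
          exact ENNReal.mul_lt_top ENNReal.ofReal_lt_top ENNReal.ofReal_lt_top
  · intro T c A hT hpos hA hcond
    have hn' : (0 : ℝ) < n := by exact_mod_cast hn
    have hn1 : (1 : ℝ) ≤ n := by exact_mod_cast hn
    obtain ⟨δ, hδ⟩ : ∃ δ, δ = K * |m / n - α| := ⟨_, rfl⟩
    have hδ0 : 0 ≤ δ := by rw [hδ]; positivity
    obtain ⟨B, hB⟩ : ∃ B, B = (n : ℝ) ^ 2 * (minEnergy ν ℓ + c -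
      (IsLogRegular.truncError M T + 1 / T + T / (2 * n) + δ)) := ⟨_, rfl⟩
    rw [← hδ, ← hB]
    have hb : ∀ x ∈ A, gibbsWeight β m n x ≤
        Real.exp (-(β / 2) * B) * Real.exp (β / 2 * K) ^ n *
          ∏ i, Real.exp (-(β / 4) * x i ^ 2) := by
      intro x hxA
      by_cases h0 : gibbsWeight β m n x = 0
      · rw [h0]; positivity
      obtain ⟨hx, hx0⟩ := injective_of_gibbsWeight_ne_zero hβ h0
      obtain ⟨hσ, hc⟩ := hcond x hxA
      rw [gibbsWeight_eq_exp hx hx0, ← Real.exp_sum, ← Real.exp_nat_mul, ← Real.exp_add,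
        ← Real.exp_add]
      apply Real.exp_le_exp.2
      have h1 := h.hamiltonian_ge (m := m) hn hx hT
      -- When `α > 0`, also `m > 0`, so a vanishing coordinate would make the weight zero; this
      -- excludes `x i = 0` even for `σ = 0`.
      have hdom : ∀ i, 0 < α → 0 < x i := by
        intro i hα
        rcases h.domain with hs | hs
        · rcases hx0 with hm0 | hx0
          · exact absurd hm0 (hpos hα).ne'
          · exact lt_of_le_of_ne (hs.trans (hσ i)) (hx0 i).symm
        · exact absurd hs hα.ne'
      have h3 : ∑ i, (x i ^ 2 / 2) - n * K - n * (n * δ) ≤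
          n * ∑ i, (realField (m / n) (x i) - 2 * logPotential ν (x i) - ℓ) := by
        -- Of the `n` copies of the effective potential, one supplies Gaussian decay and the other
        -- `n - 1` are bounded below by `-δ`. Integrating the decay costs only a factor `D ^ n`.
        have h4 : ∀ i, x i ^ 2 / 2 - K - n * δ ≤
            n * (realField (m / n) (x i) - 2 * logPotential ν (x i) - ℓ) := by
          intro i
          have e1 := hq (m / n) (by positivity) hmn (x i)
          have e2 := hg (m / n) (by positivity) hmn (x i) (hσ i) (hdom i)
          rw [← hδ] at e2
          have e3 := mul_le_mul_of_nonneg_left e2 (sub_nonneg.2 hn1)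
          nlinarith
        have h5 := Finset.sum_le_sum fun i (_ : i ∈ Finset.univ) => h4 i
        rw [← Finset.mul_sum, Finset.sum_sub_distrib, Finset.sum_sub_distrib] at h5
        simpa using h5
      have h5 : ∑ i, -(β / 4) * x i ^ 2 = -(β / 2) * ∑ i, (x i ^ 2 / 2) := by
        rw [Finset.mul_sum]
        exact Finset.sum_congr rfl fun i _ => by ring
      rw [h5]
      have h6 : -(β / 2) * B + n * (β / 2 * K) + -(β / 2) * ∑ i, (x i ^ 2 / 2) =
          -(β / 2) * (B - n * K + ∑ i, (x i ^ 2 / 2)) := by ring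
      rw [h6]
      apply mul_le_mul_of_nonpos_left _ (by linarith)
      have h7 := mul_le_mul_of_nonneg_left hc (sq_nonneg (n : ℝ))
      rw [hB]
      nlinarith
    calc ∫⁻ x in A, ENNReal.ofReal (gibbsWeight β m n x)
        ≤ ∫⁻ x in A, ENNReal.ofReal (Real.exp (-(β / 2) * B) * Real.exp (β / 2 * K) ^ n) *
          ENNReal.ofReal (∏ i, Real.exp (-(β / 4) * x i ^ 2)) := by
          refine setLIntegral_mono' hA fun x hx => ?_
          rw [← ENNReal.ofReal_mul (by positivity)]
          exact ENNReal.ofReal_le_ofReal (hb x hx)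
      _ ≤ ∫⁻ x : Fin n → ℝ, ENNReal.ofReal (Real.exp (-(β / 2) * B) * Real.exp (β / 2 * K) ^ n) *
          ENNReal.ofReal (∏ i, Real.exp (-(β / 4) * x i ^ 2)) := setLIntegral_le_lintegral _ _
      _ = _ := by
          have h0 : 0 ≤ Real.exp (-(β / 2) * B) * Real.exp (β / 2 * K) ^ n :=
            mul_nonneg (Real.exp_nonneg _) (pow_nonneg (Real.exp_nonneg _) _)
          have hβ4 : 0 < β / 4 := by linarith
          rw [lintegral_const_mul' _ _ ENNReal.ofReal_ne_top, lintegral_prod_gaussian hβ4,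
            ← ENNReal.ofReal_mul h0, mul_pow, mul_assoc]

end IsExtremal

/-! ### Lower bound of the partition function -/

/-- `ν` has a density `p` dominated by `exp G` with `G` integrable. -/
structure HasDominatedDensity (ν : Measure ℝ) (p G : ℝ → ℝ) : Prop where
  measurable : Measurable p
  nonneg : ∀ x, 0 ≤ p x
  integrable : Integrable p
  eq_withDensity : ν = volume.withDensity fun x => ENNReal.ofReal (p x)
  measurable_exponent : Measurable G
  le_exp : ∀ x, p x ≤ Real.exp (G x)
  integrable_exponent : Integrable G ν

lemma pi_withDensity_ofReal (n : ℕ) {p : ℝ → ℝ} (h0 : ∀ x, 0 ≤ p x)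
    (hi : Integrable p) :
    Measure.pi (fun _ : Fin n => volume.withDensity fun x => ENNReal.ofReal (p x)) =
      volume.withDensity fun x : Fin n → ℝ => ENNReal.ofReal (∏ i, p (x i)) := by
  have := isFiniteMeasure_withDensity_ofReal hi.2
  refine Measure.pi_eq fun s hs => ?_
  rw [withDensity_apply _ (MeasurableSet.univ_pi hs), volume_pi, Measure.restrict_pi_pi]
  have h1 : ∀ i : Fin n, Integrable p (volume.restrict (s i)) := fun i => hi.restrict
  rw [← ofReal_integral_eq_lintegral_ofReal (Integrable.fintype_prod (f := fun _ => p) h1)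
    (ae_of_all _ fun x => Finset.prod_nonneg fun i _ => h0 _),
    integral_fintype_prod_eq_prod (fun _ => p), ENNReal.ofReal_prod_of_nonneg fun i _ =>
      integral_nonneg h0]
  refine Finset.prod_congr rfl fun i _ => ?_
  rw [withDensity_apply _ (hs i), ofReal_integral_eq_lintegral_ofReal (h1 i) (ae_of_all _ h0)]

lemma ofReal_integral_le_lintegral {X : Type*} [MeasurableSpace X] {P : Measure X} {f : X → ℝ}
    (hf : Integrable f P) : ENNReal.ofReal (∫ x, f x ∂P) ≤ ∫⁻ x, ENNReal.ofReal (f x) ∂P := by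
  apply ENNReal.ofReal_le_of_le_toReal
  rw [integral_eq_lintegral_pos_part_sub_lintegral_neg_part hf]
  exact sub_le_self _ ENNReal.toReal_nonneg

/-- Jensen's inequality for the exponential function. -/
lemma ofReal_exp_integral_le {X : Type*} [MeasurableSpace X] {P : Measure X}
    [IsProbabilityMeasure P] {f : X → ℝ} (hf : Integrable f P) :
    ENNReal.ofReal (Real.exp (∫ x, f x ∂P)) ≤ ∫⁻ x, ENNReal.ofReal (Real.exp (f x)) ∂P := by
  obtain ⟨c, hc⟩ : ∃ c, c = ∫ x, f x ∂P := ⟨_, rfl⟩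
  -- The tangent line of the exponential at the mean `c`.
  have hg : Integrable (fun x => Real.exp c * (f x + (1 - c))) P :=
    (hf.add (integrable_const _)).const_mul _
  have hv : ∫ x, Real.exp c * (f x + (1 - c)) ∂P = Real.exp c := by
    rw [integral_const_mul, integral_add hf (integrable_const _), ← hc]
    simp
  rw [← hc]
  calc ENNReal.ofReal (Real.exp c) = ENNReal.ofReal (∫ x, Real.exp c * (f x + (1 - c)) ∂P) := by
        rw [hv]
    _ ≤ ∫⁻ x, ENNReal.ofReal (Real.exp c * (f x + (1 - c))) ∂P := ofReal_integral_le_lintegral hg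
    _ ≤ _ := by
        refine lintegral_mono fun x => ENNReal.ofReal_le_ofReal ?_
        have h1 : Real.exp (f x) = Real.exp c * Real.exp (f x - c) := by
          rw [← Real.exp_add]; congr 1; ring
        rw [h1]
        have := Real.add_one_le_exp (f x - c)
        exact mul_le_mul_of_nonneg_left (by linarith) (Real.exp_nonneg _)

lemma measurePreserving_eval_pair {n : ℕ} (ν : Measure ℝ) [IsProbabilityMeasure ν] {i j : Fin n}
    (hij : i ≠ j) : MeasurePreserving (fun x : Fin n → ℝ => (x i, x j))
      (Measure.pi fun _ : Fin n => ν) (ν.prod ν) := by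
  have h := (ProbabilityTheory.iIndepFun_pi (μ := fun _ : Fin n => ν) (X := fun _ t => t)
    fun _ => aemeasurable_id).indepFun hij
  refine ⟨by fun_prop, ?_⟩
  rw [h.map_prod_eq_prod_map_map (measurable_pi_apply i).aemeasurable
    (measurable_pi_apply j).aemeasurable]
  rw [(measurePreserving_eval (fun _ : Fin n => ν) i).map_eq,
    (measurePreserving_eval (fun _ : Fin n => ν) j).map_eq]

namespace IsLogRegular

variable {ν : Measure ℝ} {M : ℝ}

lemma integrable_log_self [IsProbabilityMeasure ν] (h : IsLogRegular ν M) : Integrable Real.log ν := by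
  have := h.integrable_log 0
  simpa using this

lemma integral_log_pair [IsProbabilityMeasure ν] (h : IsLogRegular ν M) {n : ℕ} (i j : Fin n) :
    Integrable (fun x : Fin n → ℝ => Real.log (x i - x j)) (Measure.pi fun _ => ν) ∧
      ∫ x : Fin n → ℝ, Real.log (x i - x j) ∂(Measure.pi fun _ => ν) =
        (∫ x, logPotential ν x ∂ν) - if i = j then ∫ x, logPotential ν x ∂ν else 0 := by
  split_ifs with hij
  · subst hij
    simp
  · have hp := measurePreserving_eval_pair ν hij
    have hi := h.integrable_log_prod h.integrable_sq
    refine ⟨hp.integrable_comp_of_integrable hi, ?_⟩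
    rw [sub_zero, ← h.integral_log_prod h.integrable_sq, ← hp.map_eq,
      integral_map hp.aemeasurable (by rw [hp.map_eq]; exact hi.aestronglyMeasurable)]

/-- Distinct coordinates are independent with law `ν`, so each of the `n² - n` ordered pairs
contributes `∫ U dν`, and the diagonal contributes nothing. -/
lemma integral_hamiltonian [IsProbabilityMeasure ν] (h : IsLogRegular ν M) (m : ℝ) (n : ℕ) :
    Integrable (hamiltonian m n) (Measure.pi fun _ => ν) ∧
      ∫ x, hamiltonian m n x ∂(Measure.pi fun _ => ν) =
        (n : ℝ) ^ 2 * ∫ x, x ^ 2 ∂ν - 2 * m * n * ∫ x, Real.log x ∂ν -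
          ((n : ℝ) ^ 2 - n) * ∫ x, logPotential ν x ∂ν := by
  have i1 : ∀ i : Fin n, Integrable (fun x : Fin n → ℝ => x i ^ 2) (Measure.pi fun _ => ν) :=
    fun i => integrable_comp_eval (μ := fun _ : Fin n => ν) (f := fun t : ℝ => t ^ 2) h.integrable_sq
  have i2 : ∀ i : Fin n, Integrable (fun x : Fin n → ℝ => Real.log (x i)) (Measure.pi fun _ => ν) :=
    fun i => integrable_comp_eval (μ := fun _ : Fin n => ν) h.integrable_log_self
  have v1 : ∀ i : Fin n, ∫ x : Fin n → ℝ, x i ^ 2 ∂(Measure.pi fun _ => ν) = ∫ x, x ^ 2 ∂ν :=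
    fun i => integral_comp_eval (μ := fun _ : Fin n => ν) (f := fun t : ℝ => t ^ 2)
      h.integrable_sq.aestronglyMeasurable
  have v2 : ∀ i : Fin n, ∫ x : Fin n → ℝ, Real.log (x i) ∂(Measure.pi fun _ => ν) =
      ∫ x, Real.log x ∂ν :=
    fun i => integral_comp_eval (μ := fun _ : Fin n => ν) h.integrable_log_self.aestronglyMeasurable
  have s1 : Integrable (fun x : Fin n → ℝ => (n : ℝ) * ∑ i, x i ^ 2) (Measure.pi fun _ => ν) :=
    (integrable_finsetSum _ fun i _ => i1 i).const_mul _
  have s2 : Integrable (fun x : Fin n → ℝ => 2 * m * ∑ i, Real.log (x i))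
      (Measure.pi fun _ => ν) := (integrable_finsetSum _ fun i _ => i2 i).const_mul _
  have s3' : ∀ i : Fin n, Integrable (fun x : Fin n → ℝ => ∑ j, Real.log (x i - x j))
      (Measure.pi fun _ => ν) :=
    fun i => integrable_finsetSum _ fun j _ => (h.integral_log_pair i j).1
  have s3 : Integrable (fun x : Fin n → ℝ => ∑ i, ∑ j, Real.log (x i - x j))
      (Measure.pi fun _ => ν) := integrable_finsetSum _ fun i _ => s3' i
  have s12 : Integrable (fun x : Fin n → ℝ => (n : ℝ) * ∑ i, x i ^ 2 -
    2 * m * ∑ i, Real.log (x i)) (Measure.pi fun _ => ν) := s1.sub s2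
  refine ⟨s12.sub s3, ?_⟩
  unfold hamiltonian
  rw [integral_sub s12 s3, integral_sub s1 s2, integral_const_mul, integral_const_mul,
    integral_finsetSum _ fun i _ => i1 i, integral_finsetSum _ fun i _ => i2 i,
    integral_finsetSum _ fun i _ => s3' i]
  rw [Finset.sum_congr rfl fun i _ => v1 i, Finset.sum_congr rfl fun i _ => v2 i]
  have e : ∀ i : Fin n, ∫ x : Fin n → ℝ, ∑ j, Real.log (x i - x j) ∂(Measure.pi fun _ => ν) =
      n * (∫ x, logPotential ν x ∂ν) - ∫ x, logPotential ν x ∂ν := by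
    intro i
    rw [integral_finsetSum _ fun j _ => (h.integral_log_pair i j).1,
      Finset.sum_congr rfl fun j _ => (h.integral_log_pair i j).2, Finset.sum_sub_distrib]
    simp
  rw [Finset.sum_congr rfl fun i _ => e i]
  simp only [Finset.sum_const, Finset.card_univ, Fintype.card_fin, nsmul_eq_mul]
  ring

lemma ae_pi_injective [IsProbabilityMeasure ν] (h : IsLogRegular ν M) (n : ℕ) :
    ∀ᵐ x : Fin n → ℝ ∂(Measure.pi fun _ => ν), Function.Injective x ∧ ∀ i, x i ≠ 0 := by
  have h1 : ∀ᵐ x : Fin n → ℝ ∂(Measure.pi fun _ => ν), ∀ i j, i ≠ j → x i - x j ≠ 0 := by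
    refine ae_all_iff.2 fun i => ae_all_iff.2 fun j => ?_
    by_cases hij : i = j
    · exact ae_of_all _ fun x hne => absurd hij hne
    · filter_upwards [(measurePreserving_eval_pair ν hij).quasiMeasurePreserving.ae h.ae_prod_ne]
        with x hx _ using hx
  have h2 : ∀ᵐ x : Fin n → ℝ ∂(Measure.pi fun _ => ν), ∀ i, x i ≠ 0 := by
    refine ae_all_iff.2 fun i => ?_
    refine (Measure.quasiMeasurePreserving_eval (fun _ : Fin n => ν) i).ae (p := fun t => t ≠ 0) ?_
    exact measure_eq_zero_iff_ae_notMem.1 (h.singleton 0)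
  filter_upwards [h1, h2] with x hx hx0
  refine ⟨fun i j hij => ?_, hx0⟩
  by_contra hne
  exact hx i j hne (sub_eq_zero.2 hij)

end IsLogRegular

lemma measurableSet_forall_le (n : ℕ) (σ : ℝ) : MeasurableSet {x : Fin n → ℝ | ∀ i, σ ≤ x i} := by
  have : {x : Fin n → ℝ | ∀ i, σ ≤ x i} = Set.univ.pi fun _ => Set.Ici σ := by
    ext x; simp [Pi.le_def]
  rw [this]
  exact MeasurableSet.univ_pi fun _ => measurableSet_Ici

namespace IsExtremal

variable {α σ ℓ M : ℝ} {ν : Measure ℝ}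

/-- Lower bound of the partition function. -/
lemma exists_le_lintegral_gibbsWeight [IsProbabilityMeasure ν] (h : IsExtremal α σ ν ℓ M)
    {p G : ℝ → ℝ} (hp : HasDominatedDensity ν p G) {β : ℝ} (hβ : 0 < β) :
    ∃ K : ℝ, ∀ (m : ℝ) (n : ℕ), 0 < n →
      ENNReal.ofReal (Real.exp (-(β / 2) * ((n : ℝ) ^ 2 * (minEnergy ν ℓ + K * |m / n - α|)) -
        K * n)) ≤ ∫⁻ x in {x : Fin n → ℝ | ∀ i, σ ≤ x i}, ENNReal.ofReal (gibbsWeight β m n x) := by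
  obtain ⟨Λ, hΛ⟩ : ∃ Λ, Λ = ∫ x, Real.log x ∂ν := ⟨_, rfl⟩
  obtain ⟨u, hu⟩ : ∃ u, u = ∫ x, logPotential ν x ∂ν := ⟨_, rfl⟩
  obtain ⟨γ, hγ⟩ : ∃ γ, γ = ∫ x, G x ∂ν := ⟨_, rfl⟩
  refine ⟨2 * |Λ| + |β / 2 * u + γ|, fun m n hn => ?_⟩
  have hn' : (0 : ℝ) < n := by exact_mod_cast hn
  obtain ⟨K, hK⟩ : ∃ K, K = 2 * |Λ| + |β / 2 * u + γ| := ⟨_, rfl⟩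
  obtain ⟨i1, v1⟩ := h.regular.integral_hamiltonian m n
  have hsq : ∫ x, x ^ 2 ∂ν = ℓ + 2 * u + 2 * α * Λ := by
    have hv := h.integrable_realField.2
    unfold realField at hv
    rw [integral_sub h.regular.integrable_sq (h.regular.integrable_log_self.const_mul _),
      integral_const_mul, ← hΛ, ← hu] at hv
    linarith
  have i2' : ∀ i : Fin n, Integrable (fun x : Fin n → ℝ => G (x i)) (Measure.pi fun _ => ν) :=
    fun i => integrable_comp_eval (μ := fun _ : Fin n => ν) hp.integrable_exponent
  have i2 : Integrable (fun x : Fin n → ℝ => ∑ i, G (x i)) (Measure.pi fun _ => ν) :=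
    integrable_finsetSum _ fun i _ => i2' i
  have v2 : ∫ x : Fin n → ℝ, ∑ i, G (x i) ∂(Measure.pi fun _ => ν) = n * γ := by
    rw [integral_finsetSum _ fun i _ => i2' i, Finset.sum_congr rfl fun i _ =>
      integral_comp_eval (μ := fun _ : Fin n => ν) hp.integrable_exponent.aestronglyMeasurable]
    simp [hγ]
  have i1' : Integrable (fun x => -(β / 2) * hamiltonian m n x) (Measure.pi fun _ => ν) :=
    i1.const_mul _
  -- Jensen's inequality under `ν^n`. The sum of the `G (x i)` stands in for the logarithm of the
  -- product density; as `p ≤ exp G`, no lower bound on `p` is needed. It contributes only order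
  -- `n`.
  have hJ := ofReal_exp_integral_le (i1'.sub i2)
  have hval : ∫ x, ((fun x => -(β / 2) * hamiltonian m n x) - fun x : Fin n → ℝ => ∑ i, G (x i)) x
      ∂(Measure.pi fun _ => ν) = -(β / 2) * ((n : ℝ) ^ 2 * (minEnergy ν ℓ -
        2 * (m / n - α) * Λ)) - (β / 2 * u + γ) * n := by
    simp only [Pi.sub_apply]
    rw [integral_sub i1' i2, integral_const_mul, v1, v2, hsq, ← hΛ, ← hu]
    unfold minEnergy
    rw [← hu]
    field_simp
    ring
  rw [hval] at hJ
  refine le_trans (ENNReal.ofReal_le_ofReal (Real.exp_le_exp.2 ?_)) (hJ.trans ?_)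
  · have a1 : 2 * (m / n - α) * Λ ≥ -(K * |m / n - α|) := by
      have e1 := neg_abs_le ((m / n - α) * Λ)
      rw [abs_mul] at e1
      have e2 : 2 * |Λ| * |m / n - α| ≤ K * |m / n - α| := by
        rw [hK]; gcongr; linarith [abs_nonneg (β / 2 * u + γ)]
      linarith
    have a2 : (β / 2 * u + γ) * n ≤ K * n := by
      have := le_abs_self (β / 2 * u + γ)
      have := abs_nonneg Λ
      exact mul_le_mul_of_nonneg_right (by linarith) hn'.le
    rw [← hK]
    have a3 : -(β / 2) * ((n : ℝ) ^ 2 * (minEnergy ν ℓ + K * |m / n - α|)) ≤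
        -(β / 2) * ((n : ℝ) ^ 2 * (minEnergy ν ℓ - 2 * (m / n - α) * Λ)) := by
      apply mul_le_mul_of_nonpos_left _ (by linarith)
      apply mul_le_mul_of_nonneg_left _ (sq_nonneg _)
      linarith
    linarith
  · have hS := measurableSet_forall_le n σ
    have hae : ∀ᵐ x : Fin n → ℝ ∂(Measure.pi fun _ => ν),
        ENNReal.ofReal (Real.exp (((fun x => -(β / 2) * hamiltonian m n x) -
          fun x : Fin n → ℝ => ∑ i, G (x i)) x)) ≤
        {x : Fin n → ℝ | ∀ i, σ ≤ x i}.indicator (fun x => ENNReal.ofReal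
          (gibbsWeight β m n x * Real.exp (-∑ i, G (x i)))) x := by
      have hσ : ∀ᵐ x : Fin n → ℝ ∂(Measure.pi fun _ => ν), ∀ i, σ ≤ x i :=
        ae_all_iff.2 fun i => (Measure.quasiMeasurePreserving_eval (fun _ : Fin n => ν) i).ae
          (p := fun t => σ ≤ t) (h.mem.mono fun x hx => hx.1)
      filter_upwards [hσ, h.regular.ae_pi_injective n] with x hx hinj
      rw [Set.indicator_of_mem (show x ∈ {x : Fin n → ℝ | ∀ i, σ ≤ x i} from hx),
        gibbsWeight_eq_exp hinj.1 (Or.inr hinj.2), ← Real.exp_add]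
      simp only [Pi.sub_apply, sub_eq_add_neg]
      exact le_rfl
    refine (lintegral_mono_ae hae).trans ?_
    have hGm : Measurable fun x : Fin n → ℝ => ∑ i, G (x i) :=
      Finset.measurable_fun_sum _ fun i _ => hp.measurable_exponent.comp (measurable_pi_apply i)
    have hpm : Measurable fun x : Fin n → ℝ => ∏ i, p (x i) :=
      Finset.measurable_fun_prod _ fun i _ => hp.measurable.comp (measurable_pi_apply i)
    have hfm : Measurable fun x : Fin n → ℝ => ENNReal.ofReal
        (gibbsWeight β m n x * Real.exp (-∑ i, G (x i))) :=
      ((measurable_gibbsWeight β m n).mul hGm.neg.exp).ennreal_ofReal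
    have hpi : (Measure.pi fun _ : Fin n => ν) =
        volume.withDensity fun x : Fin n → ℝ => ENNReal.ofReal (∏ i, p (x i)) := by
      rw [← pi_withDensity_ofReal n hp.nonneg hp.integrable, ← hp.eq_withDensity]
    rw [hpi, lintegral_withDensity_eq_lintegral_mul _ hpm.ennreal_ofReal (hfm.indicator hS),
      ← lintegral_indicator hS]
    refine lintegral_mono fun x => ?_
    simp only [Pi.mul_apply, Set.indicator_apply]
    split_ifs
    · rw [← ENNReal.ofReal_mul (Finset.prod_nonneg fun i _ => hp.nonneg _)]
      apply ENNReal.ofReal_le_ofReal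
      have e1 : ∏ i, p (x i) ≤ Real.exp (∑ i, G (x i)) := by
        rw [Real.exp_sum]
        exact Finset.prod_le_prod (fun i _ => hp.nonneg _) fun i _ => hp.le_exp _
      have e2 : Real.exp (∑ i, G (x i)) * Real.exp (-∑ i, G (x i)) = 1 := by
        rw [← Real.exp_add, add_neg_cancel, Real.exp_zero]
      calc (∏ i, p (x i)) * (gibbsWeight β m n x * Real.exp (-∑ i, G (x i)))
          ≤ Real.exp (∑ i, G (x i)) * (gibbsWeight β m n x * Real.exp (-∑ i, G (x i))) :=
            mul_le_mul_of_nonneg_right e1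
              (mul_nonneg (gibbsWeight_nonneg β m n x) (Real.exp_nonneg _))
        _ = gibbsWeight β m n x * (Real.exp (∑ i, G (x i)) * Real.exp (-∑ i, G (x i))) := by ring
        _ = gibbsWeight β m n x := by rw [e2, mul_one]
    · simp

end IsExtremal

/-! ### Convergence of the empirical measures -/

/-- Homogeneity and the Jacobian of the scaling produce one factor `k`, the same for all sets, which
cancels in the conditional law. -/
lemma exists_setLIntegral_eigenvalueWeight (β m : ℝ) {n : ℕ} (hn : 0 < n) :
    ∃ k : ENNReal, k ≠ 0 ∧ k ≠ ⊤ ∧ ∀ B : Set (Fin n → ℝ), MeasurableSet B →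
      ∫⁻ y in {y | (√(n : ℝ))⁻¹ • y ∈ B}, ENNReal.ofReal (eigenvalueWeight β m n y) =
        k * ∫⁻ x in B, ENNReal.ofReal (gibbsWeight β m n x) := by
  obtain ⟨κ, hκ, hw⟩ := exists_eigenvalueWeight_smul β m n hn
  have hs : 0 < √(n : ℝ) := Real.sqrt_pos.2 (by exact_mod_cast hn)
  obtain ⟨s, hsd⟩ : ∃ s, s = √(n : ℝ) := ⟨_, rfl⟩
  rw [← hsd] at hs ⊢
  simp only [← hsd] at hw
  have hmap := Measure.map_addHaar_smul (volume : Measure (Fin n → ℝ)) hs.ne'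
  obtain ⟨c, hc⟩ : ∃ c, c = ENNReal.ofReal |(s ^ Module.finrank ℝ (Fin n → ℝ))⁻¹| := ⟨_, rfl⟩
  rw [← hc] at hmap
  have hc0 : c ≠ 0 := by
    rw [hc]
    exact (ENNReal.ofReal_pos.2 (abs_pos.2 (inv_ne_zero (pow_ne_zero _ hs.ne')))).ne'
  have hct : c ≠ ⊤ := by rw [hc]; exact ENNReal.ofReal_ne_top
  refine ⟨c⁻¹ * ENNReal.ofReal κ, mul_ne_zero (ENNReal.inv_ne_zero.2 hct)
    (ENNReal.ofReal_pos.2 hκ).ne', ENNReal.mul_ne_top (ENNReal.inv_ne_top.2 hc0)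
    ENNReal.ofReal_ne_top, fun B hB => ?_⟩
  have hB' : MeasurableSet {y : Fin n → ℝ | s⁻¹ • y ∈ B} :=
    (by fun_prop : Measurable fun y : Fin n → ℝ => s⁻¹ • y) hB
  have hwm : Measurable fun y => ENNReal.ofReal (eigenvalueWeight β m n y) :=
    (measurable_eigenvalueWeight β m n).ennreal_ofReal
  have h1 : ∫⁻ y, {y | s⁻¹ • y ∈ B}.indicator
      (fun y => ENNReal.ofReal (eigenvalueWeight β m n y)) y ∂(Measure.map (s • ·) volume) =
      ENNReal.ofReal κ * ∫⁻ x in B, ENNReal.ofReal (gibbsWeight β m n x) := by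
    rw [lintegral_map (hwm.indicator hB') (by fun_prop), ← lintegral_indicator hB,
      ← lintegral_const_mul' _ _ ENNReal.ofReal_ne_top]
    refine lintegral_congr fun x => ?_
    by_cases hx : x ∈ B
    · have hx' : s • x ∈ {y : Fin n → ℝ | s⁻¹ • y ∈ B} := by
        simpa [inv_smul_smul₀ hs.ne'] using hx
      rw [Set.indicator_of_mem hx, Set.indicator_of_mem hx', hw, ENNReal.ofReal_mul hκ.le]
    · have hx' : s • x ∉ {y : Fin n → ℝ | s⁻¹ • y ∈ B} := by
        simpa [inv_smul_smul₀ hs.ne'] using hx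
      rw [Set.indicator_of_notMem hx, Set.indicator_of_notMem hx', mul_zero]
  rw [hmap, lintegral_smul_measure, lintegral_indicator hB', smul_eq_mul] at h1
  rw [mul_assoc, ← h1, ← mul_assoc, ENNReal.inv_mul_cancel hc0 hct, one_mul]

/-- The restricted law of the rescaled eigenvalues. -/
lemma restrictedLaw_preimage_smul {β m σ : ℝ} {n : ℕ} (hn : 0 < n)
    (hfin : ∫⁻ x, ENNReal.ofReal (gibbsWeight β m n x) < ⊤)
    (hpos : ∫⁻ x in {x : Fin n → ℝ | ∀ i, σ ≤ x i}, ENNReal.ofReal (gibbsWeight β m n x) ≠ 0)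
    {B : Set (Fin n → ℝ)} (hB : MeasurableSet B) :
    restrictedLaw β m (σ * √(n : ℝ)) n {y | (√(n : ℝ))⁻¹ • y ∈ B} =
      (∫⁻ x in {x : Fin n → ℝ | ∀ i, σ ≤ x i}, ENNReal.ofReal (gibbsWeight β m n x))⁻¹ *
        ∫⁻ x in {x : Fin n → ℝ | ∀ i, σ ≤ x i} ∩ B, ENNReal.ofReal (gibbsWeight β m n x) := by
  obtain ⟨k, hk0, hkt, hk⟩ := exists_setLIntegral_eigenvalueWeight β m hn
  have hs : 0 < √(n : ℝ) := Real.sqrt_pos.2 (by exact_mod_cast hn)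
  have hS := measurableSet_forall_le n σ
  have hset : {y : Fin n → ℝ | ∀ i, σ * √(n : ℝ) ≤ y i} =
      {y | (√(n : ℝ))⁻¹ • y ∈ {x : Fin n → ℝ | ∀ i, σ ≤ x i}} := by
    ext y
    simp only [Set.mem_ofPred_eq, Pi.smul_apply, smul_eq_mul]
    refine forall_congr' fun i => ?_
    rw [inv_mul_eq_div, le_div_iff₀ hs]
  have hm : Measurable fun y : Fin n → ℝ => (√(n : ℝ))⁻¹ • y := by fun_prop
  obtain ⟨Z, hZ⟩ : ∃ Z, Z = ∫⁻ x : Fin n → ℝ, ENNReal.ofReal (eigenvalueWeight β m n x) :=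
    ⟨_, rfl⟩
  have hZk : Z = k * ∫⁻ x, ENNReal.ofReal (gibbsWeight β m n x) := by
    have := hk Set.univ MeasurableSet.univ
    simpa [← hZ] using this
  have hZ0 : Z ≠ 0 := by
    rw [hZk]
    refine mul_ne_zero hk0 fun h0 => hpos ?_
    exact le_antisymm ((setLIntegral_le_lintegral _ _).trans h0.le) bot_le
  have hZt : Z ≠ ⊤ := by
    rw [hZk]
    exact ENNReal.mul_ne_top hkt hfin.ne
  have hlaw : ∀ A : Set (Fin n → ℝ), MeasurableSet A →
      eigenvalueLaw β m n {y | (√(n : ℝ))⁻¹ • y ∈ A} =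
        (Z⁻¹ * k) * ∫⁻ x in A, ENNReal.ofReal (gibbsWeight β m n x) := by
    intro A hA
    have hA' : MeasurableSet {y : Fin n → ℝ | (√(n : ℝ))⁻¹ • y ∈ A} := hm hA
    rw [eigenvalueLaw, Measure.smul_apply, withDensity_apply _ hA', hk A hA, ← hZ, smul_eq_mul,
      mul_assoc]
  have hSm : MeasurableSet {y : Fin n → ℝ | (√(n : ℝ))⁻¹ • y ∈ {x : Fin n → ℝ | ∀ i, σ ≤ x i}} :=
    hm hS
  have hinter : {y : Fin n → ℝ | (√(n : ℝ))⁻¹ • y ∈ {x : Fin n → ℝ | ∀ i, σ ≤ x i}} ∩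
      {y | (√(n : ℝ))⁻¹ • y ∈ B} =
      {y | (√(n : ℝ))⁻¹ • y ∈ {x : Fin n → ℝ | ∀ i, σ ≤ x i} ∩ B} := rfl
  have hc0 : Z⁻¹ * k ≠ 0 := mul_ne_zero (ENNReal.inv_ne_zero.2 hZt) hk0
  have hct : Z⁻¹ * k ≠ ⊤ := ENNReal.mul_ne_top (ENNReal.inv_ne_top.2 hZ0) hkt
  rw [restrictedLaw, hset, ProbabilityTheory.cond_apply hSm, hinter, hlaw _ hS,
    hlaw _ (hS.inter hB), ENNReal.mul_inv (Or.inl hc0) (Or.inl hct)]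
  rw [mul_mul_mul_comm, ENNReal.inv_mul_cancel hc0 hct, one_mul]

lemma isProbabilityMeasure_restrictedLaw {β m σ : ℝ} {n : ℕ} (hn : 0 < n)
    (hfin : ∫⁻ x, ENNReal.ofReal (gibbsWeight β m n x) < ⊤)
    (hpos : ∫⁻ x in {x : Fin n → ℝ | ∀ i, σ ≤ x i}, ENNReal.ofReal (gibbsWeight β m n x) ≠ 0) :
    IsProbabilityMeasure (restrictedLaw β m (σ * √(n : ℝ)) n) := by
  constructor
  have h := restrictedLaw_preimage_smul hn hfin hpos MeasurableSet.univ
  rw [Set.inter_univ, ENNReal.inv_mul_cancel hpos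
    ((setLIntegral_le_lintegral _ _).trans_lt hfin).ne] at h
  simpa using h

lemma integral_meanEmpirical {β m s : ℝ} {n : ℕ} [IsProbabilityMeasure (restrictedLaw β m s n)]
    (f : BoundedContinuousFunction ℝ ℝ) :
    ∫ x, f (x / √(n : ℝ)) ∂(meanEmpirical β m s n) =
      ∫ y, (∫ t, f t ∂(empirical n ((√(n : ℝ))⁻¹ • y))) ∂(restrictedLaw β m s n) := by
  have hfm : Measurable fun x : ℝ => f (x / √(n : ℝ)) := by
    have := f.continuous.measurable
    fun_prop
  have hi : ∀ i : Fin n, Integrable (fun y : Fin n → ℝ => f (y i / √(n : ℝ)))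
      (restrictedLaw β m s n) := fun i =>
    Integrable.of_bound (hfm.comp (measurable_pi_apply i)).aestronglyMeasurable ‖f‖
      (ae_of_all _ fun y => f.norm_coe_le_norm _)
  have hi' : ∀ i : Fin n, Integrable (fun x : ℝ => f (x / √(n : ℝ)))
      ((restrictedLaw β m s n).map fun x => x i) := fun i =>
    (integrable_map_measure hfm.aestronglyMeasurable (measurable_pi_apply i).aemeasurable).2 (hi i)
  unfold meanEmpirical
  rw [integral_smul_measure, integral_finsetSum_measure fun i _ => hi' i]
  simp only [integral_empirical]
  rw [integral_const_mul]
  simp only [Pi.smul_apply, smul_eq_mul, inv_mul_eq_div]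
  rw [integral_finsetSum _ fun i _ => hi i, ENNReal.toReal_inv, ENNReal.toReal_natCast]
  rw [div_eq_inv_mul]
  congr 1
  refine Finset.sum_congr rfl fun i _ => ?_
  rw [integral_map (measurable_pi_apply i).aemeasurable hfm.aestronglyMeasurable]

lemma abs_integral_sub_le {X : Type*} [MeasurableSpace X] {P : Measure X} [IsProbabilityMeasure P]
    {F : X → ℝ} (hF : Measurable F) {c ε C : ℝ} (hε : 0 ≤ ε) (hC : ∀ x, |F x - c| ≤ C) :
    |∫ x, F x ∂P - c| ≤ ε + C * (P {x | ε ≤ |F x - c|}).toReal := by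
  have hA : MeasurableSet {x | ε ≤ |F x - c|} :=
    measurableSet_le measurable_const ((hF.sub_const c).norm)
  have hi : Integrable (fun x => F x - c) P :=
    Integrable.of_bound (hF.sub_const c).aestronglyMeasurable C (ae_of_all _ hC)
  have hFi : Integrable F P := by
    exact (hi.add (integrable_const c)).congr (ae_of_all _ fun x => by simp)
  have h1 : ∫ x, F x ∂P - c = ∫ x, (F x - c) ∂P := by
    rw [integral_sub hFi (integrable_const c)]; simp
  have hind : Integrable ({x | ε ≤ |F x - c|}.indicator fun _ => C) P :=
    (integrable_const C).indicator hA
  rw [h1]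
  calc |∫ x, (F x - c) ∂P| ≤ ∫ x, |F x - c| ∂P := abs_integral_le_integral_abs
    _ ≤ ∫ x, (ε + {x | ε ≤ |F x - c|}.indicator (fun _ => C) x) ∂P := by
        refine integral_mono hi.abs ((integrable_const ε).add hind) fun x => ?_
        simp only [Set.indicator_apply, Set.mem_ofPred_eq]
        split_ifs with h
        · linarith [hC x]
        · linarith [not_le.1 h]
    _ = _ := by
        rw [integral_add (integrable_const ε) hind, integral_indicator_const C hA]
        simp [Measure.real, mul_comm]

lemma eventually_charge {α : ℝ} {m : ℕ → ℝ}
    (hlim : Tendsto (fun n : ℕ => m n / (n : ℝ)) atTop (𝓝 α)) :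
    ∀ᶠ n : ℕ in atTop, 0 < n ∧ m n / n ≤ α + 1 ∧ (0 < α → 0 < m n) := by
  filter_upwards [eventually_gt_atTop 0, hlim.eventually (ge_mem_nhds (by linarith : α < α + 1)),
    hlim.eventually (eventually_gt_nhds (b := α - if 0 < α then α else 1) (by
      split_ifs <;> linarith))] with n hn h1 h2
  refine ⟨hn, h1, fun hα => ?_⟩
  rw [if_pos hα, sub_self] at h2
  have hn' : (0 : ℝ) < n := by exact_mod_cast hn
  exact (div_pos_iff_of_pos_right hn').1 h2

namespace IsExtremal

variable {α σ ℓ M : ℝ} {ν : Measure ℝ}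

/-- The restricted laws are eventually probability measures. -/
lemma eventually_partition [IsProbabilityMeasure ν] (h : IsExtremal α σ ν ℓ M)
    {p G : ℝ → ℝ} (hp : HasDominatedDensity ν p G) {β : ℝ} (hβ : 0 < β) {m : ℕ → ℝ}
    (hm : ∀ n, 0 ≤ m n) (hlim : Tendsto (fun n : ℕ => m n / (n : ℝ)) atTop (𝓝 α)) :
    ∀ᶠ n : ℕ in atTop, 0 < n ∧ ∫⁻ x, ENNReal.ofReal (gibbsWeight β (m n) n x) < ⊤ ∧
      ∫⁻ x in {x : Fin n → ℝ | ∀ i, σ ≤ x i}, ENNReal.ofReal (gibbsWeight β (m n) n x) ≠ 0 := by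
  obtain ⟨K, D, -, hup⟩ := h.exists_lintegral_gibbsWeight_le hβ
  obtain ⟨L, hlow⟩ := h.exists_le_lintegral_gibbsWeight hp hβ
  filter_upwards [eventually_charge hlim] with n hn
  refine ⟨hn.1, (hup (m n) n hn.1 (hm n) hn.2.1).1, fun h0 => ?_⟩
  have := hlow (m n) n hn.1
  rw [h0, nonpos_iff_eq_zero, ENNReal.ofReal_eq_zero] at this
  exact absurd this (not_le.2 (Real.exp_pos _))

/-- The empirical measures concentrate at the extremal measure. -/
lemma tendsto_restrictedLaw_far [IsProbabilityMeasure ν] (h : IsExtremal α σ ν ℓ M)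
    {p G : ℝ → ℝ} (hp : HasDominatedDensity ν p G) {β : ℝ} (hβ : 0 < β) {m : ℕ → ℝ}
    (hm : ∀ n, 0 ≤ m n) (hlim : Tendsto (fun n : ℕ => m n / (n : ℝ)) atTop (𝓝 α))
    {f : ℝ → ℝ} (hf : Continuous f) (hfc : HasCompactSupport f) {ε : ℝ} (hε : 0 < ε) :
    Tendsto (fun n : ℕ => restrictedLaw β (m n) (σ * √(n : ℝ)) n
      {y | ε ≤ |∫ t, f t ∂(empirical n ((√(n : ℝ))⁻¹ • y)) - ∫ t, f t ∂ν|}) atTop (𝓝 0) := by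
  obtain ⟨K, D, hD, hup⟩ := h.exists_lintegral_gibbsWeight_le hβ
  obtain ⟨L, hlow⟩ := h.exists_le_lintegral_gibbsWeight hp hβ
  obtain ⟨T₁, c, hc, hreg⟩ := exists_le_regDist hf hfc hε
  have hN : Tendsto (fun n : ℕ => (n : ℝ)) atTop atTop := tendsto_natCast_atTop_atTop
  -- The truncation level is `T = √n`: it tends to infinity, while the self-interaction error `T /
  -- (2n)` tends to zero.
  have hT : Tendsto (fun n : ℕ => √(n : ℝ)) atTop atTop := Real.tendsto_sqrt_atTop.comp hN
  -- The exponential rate in the quotient of the two partition bounds: the minimal energies cancel,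
  -- and the factors of order `e^{O(n)}` become `O(1/n)`.
  obtain ⟨r, hr⟩ : ∃ r : ℕ → ℝ, r = fun n : ℕ => β / 2 * (c - (IsLogRegular.truncError M (√(n : ℝ)) +
    1 / √(n : ℝ) + √(n : ℝ) / (2 * n) + K * |m n / n - α|) - L * |m n / n - α|) -
      (Real.log D + L) * (1 / n) := ⟨_, rfl⟩
  have hrlim : Tendsto r atTop (𝓝 (β / 2 * c)) := by
    have a1 := (IsLogRegular.tendsto_truncError M).comp hT
    have a2 : Tendsto (fun n : ℕ => 1 / √(n : ℝ)) atTop (𝓝 0) := by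
      simp only [one_div]
      exact tendsto_inv_atTop_zero.comp hT
    have a3 : Tendsto (fun n : ℕ => √(n : ℝ) / (2 * n)) atTop (𝓝 0) := by
      have := a2.const_mul (1 / 2)
      rw [mul_zero] at this
      refine this.congr fun n => ?_
      rcases Nat.eq_zero_or_pos n with rfl | hn
      · simp
      · have hn' : (0 : ℝ) < n := by exact_mod_cast hn
        have hs := Real.sqrt_pos.2 hn'
        have := Real.sq_sqrt hn'.le
        field_simp
        nlinarith
    have a4 : Tendsto (fun n : ℕ => |m n / n - α|) atTop (𝓝 0) := by
      have := (hlim.sub_const α).abs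
      simpa using this
    have a5 : Tendsto (fun n : ℕ => 1 / (n : ℝ)) atTop (𝓝 0) := tendsto_one_div_atTop_nhds_zero_nat
    have := (((tendsto_const_nhds (x := c)).sub (((a1.add a2).add a3).add (a4.const_mul K))).sub
      (a4.const_mul L)).const_mul (β / 2) |>.sub (a5.const_mul (Real.log D + L))
    simp only [mul_zero, add_zero, sub_zero] at this
    rw [hr]
    exact this
  have hexp : Tendsto (fun n : ℕ => ENNReal.ofReal (Real.exp (-((n : ℝ) ^ 2 * r n)))) atTop (𝓝 0) := by
    have h1 : Tendsto (fun n : ℕ => (n : ℝ) ^ 2 * r n) atTop atTop :=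
      ((tendsto_pow_atTop two_ne_zero).comp hN).atTop_mul_pos (by positivity) hrlim
    have h2 := ENNReal.tendsto_ofReal (Real.tendsto_exp_neg_atTop_nhds_zero.comp h1)
    rw [ENNReal.ofReal_zero] at h2
    exact h2
  refine tendsto_of_tendsto_of_tendsto_of_le_of_le' tendsto_const_nhds hexp
    (Eventually.of_forall fun _ => bot_le) ?_
  filter_upwards [h.eventually_partition hp hβ hm hlim, eventually_charge hlim,
    hT.eventually_ge_atTop T₁] with n hpart hcharge hTn
  obtain ⟨hn, hfin, hpos⟩ := hpart
  have hn' : (0 : ℝ) < n := by exact_mod_cast hn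
  have hs : 0 < √(n : ℝ) := Real.sqrt_pos.2 hn'
  have hBm : MeasurableSet {x : Fin n → ℝ | ε ≤ |∫ t, f t ∂(empirical n x) - ∫ t, f t ∂ν|} := by
    simp only [integral_empirical]
    have hfm := hf.measurable
    have hsum : Measurable fun x : Fin n → ℝ => ∑ i, f (x i) :=
      Finset.measurable_fun_sum _ fun i _ => hfm.comp (measurable_pi_apply i)
    exact measurableSet_le measurable_const ((hsum.const_mul _).sub_const _).norm
  have hlaw := restrictedLaw_preimage_smul (σ := σ) hn hfin hpos hBm
  have hu := (hup (m n) n hn (hm n) hcharge.2.1).2 (√(n : ℝ)) c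
    ({x : Fin n → ℝ | ∀ i, σ ≤ x i} ∩
      {x : Fin n → ℝ | ε ≤ |∫ t, f t ∂(empirical n x) - ∫ t, f t ∂ν|}) hs hcharge.2.2
    ((measurableSet_forall_le n σ).inter hBm) (fun x hx => ⟨hx.1, by
      exact hreg (empirical n x) ν (isProbabilityMeasure_empirical hn x) inferInstance
        (integrable_empirical hn x _) h.regular.integrable_sq hx.2 _ hTn⟩)
  have hl := hlow (m n) n hn
  refine hlaw.le.trans ((mul_le_mul' (ENNReal.inv_le_inv.2 hl) hu).trans ?_)
  rw [← ENNReal.ofReal_inv_of_pos (Real.exp_pos _), ← ENNReal.ofReal_mul (by positivity),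
    ← Real.exp_neg]
  apply ENNReal.ofReal_le_ofReal
  have hDn : D ^ n = Real.exp (n * Real.log D) := by
    rw [Real.exp_nat_mul, Real.exp_log hD]
  rw [hDn, ← Real.exp_add, ← Real.exp_add]
  apply Real.exp_le_exp.2
  apply le_of_eq
  rw [hr]
  field_simp
  ring

/-- Off the far set the error is below `ε / 2`; on it the error is at most `2‖f‖`, times a
probability that tends to zero. -/
lemma tendsto_integral_of_hasCompactSupport [IsProbabilityMeasure ν] (h : IsExtremal α σ ν ℓ M)
    {p G : ℝ → ℝ} (hp : HasDominatedDensity ν p G) {β : ℝ} (hβ : 0 < β) {m : ℕ → ℝ}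
    (hm : ∀ n, 0 ≤ m n) (hlim : Tendsto (fun n : ℕ => m n / (n : ℝ)) atTop (𝓝 α))
    (f : BoundedContinuousFunction ℝ ℝ) (hfc : HasCompactSupport f) :
    Tendsto (fun n : ℕ => ∫ x, f (x / √(n : ℝ)) ∂(meanEmpirical β (m n) (σ * √(n : ℝ)) n))
      atTop (𝓝 (∫ x, f x ∂ν)) := by
  rw [Metric.tendsto_atTop']
  intro ε hε
  have hfar := h.tendsto_restrictedLaw_far hp hβ hm hlim f.continuous hfc (half_pos hε)
  have hfar' := (ENNReal.tendsto_toReal ENNReal.zero_ne_top).comp hfar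
  rw [ENNReal.toReal_zero] at hfar'
  have hfar2 := hfar'.const_mul (2 * ‖f‖)
  rw [mul_zero] at hfar2
  obtain ⟨N, hN⟩ := eventually_atTop.1 ((hfar2.eventually (gt_mem_nhds (half_pos hε))).and
    (h.eventually_partition hp hβ hm hlim))
  refine ⟨N, fun n hn => ?_⟩
  obtain ⟨h1, hn0, hfin, hpos⟩ := hN n hn.le
  have := isProbabilityMeasure_restrictedLaw hn0 hfin hpos
  rw [Real.dist_eq, integral_meanEmpirical]
  have hb : ∀ x : Fin n → ℝ, |∫ t, f t ∂(empirical n x) - ∫ t, f t ∂ν| ≤ 2 * ‖f‖ := by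
    intro x
    have := isProbabilityMeasure_empirical hn0 x
    have e1 := f.norm_integral_le_norm (empirical n x)
    have e2 := f.norm_integral_le_norm ν
    rw [Real.norm_eq_abs] at e1 e2
    have := abs_sub (∫ t, f t ∂(empirical n x)) (∫ t, f t ∂ν)
    linarith
  have hF : Measurable fun y : Fin n → ℝ => ∫ t, f t ∂(empirical n ((√(n : ℝ))⁻¹ • y)) := by
    simp only [integral_empirical]
    have hfm := f.continuous.measurable
    have hsum : Measurable fun x : Fin n → ℝ => ∑ i, f ((√(n : ℝ))⁻¹ * x i) :=
      Finset.measurable_fun_sum _ fun i _ => hfm.comp ((measurable_pi_apply i).const_mul _)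
    exact hsum.const_mul _
  have h2 := abs_integral_sub_le (P := restrictedLaw β (m n) (σ * √(n : ℝ)) n) hF
    (half_pos hε).le fun y => hb _
  refine h2.trans_lt ?_
  simp only [Function.comp_apply] at h1
  linarith

end IsExtremal

/-- A trapezoidal cutoff function. -/
noncomputable def cutoff (R x : ℝ) : ℝ := max 0 (min 1 (R + 1 - |x|))

lemma continuous_cutoff (R : ℝ) : Continuous (cutoff R) := by
  unfold cutoff; fun_prop

lemma cutoff_mem (R x : ℝ) : 0 ≤ cutoff R x ∧ cutoff R x ≤ 1 :=
  ⟨le_max_left _ _, max_le zero_le_one (min_le_left _ _)⟩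

lemma cutoff_eq_one {R x : ℝ} (h : |x| ≤ R) : cutoff R x = 1 := by
  unfold cutoff
  rw [min_eq_left (by linarith), max_eq_right zero_le_one]

lemma hasCompactSupport_cutoff (R : ℝ) : HasCompactSupport (cutoff R) := by
  refine HasCompactSupport.of_support_subset_isCompact (isCompact_Icc (a := -(R + 1)) (b := R + 1))
    fun x hx => ?_
  by_contra hn
  apply hx
  have : R + 1 < |x| := by
    by_contra! hle
    exact hn (abs_le.1 hle)
  unfold cutoff
  exact max_eq_left ((min_le_right _ _).trans (by linarith))

/-- The cutoff as a bounded continuous function. -/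
noncomputable def cutoffBCF (R : ℝ) : BoundedContinuousFunction ℝ ℝ :=
  BoundedContinuousFunction.ofNormedAddCommGroup (cutoff R) (continuous_cutoff R) 1 fun x => by
    rw [Real.norm_of_nonneg (cutoff_mem R x).1]
    exact (cutoff_mem R x).2

namespace IsExtremal

variable {α σ ℓ M : ℝ} {ν : Measure ℝ}

/-- The rescaled mean empirical measures converge weakly to the extremal measure. -/
theorem tendsto_integral_meanEmpirical [IsProbabilityMeasure ν] (h : IsExtremal α σ ν ℓ M)
    {p G : ℝ → ℝ} (hp : HasDominatedDensity ν p G) {β : ℝ} (hβ : 0 < β) {m : ℕ → ℝ}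
    (hm : ∀ n, 0 ≤ m n) (hlim : Tendsto (fun n : ℕ => m n / (n : ℝ)) atTop (𝓝 α))
    {R : ℝ} (hR : ∀ᵐ x ∂ν, |x| ≤ R) (f : BoundedContinuousFunction ℝ ℝ) :
    Tendsto (fun n : ℕ => ∫ x, f (x / √(n : ℝ)) ∂(meanEmpirical β (m n) (σ * √(n : ℝ)) n))
      atTop (𝓝 (∫ x, f x ∂ν)) := by
  have hc1 := h.tendsto_integral_of_hasCompactSupport hp hβ hm hlim (cutoffBCF R)
    (hasCompactSupport_cutoff R)
  have hc2 := h.tendsto_integral_of_hasCompactSupport hp hβ hm hlim (f * cutoffBCF R)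
    (HasCompactSupport.mul_left (f := f) (hasCompactSupport_cutoff R))
  have hv1 : ∫ x, cutoffBCF R x ∂ν = 1 := by
    have : ∫ x, cutoffBCF R x ∂ν = ∫ _, (1 : ℝ) ∂ν :=
      integral_congr_ae (hR.mono fun x hx => cutoff_eq_one hx)
    simpa using this
  have hv2 : ∫ x, (f * cutoffBCF R) x ∂ν = ∫ x, f x ∂ν := by
    refine integral_congr_ae (hR.mono fun x hx => ?_)
    have : cutoffBCF R x = 1 := cutoff_eq_one hx
    simp [this]
  rw [hv1] at hc1
  rw [hv2] at hc2
  -- Replacing `f` by `f` times the cutoff costs at most `‖f‖` times the missing mass. That mass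
  -- tends to zero, by the compactly supported case applied to the cutoff itself, so no separate
  -- tightness estimate is needed.
  have herr := ((tendsto_const_nhds (x := (1 : ℝ))).sub hc1).const_mul ‖f‖
  rw [sub_self, mul_zero] at herr
  have hdiff : Tendsto (fun n : ℕ =>
      ∫ x, f (x / √(n : ℝ)) ∂(meanEmpirical β (m n) (σ * √(n : ℝ)) n) -
        ∫ x, (f * cutoffBCF R) (x / √(n : ℝ)) ∂(meanEmpirical β (m n) (σ * √(n : ℝ)) n))
      atTop (𝓝 0) := by
    refine squeeze_zero_norm' ?_ herr
    filter_upwards [h.eventually_partition hp hβ hm hlim] with n hn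
    obtain ⟨hn0, hfin, hpos⟩ := hn
    have hprob := isProbabilityMeasure_restrictedLaw hn0 hfin hpos
    have hP : IsProbabilityMeasure (meanEmpirical β (m n) (σ * √(n : ℝ)) n) := by
      constructor
      have : ∀ i : Fin n, ((restrictedLaw β (m n) (σ * √(n : ℝ)) n).map fun x => x i) Set.univ = 1 :=
        fun i => by
          rw [Measure.map_apply (measurable_pi_apply i) MeasurableSet.univ, Set.preimage_univ,
            measure_univ]
      simp only [meanEmpirical, Measure.smul_apply, Measure.coe_finsetSum, Finset.sum_apply, this,
        smul_eq_mul, Finset.sum_const, Finset.card_univ, Fintype.card_fin, nsmul_eq_mul, mul_one]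
      exact ENNReal.inv_mul_cancel (by exact_mod_cast hn0.ne') (by simp)
    have hi : ∀ g : BoundedContinuousFunction ℝ ℝ, Integrable (fun x => g (x / √(n : ℝ)))
        (meanEmpirical β (m n) (σ * √(n : ℝ)) n) := fun g =>
      Integrable.of_bound (g.continuous.comp (continuous_id.div_const _)).aestronglyMeasurable ‖g‖
        (ae_of_all _ fun y => g.norm_coe_le_norm _)
    rw [← integral_sub (hi f) (hi _)]
    have h1 : ∫ x, (1 - cutoffBCF R (x / √(n : ℝ))) ∂(meanEmpirical β (m n) (σ * √(n : ℝ)) n) =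
        1 - ∫ x, cutoffBCF R (x / √(n : ℝ)) ∂(meanEmpirical β (m n) (σ * √(n : ℝ)) n) := by
      rw [integral_sub (integrable_const _) (hi _)]
      simp
    rw [← h1, ← integral_const_mul]
    refine norm_integral_le_of_norm_le
      (((integrable_const (1 : ℝ)).sub (hi (cutoffBCF R))).const_mul _) (ae_of_all _ fun x => ?_)
    have hcut : cutoffBCF R (x / √(n : ℝ)) ≤ 1 := (cutoff_mem R _).2
    have e : f (x / √(n : ℝ)) - (f * cutoffBCF R) (x / √(n : ℝ)) =
        f (x / √(n : ℝ)) * (1 - cutoffBCF R (x / √(n : ℝ))) := by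
      rw [BoundedContinuousFunction.mul_apply]; ring
    rw [e, norm_mul, Real.norm_of_nonneg (by linarith : 0 ≤ 1 - cutoffBCF R (x / √(n : ℝ)))]
    exact mul_le_mul_of_nonneg_right (f.norm_coe_le_norm _) (by linarith)
  have := hdiff.add hc2
  simpa using this

end IsExtremal

/-! ### The limit law as an extremal measure -/

namespace AdmissiblePair

variable {α a b : ℝ}

lemma exists_isLogRegular_limitLaw (h : AdmissiblePair α a b) :
    ∃ M, IsLogRegular (limitLaw α a b) M := by
  have := isProbabilityMeasure_limitLaw h
  obtain ⟨M, hM⟩ := limitLaw_rpow_bound h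
  refine ⟨M, ?_, fun x => ?_, fun x => (hM x).1, fun x => (hM x).2⟩
  · refine Integrable.of_bound (by fun_prop : Measurable fun x : ℝ => x ^ 2).aestronglyMeasurable
      ((|a| + |b|) ^ 2) ?_
    filter_upwards [limitLaw_ae_mem α a b] with x hx
    rw [Real.norm_of_nonneg (sq_nonneg x)]
    apply sq_le_sq'
    · linarith [hx.1, neg_abs_le a, abs_nonneg b]
    · linarith [hx.2, le_abs_self b, abs_nonneg a]
  · exact withDensity_absolutelyContinuous _ _
      (Measure.absolutelyContinuous_of_le Measure.restrict_le_self Real.volume_singleton)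

lemma isExtremal_limitLaw (h : AdmissiblePair α a b) {σ : ℝ} (hσ : 0 ≤ σ ∨ α = 0) (hσa : σ ≤ a)
    (hedge : σ < a → phiFun α b a = 0) {M : ℝ} (hM : IsLogRegular (limitLaw α a b) M) :
    IsExtremal α σ (limitLaw α a b)
      (realField α a - 2 * logPotential (limitLaw α a b) a) M where
  nonneg := h.nonneg
  domain := hσ
  regular := hM
  mem := (limitLaw_ae_mem α a b).mono fun _ hx =>
    ⟨hσa.trans hx.1.le, fun hα => (h.left_pos hα).trans hx.1⟩
  le _ hx h0 := effectivePotential_ge h (fun hxa => hedge (hx.trans_lt hxa)) h0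
  eq := (limitLaw_ae_mem α a b).mono fun _ hx =>
    effectivePotential_eq h (Set.Ioc_subset_Icc_self hx)

lemma exists_hasDominatedDensity_limitLaw (h : AdmissiblePair α a b) :
    ∃ p G, HasDominatedDensity (limitLaw α a b) p G := by
  have := isProbabilityMeasure_limitLaw h
  obtain ⟨M, hM⟩ := h.exists_isLogRegular_limitLaw
  obtain ⟨C, hC, hle⟩ := limitDensity_le h
  -- `exp G` is the bound `C (x - a)^(-1/2)` of the density, as `Real.log (a - x)` is the logarithm
  -- of the absolute value; `G` is integrable because the logarithmic potential at `a` is finite.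
  refine ⟨(Set.Ioc a b).indicator (limitDensity α a b),
    fun x => Real.log C - 1 / 2 * Real.log (a - x),
    (measurable_limitDensity α a b).indicator measurableSet_Ioc, fun x => ?_,
    (integrableOn_limitDensity h).integrable_indicator measurableSet_Ioc, ?_,
    by fun_prop, fun x => ?_, (integrable_const _).sub ((hM.integrable_log a).const_mul _)⟩
  · exact Set.indicator_nonneg (fun y hy => limitDensity_nonneg h hy.1.le) x
  · unfold limitLaw
    rw [← withDensity_indicator measurableSet_Ioc]
    congr 1
    ext x
    simp only [Set.indicator_apply]
    split_ifs <;> simp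
  · by_cases hx : x ∈ Set.Ioc a b
    · rw [Set.indicator_of_mem hx]
      refine (hle x hx.1 hx.2).trans (le_of_eq ?_)
      have hxa : 0 < x - a := sub_pos.2 hx.1
      rw [Real.exp_sub, Real.exp_log hC, ← Real.log_neg_eq_log, neg_sub, div_eq_mul_inv]
      congr 2
      rw [one_div_mul_eq_div, ← Real.log_sqrt hxa.le, Real.exp_log (Real.sqrt_pos.2 hxa)]
    · rw [Set.indicator_of_notMem hx]
      exact Real.exp_nonneg _

end AdmissiblePair

theorem theorem5p1 (β α σ : ℝ) (hβ : 0 < β) (μ : ℕ → ℝ) (hμ : ∀ n, 0 ≤ μ n)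
    (hlim : Tendsto (fun n : ℕ => μ n / (n : ℝ)) atTop (𝓝 α))
    (hσ : 0 ≤ σ ∨ α = 0) :
    (∃! p : ℝ × ℝ, IsEndpoints α σ p.1 p.2) ∧
    ∀ a b : ℝ, IsEndpoints α σ a b →
      (∀ x ∈ Set.Ioc a b, 0 ≤ limitDensity α a b x) ∧
      IsProbabilityMeasure (limitLaw α a b) ∧
      (limitLaw α a b).support = Set.Icc a b ∧
      (∀ ν : Measure ℝ,
        IsEquilibriumMeasure (Set.Ici σ) (externalField α) ν ↔ ν = limitLaw α a b) ∧
      ∀ f : BoundedContinuousFunction ℝ ℝ,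
        Tendsto (fun n : ℕ => ∫ x, f (x / √(n : ℝ)) ∂(meanEmpirical β (μ n) (σ * √(n : ℝ)) n))
          atTop (𝓝 (∫ x, f x ∂(limitLaw α a b))) := by
  have hα : 0 ≤ α := ge_of_tendsto' hlim fun n => div_nonneg (hμ n) (Nat.cast_nonneg n)
  refine ⟨existsUnique_isEndpoints hα σ, fun a b hab => ?_⟩
  obtain ⟨hlt, hσa, ha0, hφ, hψ, hedge⟩ := IsEndpoints.facts hα hab
  have h : AdmissiblePair α a b := ⟨hα, ha0, hlt, hφ, hψ⟩
  have hprob := isProbabilityMeasure_limitLaw h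
  obtain ⟨M, hM⟩ := h.exists_isLogRegular_limitLaw
  have hext := h.isExtremal_limitLaw hσ hσa hedge hM
  obtain ⟨p, G, hp⟩ := h.exists_hasDominatedDensity_limitLaw
  refine ⟨fun x hx => limitDensity_nonneg h hx.1.le, hprob, support_limitLaw h,
    hext.isEquilibriumMeasure_iff, fun f => ?_⟩
  refine hext.tendsto_integral_meanEmpirical hp hβ hμ hlim (R := |a| + |b|) ?_ f
  filter_upwards [limitLaw_ae_mem α a b] with x hx
  rw [abs_le]
  constructor
  · linarith [hx.1, neg_abs_le a, abs_nonneg b]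
  · linarith [hx.2, le_abs_self b, abs_nonneg a]
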